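/- Let $a,\rho>0$, let $\mathbf 1_\rho$ be the indicator function of the disc $\{|x|\le\rho\}\subset\mathbb R^2$, and let $P=-\Delta-a^2\mathbf 1_\rho$ on $\mathbb R^2$. Let $J_\ell,Y_\ell$ be the Bessel functions, $H^{(1)}_\ell=J_\ell+iY_\ell$, $H^{(2)}_\ell=J_\ell-iY_\ell$, and $\gamma=-\Gamma'(1)$ Euler's constant. A solution of $Pu=0$ is called outgoing if $u(r,\theta)=\sum_{\ell\in\mathbb Z}c_\ell r^{-|\ell|}e^{i\ell\theta}$ for large $r$. $P$ has a resonance at zero if there is an outgoing solution $u\not\equiv0$; an $s$-resonance if there is one with $c_0\ne0$; a $p$-resonance if there is one with $c_0=0$ and $|c_1|+|c_{-1}|>0$. For $\lambda>0$ the scattering matrix $S(\lambda)$ is the bounded operator on $L^2(S^1)$ that maps $\sum_\ell d_\ell e^{i\ell\theta}$ to $\sum_\ell c_\ell e^{i\ell\theta}$ whenever $(P-\lambda^2)u=0$ has a solution with $u(r,\theta)=\sum_\ell\big(c_\ell H^{(1)}_\ell(\lambda r)+d_\ell H^{(2)}_\ell(\lambda r)\big)e^{i\ell\theta}$ for large $r$.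 Each $e^{i\ell\theta}$ is an eigenfunction of it; its eigenvalue is written $e^{2\pi i\sigma_\ell(\lambda)}$ with $\sigma_\ell$ real and continuous on $[0,\infty)$ and $\sigma_\ell(0)=0$. The scattering phase is $\sigma(\lambda)=\frac1{2\pi i}\log\det S(\lambda)=\sum_{\ell\in\mathbb Z}\sigma_\ell(\lambda)$. Then the scattering phase is well defined (the series converges absolutely) and differentiable on $(0,\infty)$; $P$ has a $p$-resonance at zero if and only if $J_0(a\rho)=0$, and an $s$-resonance at zero if and only if $J_1(a\rho)=0$. Moreover, as $\lambda\downarrow0$: 1. If $P$ has no resonance at zero, then $$\sigma'(\lambda)=\frac{-1}{\lambda}\,\frac{2}{4(\log\lambda+b)^2+\pi^2}+O(\lambda),\qquad b=C(\rho,a)-\log2+\gamma,\qquad C(\rho,a)=\log\rho+\frac{J_0(a\rho)}{a\rho\,J_1(a\rho)}.$$ 2. If $P$ has a $p$-resonance at zero, then $$\sigma'(\lambda)=\frac{-1}{\lambda}\Big(\frac{2}{4(\log\lambda+\log(\rho/2)+\gamma)^2+\pi^2}+\frac{1}{(\log\lambda+\log(\rho/2)+\gamma-\frac12)^2+\frac{\pi^2}4}\Big)+O(\lambda).$$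 3. If $P$ has an $s$-resonance at zero, then $\sigma'(\lambda)=-\frac32\rho^2\lambda+O(\lambda^3\log\lambda)$. In more detail, as $\lambda\downarrow0$, $$\sigma'(\lambda)=\begin{cases}\dfrac{-2/\lambda}{4(\log(\lambda\rho/2)+\gamma)^2+\pi^2}+\dfrac{-4/\lambda}{4(\log(\lambda\rho/2)-\frac12+\gamma)^2+\pi^2}+O\big(\lambda/(\log\lambda)^2\big),&J_0(a\rho)=0,\\[2mm]-\frac32\rho^2\lambda+O(\lambda^3\log\lambda),&J_1(a\rho)=0,\\[2mm]\dfrac{-2/\lambda}{4(\log(\lambda/2)+C(\rho,a)+\gamma)^2+\pi^2}+\dfrac{J_2(a\rho)}{J_0(a\rho)}\rho^2\lambda+O\big(\lambda/(\log\lambda)^2\big),&\text{otherwise.}\end{cases}$$ -/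

import Mathlib

open Set Filter Topology MeasureTheory Asymptotics
open scoped Nat Real ContDiff Laplacian

noncomputable section

namespace CircularWell

/-! ### Bessel and Hankel functions of integer order, on the positive half-line -/

/-- The Bessel function of the first kind `J_n`, `n = 0, 1, 2, …`, by its power series. -/
def besselJNat (n : ℕ) (x : ℝ) : ℝ :=
  ∑' k : ℕ, (-1 : ℝ) ^ k / ((k ! : ℝ) * ((n + k)! : ℝ)) * (x / 2) ^ (2 * k + n)

/-- The digamma value `ψ(m + 1) = H_m - γ`, with `H_m` the `m`-th harmonic number. -/
def digammaSucc (m : ℕ) : ℝ := (harmonic m : ℝ) - Real.eulerMascheroniConstant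

/-- The Bessel function of the second kind (Weber's function) `Y_n`, `n = 0, 1, 2, …`,
for `x > 0`, by its standard series
`π Y_n(x) = 2 log(x/2) J_n(x) - ∑_{k<n} (n-k-1)!/k! (x/2)^{2k-n}
  - ∑_{k≥0} (ψ(k+1) + ψ(n+k+1)) (-1)^k/(k!(n+k)!) (x/2)^{2k+n}`. -/
def besselYNat (n : ℕ) (x : ℝ) : ℝ :=
  π⁻¹ * (2 * Real.log (x / 2) * besselJNat n x
    - ∑ k ∈ Finset.range n,
        ((n - k - 1)! : ℝ) / (k ! : ℝ) * (x / 2) ^ (2 * (k : ℤ) - (n : ℤ))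
    - ∑' k : ℕ, (digammaSucc k + digammaSucc (n + k)) *
        ((-1 : ℝ) ^ k / ((k ! : ℝ) * ((n + k)! : ℝ))) * (x / 2) ^ (2 * k + n))

/-- `J_ℓ` for integer `ℓ`, with `J_{-n} = (-1)^n J_n`. -/
def besselJ (l : ℤ) (x : ℝ) : ℝ :=
  if 0 ≤ l then besselJNat l.natAbs x else (-1) ^ l.natAbs * besselJNat l.natAbs x

/-- `Y_ℓ` for integer `ℓ`, with `Y_{-n} = (-1)^n Y_n`. -/
def besselY (l : ℤ) (x : ℝ) : ℝ :=
  if 0 ≤ l then besselYNat l.natAbs x else (-1) ^ l.natAbs * besselYNat l.natAbs x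

/-- The Hankel function `H_ℓ^{(1)} = J_ℓ + i Y_ℓ`. -/
def hankel1 (l : ℤ) (x : ℝ) : ℂ := (besselJ l x : ℂ) + Complex.I * (besselY l x : ℂ)

/-- The Hankel function `H_ℓ^{(2)} = J_ℓ - i Y_ℓ`. -/
def hankel2 (l : ℤ) (x : ℝ) : ℂ := (besselJ l x : ℂ) - Complex.I * (besselY l x : ℂ)

/-! ### The Schrödinger equation in the plane

The plane `ℝ²` is `ℂ` with its Euclidean norm, Lebesgue measure and Laplacian. -/

/-- The circular well of depth `a²` and radius `ρ`. -/
def circularWell (a ρ : ℝ) (z : ℂ) : ℝ := if ‖z‖ ≤ ρ then -a ^ 2 else 0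

/-- `u` solves `(-Δ + V - E) u = 0` on the plane, in the sense of distributions. For bounded `V`
every solution is locally in `H²`, so it has a continuous representative; `u` is that one. -/
structure IsSolution (V : ℂ → ℝ) (E : ℝ) (u : ℂ → ℂ) : Prop where
  continuous : Continuous u
  weak : ∀ η : ℂ → ℂ, ContDiff ℝ ∞ η → HasCompactSupport η →
    ∫ z, u z * (-(Δ η z) + ((V z - E : ℝ) : ℂ) * η z) = 0

/-- The coefficient of `e^{iℓθ}` in the Fourier series of `θ ↦ u(r cos θ, r sin θ)`. -/
def angularMode (u : ℂ → ℂ) (l : ℤ) (r : ℝ) : ℂ :=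
  (2 * (π : ℂ))⁻¹ * ∫ θ in (0 : ℝ)..(2 * π),
    u ((r : ℂ) * Complex.exp (Complex.I * (θ : ℂ))) *
      Complex.exp (-(Complex.I * (l : ℂ) * (θ : ℂ)))

/-- For all large `r`,
`u(r, θ) = ∑_ℓ (c_ℓ H_ℓ^{(1)}(lam r) + d_ℓ H_ℓ^{(2)}(lam r)) e^{iℓθ}`:
the `c_ℓ` are the outgoing amplitudes of `u` and the `d_ℓ` its incoming amplitudes. -/
def HasExpansion (lam : ℝ) (u : ℂ → ℂ) (c d : ℤ → ℂ) : Prop :=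
  ∃ R : ℝ, 0 < R ∧ ∀ r : ℝ, R < r → ∀ l : ℤ,
    angularMode u l r = c l * hankel1 l (lam * r) + d l * hankel2 l (lam * r)

/-! ### Resonances at zero energy -/

/-- For all large `r`, `u(r, θ) = ∑_ℓ c_ℓ r^{-|ℓ|} e^{iℓθ}`: `u` is outgoing at zero energy. -/
def HasOutgoingExpansionZero (u : ℂ → ℂ) (c : ℤ → ℂ) : Prop :=
  ∃ R : ℝ, 0 < R ∧ ∀ r : ℝ, R < r → ∀ l : ℤ, angularMode u l r = c l * (r : ℂ) ^ (-|l|)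

/-- `-Δ + V` has a resonance at zero: a nontrivial outgoing solution of `(-Δ + V) u = 0`.
(Zero eigenvalues are included.) -/
def HasZeroResonance (V : ℂ → ℝ) : Prop :=
  ∃ (u : ℂ → ℂ) (c : ℤ → ℂ), IsSolution V 0 u ∧ HasOutgoingExpansionZero u c ∧ u ≠ 0

/-- `-Δ + V` has an `s`-resonance at zero. -/
def HasSResonance (V : ℂ → ℝ) : Prop :=
  ∃ (u : ℂ → ℂ) (c : ℤ → ℂ), IsSolution V 0 u ∧ HasOutgoingExpansionZero u c ∧ c 0 ≠ 0

/-- `-Δ + V` has a `p`-resonance at zero. -/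
def HasPResonance (V : ℂ → ℝ) : Prop :=
  ∃ (u : ℂ → ℂ) (c : ℤ → ℂ), IsSolution V 0 u ∧ HasOutgoingExpansionZero u c ∧
    c 0 = 0 ∧ (c 1 ≠ 0 ∨ c (-1) ≠ 0)

/-! ### The scattering matrix and the scattering phase -/

instance fact_two_pi_pos : Fact (0 < 2 * π) := ⟨Real.two_pi_pos⟩

/-- `L²` of the unit circle, with normalized arc length. -/
abbrev L2Circle : Type := Lp ℂ 2 (AddCircle.haarAddCircle (T := 2 * π))

/-- The basis function `e^{iℓθ}` of `L²` of the circle. -/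
def angularBasis (l : ℤ) : L2Circle := fourierLp (T := 2 * π) 2 l

/-- `S` is the scattering matrix of `-Δ + V` at frequency `lam`: it is the bounded operator
which takes the incoming amplitudes to the outgoing amplitudes of solutions of
`(-Δ + V - lam²) u = 0`. Being bounded it is determined by its values on the basis `e^{iℓθ}`:
the solution with incoming amplitudes those of `e^{iℓθ}` has as outgoing
amplitudes the Fourier coefficients of `S e^{iℓθ}`. -/
def IsScatteringMatrix (V : ℂ → ℝ) (lam : ℝ) (S : L2Circle →L[ℂ] L2Circle) : Prop :=
  ∀ l : ℤ, ∃ u : ℂ → ℂ, IsSolution V (lam ^ 2) u ∧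
    HasExpansion lam u (fun m => fourierCoeff (S (angularBasis l)) m) (Pi.single l 1)

/-- `f` is the phase shift, in the mode `e^{iℓθ}`, of the family `S(lam)`, `lam > 0`:
`e^{2πi f(lam)}` is the eigenvalue of `S(lam)` with eigenvector `e^{iℓθ}`, `f` is continuous, and
`f(0) = 0`. -/
structure IsPhaseShift (S : ℝ → L2Circle →L[ℂ] L2Circle) (l : ℤ) (f : ℝ → ℝ) : Prop where
  continuousOn : ContinuousOn f (Ici 0)
  zero : f 0 = 0
  eigenvalue : ∀ lam : ℝ, 0 < lam →
    S lam (angularBasis l) =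
      Complex.exp (2 * (π : ℂ) * Complex.I * (f lam : ℂ)) • angularBasis l

/-- `σ` is the scattering phase of `-Δ + V` with radial `V`: the absolutely convergent sum of the
phase shifts of the scattering matrix, that is `(2πi)⁻¹ log det S`, normalized to vanish at `0`. -/
def IsScatteringPhase (V : ℂ → ℝ) (σ : ℝ → ℝ) : Prop :=
  ∃ S : ℝ → L2Circle →L[ℂ] L2Circle, (∀ lam : ℝ, 0 < lam → IsScatteringMatrix V lam (S lam)) ∧
    ∃ f : ℤ → ℝ → ℝ, (∀ l : ℤ, IsPhaseShift S l (f l)) ∧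
      ∀ lam : ℝ, 0 ≤ lam → HasSum (fun l : ℤ => f l lam) (σ lam)

/-- The constant `C(ρ, a) = log ρ + J₀(aρ) / (aρ J₁(aρ))`. -/
def wellConst (ρ a : ℝ) : ℝ :=
  Real.log ρ + 1 / (a * ρ) * (besselJ 0 (a * ρ) / besselJ 1 (a * ρ))

end CircularWell

end

open CircularWell

noncomputable section

namespace CircularWell

/-! Separation of variables reduces everything to one radial equation. For u = r^n e^{±inθ} g(r²)
and t = r², the equation on either side of r = ρ is t g'' + (n+1) g' + k g = 0 with k constant. It
is solved by C_n(kt) and D_n(kt), which are J_n and π Y_n stripped of the factor (x/2)^n. In this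
normalisation differentiation is the index shift f_n ↦ -f_{n+1}, both families obey the same
three-term recurrence, and the Wronskian is explicit: s^{n+1} (C_{n+1} D_n - C_n D_{n+1}) = 1
(`wronskian`).

Put s = λ²ρ²/4 and A = a²ρ²/4. Matching value and derivative at r = ρ with the regular interior
solution produces two real determinants N_n and M_n, and the scattering eigenvalue in the modes ±n
is (M_n + iπN_n)/(M_n - iπN_n). Its phase has s-derivative (N'M - NM')/(M² + π²N²). The Wronskian
collapses the numerator to a product of values of C at s + A, which is `phaseDensity`
(`hasDerivAt_scatteringEigenvalue`).

As s → 0, M_0 behaves like A C_1(A) (log s + 2γ) + C_0(A), and πN_0 tends to π A C_1(A); this gives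
the 1/(log² + π²) profile of mode 0. For n ≥ 1, s^n M_n tends to (n-1)! C_{n-1}(A) while s^n N_n =
O(s^n). So mode n is exceptional exactly when J_{n-1}(aρ) = 0, that is, when r^{-n} continues to a
regular solution at zero energy. If J_0(aρ) = 0, a logarithm appears in the modes ±1 as well. If
J_1(aρ) = 0, the logarithm disappears from mode 0 and the modes ±2 contribute a linear term. From n
= 3 on, extra powers of s in the numerator make every case negligible. Hence only |ℓ| ≤ 2 matters,
up to O(λ³ log λ).

Two further ingredients are needed. Solutions are only continuous and weak, so the radial picture is
justified by approximation: a C¹-matched profile is a limit of smooth profiles whose radial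
operators stay bounded (`exists_smooth_approx`). Thus matched profiles are weak solutions
(`isSolution_separated`), and testing an arbitrary solution against a cut-off matched profile forces
each of its modes to match (`IsSolution.mode_matched`); no regularity theory is used. Finally, C_n
is comparable to 1/n! and s^n D_n to (n-1)! for large n, uniformly on bounded sets. This bounds the
densities by s S^j/j! up to a constant (`exists_phaseDensity_le`), so the series of phase shifts
converges and may be differentiated term by term. -/

/-! ### Alternating exponential series with bounded coefficients -/

/-- The series `∑ b_k (-s)^k / k!`. -/
def altExp (b : ℕ → ℝ) (s : ℝ) : ℝ := ∑' k : ℕ, b k * ((-s) ^ k / (k ! : ℝ))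

lemma norm_altExp_term_le {b : ℕ → ℝ} {B : ℝ} (hb : ∀ k, |b k| ≤ B) {s R : ℝ} (hs : |s| ≤ R)
    (k : ℕ) : ‖b k * ((-s) ^ k / (k ! : ℝ))‖ ≤ B * (R ^ k / (k ! : ℝ)) := by
  have hB : 0 ≤ B := (abs_nonneg _).trans (hb 0)
  rw [norm_mul, norm_div, norm_pow, norm_neg, Real.norm_eq_abs, Real.norm_eq_abs,
    Real.norm_eq_abs, Nat.abs_cast]
  gcongr
  exact hb k

lemma summable_altExp {b : ℕ → ℝ} {B : ℝ} (hb : ∀ k, |b k| ≤ B) (s : ℝ) :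
    Summable fun k : ℕ => b k * ((-s) ^ k / (k ! : ℝ)) :=
  .of_norm_bounded ((Real.summable_pow_div_factorial |s|).mul_left B)
    fun k => norm_altExp_term_le hb le_rfl k

lemma abs_altExp_le {b : ℕ → ℝ} {B : ℝ} (hb : ∀ k, |b k| ≤ B) (s : ℝ) :
    |altExp b s| ≤ B * Real.exp |s| := by
  have h : HasSum (fun k : ℕ => B * (|s| ^ k / (k ! : ℝ))) (B * Real.exp |s|) := by
    rw [Real.exp_eq_exp_ℝ]
    exact (NormedSpace.expSeries_div_hasSum_exp (𝔸 := ℝ) |s|).mul_left B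
  exact tsum_of_norm_bounded h fun k => norm_altExp_term_le hb le_rfl k

lemma altExp_zero (b : ℕ → ℝ) : altExp b 0 = b 0 := by
  rw [altExp, tsum_eq_single 0]
  · simp
  · intro k hk
    simp [hk]

lemma altExp_add {b c : ℕ → ℝ} {B C : ℝ} (hb : ∀ k, |b k| ≤ B) (hc : ∀ k, |c k| ≤ C) (s : ℝ) :
    altExp b s + altExp c s = altExp (fun k => b k + c k) s := by
  simp only [altExp, add_mul]
  exact ((summable_altExp hb s).tsum_add (summable_altExp hc s)).symm

lemma altExp_const_mul (r : ℝ) (b : ℕ → ℝ) (s : ℝ) :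
    r * altExp b s = altExp (fun k => r * b k) s := by
  simp only [altExp, mul_assoc]
  exact tsum_mul_left.symm

/-- Multiplication by s raises the power by one, so it becomes an operation on coefficients;
recurrences in s then reduce to identities between coefficients. The truncated index k - 1 at k = 0
is harmless because of the factor k. -/
lemma mul_altExp {b : ℕ → ℝ} {B : ℝ} (hb : ∀ k, |b k| ≤ B) (s : ℝ) :
    s * altExp b s = altExp (fun k => -(k * b (k - 1))) s := by
  have key : ∀ k : ℕ, -(((k + 1 : ℕ) : ℝ) * b (k + 1 - 1)) * ((-s) ^ (k + 1) / ((k + 1)! : ℝ)) =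
      s * (b k * ((-s) ^ k / (k ! : ℝ))) := by
    intro k
    rw [Nat.factorial_succ, Nat.add_sub_cancel]
    push_cast
    field_simp
    ring
  have hsum : Summable fun k : ℕ => -((k : ℝ) * b (k - 1)) * ((-s) ^ k / (k ! : ℝ)) := by
    rw [← summable_nat_add_iff 1]
    simp only [key]
    exact (summable_altExp hb s).mul_left s
  rw [altExp, altExp, hsum.tsum_eq_zero_add, ← tsum_mul_left, tsum_congr key]
  simp

lemma altExp_sub_coeff_zero {b : ℕ → ℝ} {B : ℝ} (hb : ∀ k, |b k| ≤ B) (s : ℝ) :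
    altExp b s = b 0 - s * altExp (fun k => b (k + 1) / (k + 1)) s := by
  rw [altExp, (summable_altExp hb s).tsum_eq_zero_add, altExp, ← tsum_mul_left, sub_eq_add_neg,
    ← tsum_neg]
  congr 1
  · simp
  · refine tsum_congr fun k => ?_
    rw [Nat.factorial_succ]
    push_cast
    field_simp
    ring

/-- Because of the weights 1/k!, termwise differentiation only shifts the coefficients, up to sign,
so the class of bounded sequences is preserved. -/
lemma hasDerivAt_altExp {b : ℕ → ℝ} {B : ℝ} (hb : ∀ k, |b k| ≤ B) (s : ℝ) :
    HasDerivAt (altExp b) (-altExp (fun k => b (k + 1)) s) s := by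
  have hB : 0 ≤ B := (abs_nonneg _).trans (hb 0)
  set R := |s| + 1
  have hder : ∀ (k : ℕ) (y : ℝ), HasDerivAt (fun y : ℝ => b k * ((-y) ^ k / (k ! : ℝ)))
      (b k * (k * (-y) ^ (k - 1) * (-1) / (k ! : ℝ))) y := by
    intro k y
    exact (((hasDerivAt_neg y).pow k).div_const _).const_mul _
  have hkey : ∀ (k : ℕ) (y : ℝ), b (k + 1) * (((k + 1 : ℕ) : ℝ) * (-y) ^ (k + 1 - 1) * (-1) /
      ((k + 1)! : ℝ)) = -(b (k + 1) * ((-y) ^ k / (k ! : ℝ))) := by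
    intro k y
    rw [Nat.factorial_succ, Nat.add_sub_cancel]
    push_cast
    field_simp
  -- A summable majorant of the differentiated terms on (-R, R); the constant term differentiates to
  -- zero.
  let u : ℕ → ℝ := fun k => if k = 0 then 0 else B * (R ^ (k - 1) / ((k - 1)! : ℝ))
  have hu : Summable u := by
    rw [← summable_nat_add_iff 1]
    simpa [u] using (Real.summable_pow_div_factorial R).mul_left B
  have h := hasDerivAt_tsum_of_isPreconnected (t := Ioo (-R) R) hu isOpen_Ioo isPreconnected_Ioo
    (fun k y _ => hder k y) (fun k y hy => ?_) (y₀ := 0) (y := s) ?_ (summable_altExp hb 0) ?_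
  · refine HasDerivAt.congr_deriv h ?_
    have hs' : Summable fun k : ℕ => b k * (k * (-s) ^ (k - 1) * (-1) / (k ! : ℝ)) := by
      rw [← summable_nat_add_iff 1]
      simp only [hkey]
      exact (summable_altExp (fun k => hb (k + 1)) s).neg
    rw [hs'.tsum_eq_zero_add]
    simp only [hkey, tsum_neg, altExp]
    simp
  · rcases k with _ | k
    · simp [u]
    · rw [hkey, norm_neg]
      simp only [u, Nat.succ_ne_zero, if_false, Nat.add_sub_cancel]
      exact norm_altExp_term_le (fun k => hb (k + 1)) (abs_le.2 ⟨hy.1.le, hy.2.le⟩) k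
  · have : 0 < R := by positivity
    constructor <;> linarith
  · constructor
    · linarith [neg_abs_le s]
    · linarith [le_abs_self s]

/-! ### The functions `J_n` and `Y_n` in the variable `s = x² / 4` -/

/-- `J_n(x) = (x/2)^n C_n(x²/4)`. -/
def besselC (n : ℕ) : ℝ → ℝ := altExp fun k => 1 / ((n + k)! : ℝ)

/-- The regular part of the series of `Y_n`. -/
def besselE (n : ℕ) : ℝ → ℝ :=
  altExp fun k => (digammaSucc k + digammaSucc (n + k)) / ((n + k)! : ℝ)

/-- `π Y_n(x) = (x/2)^n D_n(x²/4)`. -/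
def besselD (n : ℕ) (s : ℝ) : ℝ :=
  Real.log s * besselC n s
    - ∑ k ∈ Finset.range n, ((n - k - 1)! : ℝ) / (k ! : ℝ) * s ^ ((k : ℤ) - (n : ℤ))
    - besselE n s

lemma abs_coeffC_le (n k : ℕ) : |1 / ((n + k)! : ℝ)| ≤ 1 / (n ! : ℝ) := by
  rw [abs_of_nonneg (by positivity)]
  have : (n ! : ℝ) ≤ ((n + k)! : ℝ) := by exact_mod_cast Nat.factorial_le (by omega)
  gcongr

lemma digammaSucc_succ (m : ℕ) : digammaSucc (m + 1) = digammaSucc m + 1 / ((m : ℝ) + 1) := by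
  simp only [digammaSucc, harmonic_succ]
  push_cast
  ring

lemma abs_digammaSucc_le (m : ℕ) : |digammaSucc m| ≤ m + 1 := by
  have h0 : 0 ≤ Real.eulerMascheroniConstant := by
    linarith [Real.one_half_lt_eulerMascheroniConstant]
  have h1 : Real.eulerMascheroniConstant ≤ 1 := by
    linarith [Real.eulerMascheroniConstant_lt_two_thirds]
  have h2 : 0 ≤ (harmonic m : ℝ) ∧ (harmonic m : ℝ) ≤ m := by
    induction m with
    | zero => simp
    | succ m ih =>
      rw [harmonic_succ]
      push_cast
      have : 0 ≤ ((m : ℝ) + 1)⁻¹ := by positivity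
      have : ((m : ℝ) + 1)⁻¹ ≤ 1 := inv_le_one_of_one_le₀ (by linarith [Nat.cast_nonneg (α := ℝ) m])
      constructor <;> linarith [ih.1, ih.2]
  rw [digammaSucc, abs_le]
  constructor <;> linarith [h2.1, h2.2, Nat.cast_nonneg (α := ℝ) m]

/-- The two digamma values grow at most linearly: their sum is at most 2(n+k) + 2, and both n + k
and 1 are bounded by (n+k)!. -/
lemma abs_coeffE_le (n k : ℕ) :
    |(digammaSucc k + digammaSucc (n + k)) / ((n + k)! : ℝ)| ≤ 4 := by
  rw [abs_div, Nat.abs_cast, div_le_iff₀ (by positivity)]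
  have h1 := abs_digammaSucc_le k
  have h2 := abs_digammaSucc_le (n + k)
  have h3 : ((n + k : ℕ) : ℝ) ≤ ((n + k)! : ℝ) := by exact_mod_cast Nat.self_le_factorial _
  have h4 : (1 : ℝ) ≤ ((n + k)! : ℝ) := by exact_mod_cast Nat.factorial_pos _
  push_cast at h2 h3
  calc _ ≤ |digammaSucc k| + |digammaSucc (n + k)| := abs_add_le _ _
    _ ≤ _ := by linarith [Nat.cast_nonneg (α := ℝ) n]

lemma abs_besselC_le (n : ℕ) (s : ℝ) : |besselC n s| ≤ 1 / (n ! : ℝ) * Real.exp |s| :=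
  abs_altExp_le (abs_coeffC_le n) s

lemma abs_besselE_le (n : ℕ) (s : ℝ) : |besselE n s| ≤ 4 * Real.exp |s| :=
  abs_altExp_le (abs_coeffE_le n) s

lemma hasDerivAt_besselC (n : ℕ) (s : ℝ) : HasDerivAt (besselC n) (-besselC (n + 1) s) s := by
  refine (hasDerivAt_altExp (abs_coeffC_le n) s).congr_deriv ?_
  have h : (fun k : ℕ => 1 / ((n + (k + 1))! : ℝ)) = fun k => 1 / ((n + 1 + k)! : ℝ) := by
    funext k
    rw [show n + (k + 1) = n + 1 + k by ring]
  rw [h, besselC]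

lemma besselC_recurrence (n : ℕ) (s : ℝ) :
    s * besselC (n + 2) s = (n + 1) * besselC (n + 1) s - besselC n s := by
  have h1 := mul_altExp (abs_coeffC_le (n + 2)) s
  have h2 := altExp_const_mul ((n : ℝ) + 1) (fun k => 1 / ((n + 1 + k)! : ℝ)) s
  have h3 : ∀ k : ℕ, (n + 1 + k)! = (n + 1 + k) * (n + k)! := fun k => by
    rw [show n + 1 + k = n + k + 1 by ring, Nat.factorial_succ]
  have h4 : ∀ k : ℕ, (k : ℝ) * (1 / ((n + 2 + (k - 1))! : ℝ)) = k / ((n + 1 + k)! : ℝ) := by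
    intro k
    rcases k with _ | k
    · simp
    · rw [Nat.add_sub_cancel, show n + 2 + k = n + 1 + (k + 1) by ring]
      ring
  have hb : ∀ k : ℕ, |-((k : ℝ) * (1 / ((n + 2 + (k - 1))! : ℝ)))| ≤ 1 := by
    intro k
    rw [h4, abs_neg, abs_of_nonneg (by positivity), div_le_one (by positivity)]
    have : (k : ℝ) ≤ ((n + 1 + k : ℕ) : ℝ) := by push_cast; linarith [Nat.cast_nonneg (α := ℝ) n]
    exact this.trans (by exact_mod_cast Nat.self_le_factorial _)
  simp only [besselC]
  rw [eq_sub_iff_add_eq, h1, h2, altExp_add hb (abs_coeffC_le n)]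
  congr 1
  ext k
  rw [h4, h3]
  push_cast
  field_simp
  ring

/-- Only the lowest index is needed: the recurrence for D at higher indices is obtained by
differentiation in `besselD_recurrence`. The constant -1 comes from the coefficient at k = 0. -/
lemma besselE_recurrence (s : ℝ) :
    s * besselE 2 s = besselE 1 s - besselE 0 s - 1 := by
  have h1 := mul_altExp (abs_coeffE_le 2) s
  have hone : altExp (fun k => if k = 0 then 1 else 0) s = 1 := by
    rw [altExp, tsum_eq_single 0]
    · simp
    · intro k hk
      simp [hk]
  have h4 : ∀ k : ℕ, -((k : ℝ) * ((digammaSucc (k - 1) + digammaSucc (2 + (k - 1))) /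
      ((2 + (k - 1))! : ℝ))) = (digammaSucc k + digammaSucc (1 + k)) / ((1 + k)! : ℝ) +
        ((-1) * ((digammaSucc k + digammaSucc (0 + k)) / ((0 + k)! : ℝ)) +
          (-1) * (if k = 0 then 1 else 0)) := by
    intro k
    rcases k with _ | k
    · simp [add_comm 1, digammaSucc]
      ring
    · rw [Nat.add_sub_cancel, show 2 + k = k + 1 + 1 by ring, show 1 + (k + 1) = k + 1 + 1 by ring,
        zero_add, digammaSucc_succ (k + 1), digammaSucc_succ k, Nat.factorial_succ (k + 1)]
      simp only [Nat.succ_ne_zero, if_false]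
      push_cast
      field_simp
      ring
  have hb1 : ∀ k : ℕ, |(-1 : ℝ) * (if k = 0 then 1 else 0)| ≤ 1 := by
    intro k
    split_ifs <;> simp
  have hb0 : ∀ k : ℕ, |(-1) * ((digammaSucc k + digammaSucc (0 + k)) / ((0 + k)! : ℝ))| ≤ 4 := by
    intro k
    rw [abs_mul]
    simpa using abs_coeffE_le 0 k
  have hb01 := fun k => (abs_add_le _ _).trans (add_le_add (hb0 k) (hb1 k))
  simp only [besselE]
  rw [h1, funext h4, ← altExp_add (abs_coeffE_le 1) hb01, ← altExp_add hb0 hb1,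
    ← altExp_const_mul, ← altExp_const_mul, hone]
  ring

/-- The shift of coefficients turns ψ(k+1) into ψ(k+2) = ψ(k+1) + 1/(k+1). The surplus 1/(k+1) sums
to a difference quotient of C_n at 0. -/
lemma hasDerivAt_besselE (n : ℕ) {s : ℝ} (hs : s ≠ 0) :
    HasDerivAt (besselE n) (-besselE (n + 1) s + (besselC n s - 1 / (n ! : ℝ)) / s) s := by
  refine (hasDerivAt_altExp (abs_coeffE_le n) s).congr_deriv ?_
  have hC := altExp_sub_coeff_zero (abs_coeffC_le n) s
  have hC' : (besselC n s - 1 / (n ! : ℝ)) / s =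
      -altExp (fun k => 1 / ((n + (k + 1))! : ℝ) / (k + 1)) s := by
    simp only [besselC]
    rw [hC]
    simp only [add_zero]
    field_simp
    ring
  have hb : ∀ k : ℕ, |1 / ((n + (k + 1))! : ℝ) / (k + 1)| ≤ 1 := by
    intro k
    rw [abs_of_nonneg (by positivity), div_div, div_le_one (by positivity)]
    have : (1 : ℝ) ≤ ((n + (k + 1))! : ℝ) := by exact_mod_cast Nat.factorial_pos _
    nlinarith [Nat.cast_nonneg (α := ℝ) k]
  rw [hC', besselE, ← neg_add, altExp_add (abs_coeffE_le (n + 1)) hb]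
  congr 2
  funext k
  rw [show n + (k + 1) = n + 1 + k by ring, digammaSucc_succ k]
  field_simp
  ring

/-- Differentiating log s produces C_n/s, which cancels against the surplus in the derivative of E_n
except for 1/(n! s). That remainder is precisely the new term k = n of the finite sum in D_{n+1}. -/
lemma hasDerivAt_besselD (n : ℕ) {s : ℝ} (hs : 0 < s) :
    HasDerivAt (besselD n) (-besselD (n + 1) s) s := by
  have h1 := ((Real.hasDerivAt_log hs.ne').mul (hasDerivAt_besselC n s))
  have h2 : HasDerivAt (fun s : ℝ => ∑ k ∈ Finset.range n, ((n - k - 1)! : ℝ) / (k ! : ℝ) *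
      s ^ ((k : ℤ) - (n : ℤ))) (∑ k ∈ Finset.range n, ((n - k - 1)! : ℝ) / (k ! : ℝ) *
      ((((k : ℤ) - (n : ℤ) : ℤ) : ℝ) * s ^ ((k : ℤ) - (n : ℤ) - 1))) s :=
    .fun_sum fun k _ => (hasDerivAt_zpow _ _ (Or.inl hs.ne')).const_mul _
  have h3 := (h1.sub h2).sub (hasDerivAt_besselE n hs.ne')
  refine h3.congr_deriv ?_
  rw [besselD, Finset.sum_range_succ]
  have h4 : ∑ k ∈ Finset.range n, ((n - k - 1)! : ℝ) / (k ! : ℝ) *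
      ((((k : ℤ) - (n : ℤ) : ℤ) : ℝ) * s ^ ((k : ℤ) - (n : ℤ) - 1)) =
      -∑ k ∈ Finset.range n, ((n + 1 - k - 1)! : ℝ) / (k ! : ℝ) *
        s ^ ((k : ℤ) - ((n + 1 : ℕ) : ℤ)) := by
    rw [← Finset.sum_neg_distrib]
    refine Finset.sum_congr rfl fun k hk => ?_
    obtain ⟨m, rfl⟩ := Nat.exists_eq_add_of_lt (Finset.mem_range.1 hk)
    rw [show k + m + 1 - k - 1 = m by omega, show k + m + 1 + 1 - k - 1 = m + 1 by omega,
      Nat.factorial_succ, show (k : ℤ) - ((k + m + 1 : ℕ) : ℤ) - 1 =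
        (k : ℤ) - ((k + m + 1 + 1 : ℕ) : ℤ) by push_cast; ring]
    push_cast
    ring
  rw [h4, show n + 1 - n - 1 = 0 by omega, show (n : ℤ) - ((n + 1 : ℕ) : ℤ) = -1 by push_cast; ring,
    zpow_neg_one]
  field_simp
  simp
  ring

/-- The derivative of the recurrence at n is the recurrence at n + 1, since D_n' = -D_{n+1}; so only
n = 0 needs the series. -/
lemma besselD_recurrence (n : ℕ) {s : ℝ} (hs : 0 < s) :
    s * besselD (n + 2) s = (n + 1) * besselD (n + 1) s - besselD n s := by
  induction n generalizing s with
  | zero =>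
    have h1 := besselC_recurrence 0 s
    have h2 := besselE_recurrence s
    have h3 : s * ∑ k ∈ Finset.range 2, ((2 - k - 1)! : ℝ) / (k ! : ℝ) * s ^ ((k : ℤ) - 2) =
        1 / s + 1 := by
      rw [Finset.sum_range_succ, Finset.sum_range_one]
      simp [zpow_neg, Nat.factorial]
      field_simp
    simp only [besselD, mul_sub]
    simp only [zero_add, Nat.cast_zero, one_mul, Finset.sum_range_one, Finset.sum_range_zero,
      Nat.cast_ofNat, h3, h2, Nat.sub_zero, Nat.sub_self, Nat.factorial_zero, Nat.cast_one] at h1 ⊢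
    rw [show s * (Real.log s * besselC 2 s) = Real.log s * (s * besselC 2 s) by ring, h1]
    simp [zpow_neg]
    ring
  | succ n ih =>
    have hd : HasDerivAt (fun s => s * besselD (n + 2) s -
        ((n + 1) * besselD (n + 1) s - besselD n s))
        (1 * besselD (n + 2) s + s * (-besselD (n + 3) s) -
          ((n + 1) * (-besselD (n + 2) s) - -besselD (n + 1) s)) s :=
      (((hasDerivAt_id s).mul (hasDerivAt_besselD _ hs))).sub
        (((hasDerivAt_besselD _ hs).const_mul _).sub (hasDerivAt_besselD _ hs))
    have h0 : (fun s => s * besselD (n + 2) s - ((n + 1) * besselD (n + 1) s - besselD n s))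
        =ᶠ[𝓝 s] fun _ => 0 := by
      filter_upwards [lt_mem_nhds hs] with y hy
      rw [ih hy, sub_self]
    have := hd.unique ((hasDerivAt_const s (0 : ℝ)).congr_of_eventuallyEq h0)
    push_cast
    rw [show n + 1 + 2 = n + 3 by ring, show n + 1 + 1 = n + 2 by ring]
    linarith

lemma contDiff_besselC (n : ℕ) : ContDiff ℝ ∞ (besselC n) := by
  rw [contDiff_infty]
  intro m
  induction m generalizing n with
  | zero =>
    exact contDiff_zero.2 (continuous_iff_continuousAt.2 fun s =>
      (hasDerivAt_besselC n s).continuousAt)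
  | succ m ih =>
    push_cast
    rw [contDiff_succ_iff_deriv]
    refine ⟨fun s => (hasDerivAt_besselC n s).differentiableAt, by simp, ?_⟩
    rw [show deriv (besselC n) = fun s => -besselC (n + 1) s from
      funext fun s => (hasDerivAt_besselC n s).deriv]
    exact (ih (n + 1)).neg

lemma besselC_zero_right (n : ℕ) : besselC n 0 = 1 / (n ! : ℝ) := by
  rw [besselC, altExp_zero, add_zero]

lemma besselE_zero_zero : besselE 0 0 = -(2 * Real.eulerMascheroniConstant) := by
  rw [besselE, altExp_zero]
  simp [digammaSucc]
  ring

/-! ### The Wronskian of C_n and D_n -/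

lemma wronskian_succ (n : ℕ) {s : ℝ} (hs : 0 < s) :
    s ^ (n + 2) * (besselC (n + 2) s * besselD (n + 1) s - besselC (n + 1) s * besselD (n + 2) s) =
      s ^ (n + 1) * (besselC (n + 1) s * besselD n s - besselC n s * besselD (n + 1) s) := by
  have h1 := besselC_recurrence n s
  have h2 := besselD_recurrence n hs
  calc _ = s ^ (n + 1) * ((s * besselC (n + 2) s) * besselD (n + 1) s -
        besselC (n + 1) s * (s * besselD (n + 2) s)) := by ring
    _ = _ := by rw [h1, h2]; ring

lemma hasDerivAt_wronskian_zero {s : ℝ} (hs : 0 < s) :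
    HasDerivAt (fun s => s * (besselC 1 s * besselD 0 s - besselC 0 s * besselD 1 s)) 0 s := by
  have h := (hasDerivAt_id s).mul
    (((hasDerivAt_besselC 1 s).mul (hasDerivAt_besselD 0 hs)).sub
      ((hasDerivAt_besselC 0 s).mul (hasDerivAt_besselD 1 hs)))
  refine h.congr_deriv ?_
  have h1 := besselC_recurrence 0 s
  have h2 := besselD_recurrence 0 hs
  simp only [zero_add, Nat.cast_zero, one_mul, id, Pi.sub_apply, Pi.mul_apply] at h1 h2 ⊢
  linear_combination (-besselD 0 s) * h1 + (besselC 0 s) * h2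

lemma tendsto_mul_log_zero : Tendsto (fun s : ℝ => s * Real.log s) (𝓝[>] 0) (𝓝 0) := by
  simpa using (Real.continuous_mul_log.tendsto 0).mono_left nhdsWithin_le_nhds

lemma continuous_besselC (n : ℕ) : Continuous (besselC n) := (contDiff_besselC n).continuous

lemma hasDerivAt_besselE' (n : ℕ) (s : ℝ) : ∃ d, HasDerivAt (besselE n) d s :=
  ⟨_, hasDerivAt_altExp (abs_coeffE_le n) s⟩

lemma continuous_besselE (n : ℕ) : Continuous (besselE n) :=
  continuous_iff_continuousAt.2 fun s =>
    let ⟨_, h⟩ := hasDerivAt_besselE' n s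
    h.continuousAt

/-- The expression has zero derivative, so its value can be read off as s → 0: the two logarithmic
contributions cancel in the limit, and the pole -1/s of D_1 contributes C_0(0) = 1. -/
lemma wronskian_zero {s : ℝ} (hs : 0 < s) :
    s * (besselC 1 s * besselD 0 s - besselC 0 s * besselD 1 s) = 1 := by
  set W : ℝ → ℝ := fun s => s * (besselC 1 s * besselD 0 s - besselC 0 s * besselD 1 s)
  have hconst : ∀ x ∈ Ioi (0 : ℝ), W x = W s := by
    intro x hx
    refine (convex_Ioi (0 : ℝ)).is_const_of_fderivWithin_eq_zero (𝕜 := ℝ)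
      (fun y hy => (hasDerivAt_wronskian_zero hy).differentiableAt.differentiableWithinAt)
      (fun y hy => ?_) hx hs
    rw [fderivWithin_of_isOpen isOpen_Ioi hy]
    ext
    simpa using (hasDerivAt_wronskian_zero hy).deriv
  have hlim : Tendsto W (𝓝[>] 0) (𝓝 1) := by
    have hW : ∀ x ∈ Ioi (0 : ℝ), W x = (x * Real.log x) * (besselC 1 x * besselC 0 x) -
        x * (besselC 1 x * besselE 0 x) - (x * Real.log x) * (besselC 0 x * besselC 1 x) +
        besselC 0 x + x * (besselC 0 x * besselE 1 x) := by
      intro x hx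
      have hx0 : x ≠ 0 := (mem_Ioi.1 hx).ne'
      simp only [W, besselD, Finset.sum_range_zero, Finset.sum_range_one]
      simp [zpow_neg]
      field_simp
      ring
    have hc : ∀ f : ℝ → ℝ, Continuous f → Tendsto f (𝓝[>] 0) (𝓝 (f 0)) := fun f hf =>
      (hf.tendsto 0).mono_left nhdsWithin_le_nhds
    have h := ((((tendsto_mul_log_zero.mul
      (hc _ ((continuous_besselC 1).mul (continuous_besselC 0)))).sub
      (hc _ (continuous_id.mul ((continuous_besselC 1).mul (continuous_besselE 0))))).sub
      (tendsto_mul_log_zero.mul (hc _ ((continuous_besselC 0).mul (continuous_besselC 1))))).add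
      (hc _ (continuous_besselC 0))).add
      (hc _ (continuous_id.mul ((continuous_besselC 0).mul (continuous_besselE 1))))
    have h1 : Tendsto W (𝓝[>] 0) _ := h.congr' (by
      filter_upwards [self_mem_nhdsWithin] with x hx
      rw [hW x hx]
      rfl)
    simpa [besselC_zero_right] using h1
  refine tendsto_nhds_unique (tendsto_const_nhds.congr' ?_) hlim
  filter_upwards [self_mem_nhdsWithin] with x hx using (hconst x hx).symm

lemma wronskian (n : ℕ) {s : ℝ} (hs : 0 < s) :
    s ^ (n + 1) * (besselC (n + 1) s * besselD n s - besselC n s * besselD (n + 1) s) = 1 := by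
  induction n with
  | zero => simpa using wronskian_zero hs
  | succ n ih => rw [← ih, ← wronskian_succ n hs]

lemma besselC_ne_zero_or (n : ℕ) {s : ℝ} (hs : 0 < s) :
    besselC n s ≠ 0 ∨ besselC (n + 1) s ≠ 0 := by
  by_contra! h
  have := wronskian n hs
  rw [h.1, h.2] at this
  simp at this

/-! ### Identification with the Bessel functions -/

lemma besselJNat_eq (n : ℕ) (x : ℝ) : besselJNat n x = (x / 2) ^ n * besselC n (x ^ 2 / 4) := by
  rw [besselJNat, besselC, altExp, ← tsum_mul_left]
  refine tsum_congr fun k => ?_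
  rw [pow_add, pow_mul, show (x / 2) ^ 2 = x ^ 2 / 4 by ring, neg_pow (x ^ 2 / 4)]
  field_simp

lemma besselYNat_eq (n : ℕ) {x : ℝ} (hx : 0 < x) :
    besselYNat n x = π⁻¹ * ((x / 2) ^ n * besselD n (x ^ 2 / 4)) := by
  have hx2 : 0 < x / 2 := by positivity
  rw [besselYNat, besselD, besselE, altExp, besselJNat_eq]
  congr 1
  rw [mul_sub, mul_sub, ← tsum_mul_left, Finset.mul_sum, show x ^ 2 / 4 = (x / 2) ^ 2 by ring,
    Real.log_pow]
  congr 2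
  · push_cast
    ring
  · refine Finset.sum_congr rfl fun k _ => ?_
    rw [← zpow_natCast (x / 2) 2, ← zpow_mul, ← zpow_natCast (x / 2) n, mul_left_comm,
      ← zpow_add₀ hx2.ne']
    congr 2
    push_cast
    ring
  · funext k
    rw [pow_add, pow_mul, neg_pow ((x / 2) ^ 2)]
    field_simp

/-! ### The Laplacian of `z^n g(|z|²)` and `\bar z^n g(|z|²)` -/

/-- `z` if `l ≥ 0` and `conj z` if `l < 0`, so that `(signedCoord l z) ^ |l| = r^|l| e^{ilθ}`. -/
def signedCoord (l : ℤ) : ℂ →L[ℝ] ℂ :=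
  if 0 ≤ l then ContinuousLinearMap.id ℝ ℂ else (Complex.conjCLE : ℂ →L[ℝ] ℂ)

lemma signedCoord_one (l : ℤ) : signedCoord l 1 = 1 := by
  unfold signedCoord
  split_ifs <;> simp

lemma signedCoord_I_sq (l : ℤ) : signedCoord l Complex.I ^ 2 = -1 := by
  unfold signedCoord
  split_ifs <;> simp

lemma signedCoord_eq (l : ℤ) (z : ℂ) :
    signedCoord l z = z.re + signedCoord l Complex.I * z.im := by
  unfold signedCoord
  split_ifs
  · apply Complex.ext <;> simp
  · apply Complex.ext <;> simp

lemma norm_signedCoord (l : ℤ) (z : ℂ) : ‖signedCoord l z‖ = ‖z‖ := by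
  unfold signedCoord
  split_ifs <;> simp

lemma signedCoord_polar (l : ℤ) (r θ : ℝ) :
    signedCoord l (r * Complex.exp (Complex.I * θ)) ^ l.natAbs =
      (r : ℂ) ^ l.natAbs * Complex.exp (Complex.I * l * θ) := by
  unfold signedCoord
  split_ifs with h
  · obtain ⟨n, rfl⟩ := Int.eq_ofNat_of_zero_le h
    simp only [ContinuousLinearMap.id_apply, Int.natAbs_natCast, mul_pow, ← Complex.exp_nat_mul]
    congr 2
    push_cast
    ring
  · obtain ⟨n, hn⟩ := Int.eq_ofNat_of_zero_le (show 0 ≤ -l by omega)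
    obtain rfl : l = -(n : ℤ) := by omega
    simp only [ContinuousLinearEquiv.coe_coe, Complex.conjCLE_apply, Int.natAbs_neg,
      Int.natAbs_natCast, map_mul, mul_pow, Complex.conj_ofReal, ← Complex.exp_conj,
      Complex.conj_I, ← Complex.exp_nat_mul]
    congr 2
    push_cast
    ring

lemma laplacian_eq_fderiv {f : ℂ → ℂ} (hf : ContDiff ℝ 2 f) (z : ℂ) :
    Δ f z = fderiv ℝ (fun w => fderiv ℝ f w 1) z 1 +
      fderiv ℝ (fun w => fderiv ℝ f w Complex.I) z Complex.I := by
  have hd : Differentiable ℝ (fderiv ℝ f) :=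
    (hf.fderiv_right (m := 1) (by norm_num)).differentiable one_ne_zero
  have h : ∀ v : ℂ, fderiv ℝ (fun w => fderiv ℝ f w v) z v = fderiv ℝ (fderiv ℝ f) z v v := by
    intro v
    rw [fderiv_clm_apply (hd z) (differentiableAt_const v)]
    simp
  rw [InnerProductSpace.laplacian_eq_iteratedFDeriv_complexPlane, h, h]
  simp [iteratedFDeriv_two_apply]

/-- The radial part of a quarter of the Laplacian on functions `z^n g(|z|²)`. -/
def radialOp (n : ℕ) (g : ℝ → ℂ) (t : ℝ) : ℂ := (n + 1) * deriv g t + t * deriv (deriv g) t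

lemma contDiff_separated {m : ℕ∞} (l : ℤ) (n : ℕ) {g : ℝ → ℂ} (hg : ContDiff ℝ m g) :
    ContDiff ℝ m (fun z : ℂ => signedCoord l z ^ n * g (‖z‖ ^ 2)) :=
  ((signedCoord l).contDiff.pow n).mul (hg.comp (contDiff_norm_sq ℝ))

lemma fderiv_eq_of_hasDerivAt_line {f : ℂ → ℂ} {w v d : ℂ} (hf : DifferentiableAt ℝ f w)
    (hd : HasDerivAt (fun x : ℝ => f (w + x • v)) d 0) : fderiv ℝ f w v = d := by
  rw [← hf.lineDeriv_eq_fderiv, lineDeriv, hd.deriv]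

lemma hasDerivAt_signedCoord_line (l : ℤ) (w v : ℂ) :
    HasDerivAt (fun x : ℝ => signedCoord l (w + x • v)) (signedCoord l v) 0 := by
  have h : HasDerivAt (fun x : ℝ => w + x • v) v 0 := by
    simpa using ((hasDerivAt_id (0 : ℝ)).smul_const v).const_add w
  have := (signedCoord l).hasFDerivAt.comp_hasDerivAt (0 : ℝ) h
  exact this

lemma hasDerivAt_comp_norm_sq_line {g : ℝ → ℂ} (hg : Differentiable ℝ g) (w v : ℂ) :
    HasDerivAt (fun x : ℝ => g (‖w + x • v‖ ^ 2))
      (deriv g (‖w‖ ^ 2) * (2 * inner ℝ w v : ℝ)) 0 := by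
  have h : HasDerivAt (fun x : ℝ => w + x • v) v 0 := by
    simpa using ((hasDerivAt_id (0 : ℝ)).smul_const v).const_add w
  have h2 := h.norm_sq
  simp only [zero_smul, add_zero] at h2
  have h3 : HasDerivAt g (deriv g (‖w‖ ^ 2)) (‖w + (0 : ℝ) • v‖ ^ 2) := by
    simpa using (hg (‖w‖ ^ 2)).hasDerivAt
  have := h3.scomp (0 : ℝ) h2
  refine this.congr_deriv ?_
  rw [Complex.real_smul, mul_comm]

/-- The factor z^n or its conjugate is harmonic and homogeneous of degree n, so only g is hit twice,
and the cross term is n times the function by Euler's identity. -/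
lemma laplacian_separated (l : ℤ) (n : ℕ) {g : ℝ → ℂ} (hg : ContDiff ℝ ∞ g) (z : ℂ) :
    Δ (fun z : ℂ => signedCoord l z ^ n * g (‖z‖ ^ 2)) z =
      signedCoord l z ^ n * (4 * radialOp n g (‖z‖ ^ 2)) := by
  set e := signedCoord l
  have hg1 : ContDiff ℝ ∞ (deriv g) := (contDiff_infty_iff_deriv.1 hg).2
  have hd0 : Differentiable ℝ g := hg.differentiable (by simp)
  have hd1 : Differentiable ℝ (deriv g) := hg1.differentiable (by simp)
  have hfirst : ∀ v w : ℂ, fderiv ℝ (fun z : ℂ => e z ^ n * g (‖z‖ ^ 2)) w v =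
      n * e w ^ (n - 1) * e v * g (‖w‖ ^ 2) +
        e w ^ n * (deriv g (‖w‖ ^ 2) * (2 * inner ℝ w v : ℝ)) := by
    intro v w
    refine fderiv_eq_of_hasDerivAt_line
      ((contDiff_separated l n hg).differentiable (by simp) w) ?_
    have h1 := ((hasDerivAt_signedCoord_line l w v).pow n).mul
      (hasDerivAt_comp_norm_sq_line hd0 w v)
    refine h1.congr_deriv ?_
    simp [e]
  have hsecond : ∀ v : ℂ, fderiv ℝ (fun w => fderiv ℝ (fun z : ℂ => e z ^ n * g (‖z‖ ^ 2)) w v)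
      z v = n * ((n - 1 : ℕ) * e z ^ (n - 1 - 1) * e v) * e v * g (‖z‖ ^ 2) +
        n * e z ^ (n - 1) * e v * (deriv g (‖z‖ ^ 2) * (2 * inner ℝ z v : ℝ)) +
        (n * e z ^ (n - 1) * e v * (deriv g (‖z‖ ^ 2) * (2 * inner ℝ z v : ℝ)) +
          e z ^ n * (deriv (deriv g) (‖z‖ ^ 2) * (2 * inner ℝ z v : ℝ) * (2 * inner ℝ z v : ℝ) +
            deriv g (‖z‖ ^ 2) * (2 * ‖v‖ ^ 2 : ℝ))) := by
    intro v
    have hdiff : Differentiable ℝ fun w => fderiv ℝ (fun z : ℂ => e z ^ n * g (‖z‖ ^ 2)) w v :=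
      (((contDiff_separated l n hg).fderiv_right (m := 1) (by norm_cast)).clm_apply
        contDiff_const).differentiable one_ne_zero
    refine fderiv_eq_of_hasDerivAt_line (hdiff z) ?_
    simp only [hfirst]
    have hline : HasDerivAt (fun x : ℝ => z + x • v) v 0 := by
      simpa using ((hasDerivAt_id (0 : ℝ)).smul_const v).const_add z
    have hinner : HasDerivAt (fun x : ℝ => ((2 * inner ℝ (z + x • v) v : ℝ) : ℂ))
        (2 * ‖v‖ ^ 2 : ℝ) 0 := by
      have := ((hline.inner ℝ (hasDerivAt_const (0 : ℝ) v)).const_mul 2).ofReal_comp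
      simpa using this
    have h1 := (((((hasDerivAt_signedCoord_line l z v).pow (n - 1)).const_mul (n : ℂ)).mul_const
      (e v)).mul (hasDerivAt_comp_norm_sq_line hd0 z v)).add
      (((hasDerivAt_signedCoord_line l z v).pow n).mul
        ((hasDerivAt_comp_norm_sq_line hd1 z v).mul hinner))
    refine h1.congr_deriv ?_
    simp [e]
  rw [laplacian_eq_fderiv ((contDiff_separated l n hg).of_le (by norm_cast)),
    hsecond, hsecond]
  have he1 : e 1 = 1 := signedCoord_one l
  -- Harmonicity: the second derivatives of e^n in the directions 1 and I cancel.
  have heI : e Complex.I ^ 2 = -1 := signedCoord_I_sq l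
  have hez := signedCoord_eq l z
  have hi1 : inner ℝ z 1 = z.re := by simp [Complex.inner]
  have hiI : inner ℝ z Complex.I = z.im := by simp [Complex.inner]
  have hn : ((‖z‖ ^ 2 : ℝ) : ℂ) = (z.re : ℂ) ^ 2 + (z.im : ℂ) ^ 2 := by
    rw [← Complex.normSq_eq_norm_sq, Complex.normSq_apply]
    push_cast
    ring
  -- Euler's identity for the homogeneous factor; for n = 0 the truncated exponent is killed by the
  -- coefficient n.
  have hpow : (n : ℂ) * e z ^ (n - 1) * e z = n * e z ^ n := by
    rcases n with _ | n
    · simp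
    · rw [Nat.add_sub_cancel, pow_succ, mul_assoc]
  simp only [radialOp, he1, hi1, hiI, norm_one, Complex.norm_I, hn]
  push_cast
  rw [show e z = z.re + e Complex.I * z.im from hez] at hpow ⊢
  linear_combination (4 * deriv g (‖z‖ ^ 2)) * hpow +
    (n * ((n - 1 : ℕ) * (z.re + e Complex.I * z.im) ^ (n - 1 - 1)) * g (‖z‖ ^ 2)) * heI

lemma integral_mul_laplacian {f η : ℂ → ℂ} (hf : ContDiff ℝ ∞ f) (hη : ContDiff ℝ ∞ η)
    (hs : HasCompactSupport η) : ∫ z, f z * Δ η z = ∫ z, Δ f z * η z := by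
  have hc : ∀ {g : ℂ → ℂ}, ContDiff ℝ ∞ g → ∀ v, ContDiff ℝ ∞ fun w => fderiv ℝ g w v := by
    intro g hg v
    exact (hg.fderiv_right (m := ∞) (by norm_cast)).clm_apply contDiff_const
  have hint : ∀ {p q : ℂ → ℂ}, Continuous p → Continuous q → HasCompactSupport q →
      Integrable fun z => p z * q z := fun hp hq hqs =>
    (hp.mul hq).integrable_of_hasCompactSupport hqs.mul_left
  have hone : ∀ v, ∫ z, f z * fderiv ℝ (fun w => fderiv ℝ η w v) z v =
      ∫ z, fderiv ℝ (fun w => fderiv ℝ f w v) z v * η z := by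
    intro v
    have hsv : HasCompactSupport fun w => fderiv ℝ η w v := hs.fderiv_apply ℝ v
    have hsvv : HasCompactSupport fun w => fderiv ℝ (fun w => fderiv ℝ η w v) w v :=
      hsv.fderiv_apply ℝ v
    rw [integral_mul_fderiv_eq_neg_fderiv_mul_of_integrable
      (hint (hc hf v).continuous (hc hη v).continuous hsv)
      (hint hf.continuous (hc (hc hη v) v).continuous hsvv)
      (hint hf.continuous (hc hη v).continuous hsv)
      (fun z _ => hf.differentiable (by simp) z)
      (fun z _ => (hc hη v).differentiable (by simp) z),
      integral_mul_fderiv_eq_neg_fderiv_mul_of_integrable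
      (hint (hc (hc hf v) v).continuous hη.continuous hs)
      (hint (hc hf v).continuous (hc hη v).continuous hsv)
      (hint (hc hf v).continuous hη.continuous hs)
      (fun z _ => (hc hf v).differentiable (by simp) z)
      (fun z _ => hη.differentiable (by simp) z), neg_neg]
  have h2 : ∀ {g : ℂ → ℂ}, ContDiff ℝ ∞ g → ContDiff ℝ 2 g := fun hg =>
    hg.of_le (by norm_cast)
  have hsv : ∀ v, HasCompactSupport fun w => fderiv ℝ (fun w => fderiv ℝ η w v) w v :=
    fun v => (hs.fderiv_apply ℝ v).fderiv_apply ℝ v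
  simp only [laplacian_eq_fderiv (h2 hf), laplacian_eq_fderiv (h2 hη), mul_add, add_mul]
  rw [integral_add (hint hf.continuous (hc (hc hη 1) 1).continuous (hsv 1))
    (hint hf.continuous (hc (hc hη _) _).continuous (hsv _)),
    integral_add (hint (hc (hc hf 1) 1).continuous hη.continuous hs)
    (hint (hc (hc hf _) _).continuous hη.continuous hs), hone, hone]

/-! ### Smooth approximation of radial profiles that are matched to first order -/

lemma radialOp_congr (n : ℕ) {g h : ℝ → ℂ} {t : ℝ} (H : g =ᶠ[𝓝 t] h) :
    radialOp n g t = radialOp n h t := by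
  rw [radialOp, radialOp, H.deriv_eq, H.deriv.deriv_eq]

lemma smoothTransition_deriv_eq_zero {x : ℝ} (hx : 1 < x) :
    Real.smoothTransition =ᶠ[𝓝 x] fun _ => 1 := by
  filter_upwards [lt_mem_nhds hx] with y hy using Real.smoothTransition.one_of_one_le hy.le

lemma exists_bound_deriv_smoothTransition :
    ∃ K, ∀ x, |deriv Real.smoothTransition x| ≤ K ∧
      |deriv (deriv Real.smoothTransition) x| ≤ K := by
  have hc : ContDiff ℝ ∞ Real.smoothTransition := Real.smoothTransition.contDiff
  have hc1 : ContDiff ℝ ∞ (deriv Real.smoothTransition) := (contDiff_infty_iff_deriv.1 hc).2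
  have hc2 : ContDiff ℝ ∞ (deriv (deriv Real.smoothTransition)) :=
    (contDiff_infty_iff_deriv.1 hc1).2
  have hs : HasCompactSupport (deriv Real.smoothTransition) := by
    refine HasCompactSupport.intro (isCompact_Icc (a := (0 : ℝ)) (b := 1)) fun x hx => ?_
    rw [mem_Icc, not_and_or, not_le, not_le] at hx
    rcases hx with hx | hx
    · have : Real.smoothTransition =ᶠ[𝓝 x] fun _ => 0 := by
        filter_upwards [gt_mem_nhds hx] with y hy using
          Real.smoothTransition.zero_of_nonpos (le_of_lt hy)
      rw [this.deriv_eq, deriv_const]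
    · rw [(smoothTransition_deriv_eq_zero hx).deriv_eq, deriv_const]
  obtain ⟨K1, h1⟩ := hs.exists_bound_of_continuous hc1.continuous
  obtain ⟨K2, h2⟩ := hs.deriv.exists_bound_of_continuous hc2.continuous
  exact ⟨max K1 K2, fun x => ⟨(h1 x).trans (le_max_left _ _), (h2 x).trans (le_max_right _ _)⟩⟩

lemma norm_le_of_deriv_bound {F : Type*} [NormedAddCommGroup F] [NormedSpace ℝ F] {f f' : ℝ → F}
    {T R C : ℝ} (hf : ∀ t ∈ Icc T R, HasDerivAt f (f' t) t)
    (h0 : f T = 0) (hb : ∀ t ∈ Icc T R, ‖f' t‖ ≤ C) {t : ℝ} (ht : t ∈ Icc T R) :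
    ‖f t‖ ≤ C * (t - T) := by
  have h := norm_image_sub_le_of_norm_deriv_le_segment' (f := f) (f' := f') (a := T) (b := R)
    (C := C) (fun x hx => (hf x hx).hasDerivWithinAt)
    (fun x hx => hb x ⟨hx.1, hx.2.le⟩) t ht
  simpa [h0] using h

/-- The glued profile is only C¹ at T. The approximants switch on the difference k = ge - gi over a
layer of width 1/(j+1). Since k and k' vanish at T, k is O((t-T)²), which absorbs the factor (j+1)²
from two derivatives of the switch; the radial operators therefore stay bounded and dominated
convergence applies. -/
lemma exists_smooth_approx (n : ℕ) {gi ge : ℝ → ℂ} (hgi : ContDiff ℝ ∞ gi)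
    (hge : ContDiffOn ℝ ∞ ge (Ioi 0)) {T : ℝ} (hT : 0 < T) (h0 : gi T = ge T)
    (h1 : deriv gi T = deriv ge T) :
    ∃ χ : ℕ → ℝ → ℂ, (∀ j, ContDiff ℝ ∞ (χ j)) ∧ (∀ j t, T + 1 ≤ t → χ j t = ge t) ∧
      (∀ t, Tendsto (fun j => χ j t) atTop (𝓝 (if t ≤ T then gi t else ge t))) ∧
      (∀ t, Tendsto (fun j => radialOp n (χ j) t) atTop
        (𝓝 (if t ≤ T then radialOp n gi t else radialOp n ge t))) ∧
      ∀ R, ∃ B, ∀ j, ∀ t ∈ Icc 0 R, ‖χ j t‖ ≤ B ∧ ‖radialOp n (χ j) t‖ ≤ B := by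
  set θ := Real.smoothTransition
  have hθ : ContDiff ℝ ∞ θ := Real.smoothTransition.contDiff
  have hθ1 : ContDiff ℝ ∞ (deriv θ) := (contDiff_infty_iff_deriv.1 hθ).2
  obtain ⟨K, hK⟩ := exists_bound_deriv_smoothTransition
  have hK0 : 0 ≤ K := (abs_nonneg _).trans (hK 0).1
  set k : ℝ → ℂ := fun t => ge t - gi t
  have hk : ContDiffOn ℝ ∞ k (Ioi 0) := hge.sub hgi.contDiffOn
  have hk1 : ContDiffOn ℝ ∞ (deriv k) (Ioi 0) := hk.deriv_of_isOpen isOpen_Ioi (by norm_cast)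
  have hk2 : ContDiffOn ℝ ∞ (deriv (deriv k)) (Ioi 0) :=
    hk1.deriv_of_isOpen isOpen_Ioi (by norm_cast)
  have hgi1 : ContDiff ℝ ∞ (deriv gi) := (contDiff_infty_iff_deriv.1 hgi).2
  have hgi2 : ContDiff ℝ ∞ (deriv (deriv gi)) := (contDiff_infty_iff_deriv.1 hgi1).2
  have dk : ∀ t, 0 < t → HasDerivAt k (deriv k t) t := fun t ht =>
    ((hk.differentiableOn (by simp)).differentiableAt (Ioi_mem_nhds ht)).hasDerivAt
  have dk1 : ∀ t, 0 < t → HasDerivAt (deriv k) (deriv (deriv k) t) t := fun t ht =>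
    ((hk1.differentiableOn (by simp)).differentiableAt (Ioi_mem_nhds ht)).hasDerivAt
  have dge : DifferentiableAt ℝ ge T :=
    (hge.differentiableOn (by simp)).differentiableAt (Ioi_mem_nhds hT)
  have kT : k T = 0 := by simp [k, h0]
  have k1T : deriv k T = 0 := by
    have := dge.hasDerivAt.sub (hgi.differentiable (by simp) T).hasDerivAt
    rw [show deriv k T = _ from this.deriv, h1, sub_self]
  let χ : ℕ → ℝ → ℂ := fun j t => gi t + (θ ((t - T) * (j + 1)) : ℂ) * k t
  have hlin : ∀ (j : ℕ) (t : ℝ), HasDerivAt (fun t : ℝ => (t - T) * ((j : ℝ) + 1)) (j + 1) t := by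
    intro j t
    simpa using ((hasDerivAt_id t).sub_const T).mul_const ((j : ℝ) + 1)
  have dθ : ∀ {f : ℝ → ℝ}, ContDiff ℝ ∞ f → ∀ (j : ℕ) (t : ℝ),
      HasDerivAt (fun t : ℝ => (f ((t - T) * (j + 1)) : ℂ))
        (((deriv f ((t - T) * (j + 1)) : ℝ) : ℂ) * (j + 1)) t := by
    intro f hf j t
    have := (((hf.differentiable (by simp) _).hasDerivAt).comp t (hlin j t)).ofReal_comp
    refine this.congr_deriv ?_
    push_cast
    rfl
  have hF1 : ∀ j t, 0 < t → HasDerivAt (χ j) (deriv gi t +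
      (((deriv θ ((t - T) * (j + 1)) : ℝ) : ℂ) * (j + 1) * k t +
        (θ ((t - T) * (j + 1)) : ℂ) * deriv k t)) t := fun j t ht =>
    (hgi.differentiable (by simp) t).hasDerivAt.add ((dθ hθ j t).mul (dk t ht))
  have hF2 : ∀ j t, 0 < t → HasDerivAt (deriv (χ j)) (deriv (deriv gi) t +
      ((((deriv (deriv θ) ((t - T) * (j + 1)) : ℝ) : ℂ) * (j + 1) * (j + 1) * k t +
        ((deriv θ ((t - T) * (j + 1)) : ℝ) : ℂ) * (j + 1) * deriv k t) +
        (((deriv θ ((t - T) * (j + 1)) : ℝ) : ℂ) * (j + 1) * deriv k t +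
        (θ ((t - T) * (j + 1)) : ℂ) * deriv (deriv k) t))) t := by
    intro j t ht
    have h := (hgi1.differentiable (by simp) t).hasDerivAt.add
      ((((dθ hθ1 j t).mul_const ((j : ℂ) + 1)).mul (dk t ht)).add
        ((dθ hθ j t).mul (dk1 t ht)))
    refine h.congr_of_eventuallyEq ?_
    filter_upwards [Ioi_mem_nhds ht] with y hy using (hF1 j y hy).deriv
  have hlow : ∀ j t, t < T → χ j =ᶠ[𝓝 t] gi := by
    intro j t ht
    filter_upwards [gt_mem_nhds ht] with y hy
    simp only [χ, θ]
    rw [Real.smoothTransition.zero_of_nonpos (mul_nonpos_of_nonpos_of_nonneg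
      (sub_nonpos.2 (le_of_lt hy)) (by positivity))]
    simp
  have hleT : ∀ (j : ℕ) t, t ≤ T → θ ((t - T) * (j + 1)) = 0 := fun j t ht =>
    Real.smoothTransition.zero_of_nonpos (mul_nonpos_of_nonpos_of_nonneg
      (sub_nonpos.2 ht) (by positivity))
  have hhigh : ∀ (j : ℕ) t, 1 ≤ (t - T) * (j + 1) → χ j t = ge t := by
    intro j t ht
    simp only [χ, θ, k]
    rw [Real.smoothTransition.one_of_one_le ht]
    simp
  have hhigh' : ∀ (j : ℕ) t, 1 < (t - T) * (j + 1) → χ j =ᶠ[𝓝 t] ge := by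
    intro j t ht
    have : ∀ᶠ y in 𝓝 t, 1 < (y - T) * (j + 1) :=
      (hlin j t).continuousAt.eventually (lt_mem_nhds ht)
    filter_upwards [this] with y hy using hhigh j y hy.le
  have hev : ∀ t, T < t → ∀ᶠ j : ℕ in atTop, 1 < (t - T) * (j + 1) := by
    intro t ht
    obtain ⟨N, hN⟩ := exists_nat_gt (1 / (t - T))
    filter_upwards [eventually_ge_atTop N] with j hj
    have h2 : 0 < t - T := sub_pos.2 ht
    have h3 : (N : ℝ) ≤ j := by exact_mod_cast hj
    rw [div_lt_iff₀ h2] at hN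
    nlinarith
  -- At the interface itself every term containing the switch carries k(T), k'(T) or θ(0), all of
  -- which vanish.
  have hopT : ∀ j, radialOp n (χ j) T = radialOp n gi T := by
    intro j
    rw [radialOp, radialOp, (hF1 j T hT).deriv, (hF2 j T hT).deriv, kT, k1T, hleT j T le_rfl]
    simp
  refine ⟨χ, fun j => ?_, fun j t ht => hhigh j t ?_, fun t => ?_, fun t => ?_, fun R => ?_⟩
  · rw [contDiff_iff_contDiffAt]
    intro t
    rcases lt_or_ge t T with ht | ht
    · exact hgi.contDiffAt.congr_of_eventuallyEq (hlow j t ht)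
    · have hkt : ContDiffAt ℝ ∞ k t := hk.contDiffAt (Ioi_mem_nhds (hT.trans_le ht))
      have hθt : ContDiff ℝ ∞ fun t : ℝ => (θ ((t - T) * (j + 1)) : ℂ) :=
        Complex.ofRealCLM.contDiff.comp
          (hθ.comp ((contDiff_id.sub contDiff_const).mul contDiff_const))
      exact hgi.contDiffAt.add (hθt.contDiffAt.mul hkt)
  · have : (0 : ℝ) ≤ j := Nat.cast_nonneg j
    nlinarith
  · split_ifs with ht
    · have : ∀ j, χ j t = gi t := fun j => by simp [χ, hleT j t ht]
      simp only [this]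
      exact tendsto_const_nhds
    · refine tendsto_const_nhds.congr' ?_
      filter_upwards [hev t (not_le.1 ht)] with j hj using (hhigh j t hj.le).symm
  · split_ifs with ht
    · have : ∀ j, radialOp n (χ j) t = radialOp n gi t := by
        intro j
        rcases ht.lt_or_eq with h | h
        · exact radialOp_congr n (hlow j t h)
        · rw [h, hopT]
      simp only [this]
      exact tendsto_const_nhds
    · refine tendsto_const_nhds.congr' ?_
      filter_upwards [hev t (not_le.1 ht)] with j hj using
        (radialOp_congr n (hhigh' j t hj)).symm
  · have hsub : Icc T R ⊆ Ioi (0 : ℝ) := fun t ht => hT.trans_le ht.1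
    obtain ⟨B0, hB0⟩ := (isCompact_Icc (a := (0 : ℝ)) (b := R)).exists_bound_of_continuousOn
      hgi.continuous.continuousOn
    obtain ⟨B1, hB1⟩ := (isCompact_Icc (a := (0 : ℝ)) (b := R)).exists_bound_of_continuousOn
      hgi1.continuous.continuousOn
    obtain ⟨B2, hB2⟩ := (isCompact_Icc (a := (0 : ℝ)) (b := R)).exists_bound_of_continuousOn
      hgi2.continuous.continuousOn
    obtain ⟨C0, hC0⟩ := (isCompact_Icc (a := T) (b := R)).exists_bound_of_continuousOn
      (hk.continuousOn.mono hsub)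
    obtain ⟨C1, hC1⟩ := (isCompact_Icc (a := T) (b := R)).exists_bound_of_continuousOn
      (hk1.continuousOn.mono hsub)
    obtain ⟨C2, hC2⟩ := (isCompact_Icc (a := T) (b := R)).exists_bound_of_continuousOn
      (hk2.continuousOn.mono hsub)
    have hθle : ∀ x, ‖(θ x : ℂ)‖ ≤ 1 := fun x => by
      rw [Complex.norm_real, Real.norm_eq_abs, abs_of_nonneg (Real.smoothTransition.nonneg x)]
      exact Real.smoothTransition.le_one x
    -- the second derivative bound gives quadratic smallness of `k` at `T`
    have b1 : ∀ t ∈ Icc T R, ‖deriv k t‖ ≤ C2 * (t - T) := fun t ht =>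
      norm_le_of_deriv_bound (fun t ht => dk1 t (hsub ht)) k1T hC2 ht
    have b0 : ∀ t ∈ Icc T R, ‖k t‖ ≤ C2 * (t - T) * (t - T) := by
      intro t ht
      have hC2' : 0 ≤ C2 := (norm_nonneg _).trans (hC2 t ht)
      refine norm_le_of_deriv_bound (R := t) (fun x hx => dk x (hsub ⟨hx.1, hx.2.trans ht.2⟩))
        kT (fun x hx => (b1 x ⟨hx.1, hx.2.trans ht.2⟩).trans ?_) ⟨ht.1, le_rfl⟩
      have := hx.2
      gcongr
    -- Here f stands for θ' or θ''. Beyond the layer f vanishes; inside it (t - T)(j + 1) ≤ 1, and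
    -- each factor j + 1 is paired with a factor t - T from the bounds on k and k'.
    have hcase : ∀ (j : ℕ) t, t ∈ Icc T R → ∀ f : ℝ → ℝ, (∀ x, |f x| ≤ K) →
        (∀ x, 1 < x → f x = 0) → 0 ≤ C2 ∧
        ‖(f ((t - T) * (j + 1)) : ℂ) * (j + 1) * deriv k t‖ ≤ K * C2 ∧
        ‖(f ((t - T) * (j + 1)) : ℂ) * (j + 1) * k t‖ ≤ K * C2 * (R - T) ∧
        ‖(f ((t - T) * (j + 1)) : ℂ) * (j + 1) * (j + 1) * k t‖ ≤ K * C2 := by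
      intro j t ht f hf hf1
      have hC2' : 0 ≤ C2 := (norm_nonneg _).trans (hC2 t ht)
      have htT : 0 ≤ t - T := sub_nonneg.2 ht.1
      have hRT : t - T ≤ R - T := by linarith [ht.2]
      have hRT0 : 0 ≤ R - T := htT.trans hRT
      refine ⟨hC2', ?_⟩
      rcases lt_or_ge 1 ((t - T) * (j + 1)) with h | h
      · rw [hf1 _ h]
        simp only [Complex.ofReal_zero, zero_mul, norm_zero]
        refine ⟨by positivity, by positivity, by positivity⟩
      · have hj : ‖((j : ℂ) + 1)‖ = (j : ℝ) + 1 := by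
          rw [← Nat.cast_succ, Complex.norm_natCast, Nat.cast_succ]
        have hf' : ‖(f ((t - T) * (j + 1)) : ℂ)‖ ≤ K := by
          rw [Complex.norm_real]
          exact hf _
        have e1 := b1 t ht
        have e0 := b0 t ht
        have hj0 : (0 : ℝ) ≤ (j : ℝ) + 1 := by positivity
        simp only [norm_mul, hj]
        refine ⟨?_, ?_, ?_⟩
        · calc _ ≤ K * ((j : ℝ) + 1) * (C2 * (t - T)) := by gcongr
            _ = K * C2 * ((t - T) * ((j : ℝ) + 1)) := by ring
            _ ≤ K * C2 * 1 := by gcongr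
            _ = _ := mul_one _
        · calc _ ≤ K * ((j : ℝ) + 1) * (C2 * (t - T) * (t - T)) := by gcongr
            _ = K * C2 * ((t - T) * ((j : ℝ) + 1)) * (t - T) := by ring
            _ ≤ K * C2 * 1 * (R - T) := by gcongr
            _ = _ := by ring
        · calc _ ≤ K * ((j : ℝ) + 1) * ((j : ℝ) + 1) * (C2 * (t - T) * (t - T)) := by gcongr
            _ = K * C2 * ((t - T) * ((j : ℝ) + 1)) * ((t - T) * ((j : ℝ) + 1)) := by ring
            _ ≤ K * C2 * 1 * 1 := by gcongr
            _ = _ := by ring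
    have hz1 : ∀ x, 1 < x → deriv θ x = 0 := fun x hx => by
      rw [(smoothTransition_deriv_eq_zero hx).deriv_eq, deriv_const]
    have hz2 : ∀ x, 1 < x → deriv (deriv θ) x = 0 := fun x hx => by
      rw [(smoothTransition_deriv_eq_zero hx).deriv.deriv_eq]
      simp
    have hn : ‖((n : ℂ) + 1)‖ = (n : ℝ) + 1 := by
      rw [← Nat.cast_succ, Complex.norm_natCast, Nat.cast_succ]
    have hR : ∀ (t : ℝ) (x y : ℂ) (b c : ℝ), t ∈ Icc 0 R → ‖x‖ ≤ b → ‖y‖ ≤ c →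
        ‖(n + 1) * x + t * y‖ ≤ ((n : ℝ) + 1) * b + R * c := by
      intro t x y b c ht hx hy
      refine (norm_add_le _ _).trans ?_
      rw [norm_mul, norm_mul, hn, Complex.norm_real, Real.norm_eq_abs, abs_of_nonneg ht.1]
      have h1 := ht.1
      have h2 := ht.2
      have h3 : 0 ≤ R := h1.trans h2
      gcongr
    refine ⟨max (max B0 (((n : ℝ) + 1) * B1 + R * B2)) (max (B0 + C0)
      (((n : ℝ) + 1) * (B1 + (K * C2 * (R - T) + C1)) +
        R * (B2 + ((K * C2 + K * C2) + (K * C2 + C2))))), fun j t ht => ?_⟩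
    rcases lt_or_ge t T with h | h
    · rw [(hlow j t h).eq_of_nhds, radialOp_congr n (hlow j t h)]
      refine ⟨(hB0 t ht).trans ((le_max_left _ _).trans (le_max_left _ _)),
        (hR t _ _ _ _ ht (hB1 t ht) (hB2 t ht)).trans
          ((le_max_right _ _).trans (le_max_left _ _))⟩
    · have hTR : t ∈ Icc T R := ⟨h, ht.2⟩
      have ht0 : 0 < t := hT.trans_le h
      constructor
      · refine le_trans ?_ ((le_max_left _ _).trans (le_max_right _ _))
        refine (norm_add_le _ _).trans (add_le_add (hB0 t ht) ?_)
        rw [norm_mul]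
        exact (mul_le_of_le_one_left (norm_nonneg _) (hθle _)).trans (hC0 t hTR)
      · refine le_trans ?_ ((le_max_right _ _).trans (le_max_right _ _))
        rw [radialOp, (hF1 j t ht0).deriv, (hF2 j t ht0).deriv]
        obtain ⟨-, c1, c2, -⟩ := hcase j t hTR (deriv θ) (fun x => (hK x).1) hz1
        obtain ⟨-, -, -, c3⟩ := hcase j t hTR (deriv (deriv θ)) (fun x => (hK x).2) hz2
        have hm : ∀ (x : ℝ) (y : ℂ) (c : ℝ), ‖y‖ ≤ c → ‖(θ x : ℂ) * y‖ ≤ c := by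
          intro x y c hy
          rw [norm_mul]
          exact (mul_le_of_le_one_left (norm_nonneg _) (hθle _)).trans hy
        refine hR t _ _ _ _ ht ?_ ?_
        · exact (norm_add_le _ _).trans (add_le_add (hB1 t ht)
            ((norm_add_le _ _).trans (add_le_add c2 (hm _ _ _ (hC1 t hTR)))))
        · exact (norm_add_le _ _).trans (add_le_add (hB2 t ht)
            ((norm_add_le _ _).trans (add_le_add ((norm_add_le _ _).trans (add_le_add c3 c1))
              ((norm_add_le _ _).trans (add_le_add c1 (hm _ _ _ (hC2 t hTR)))))))

/-! ### Weak solutions with a single angular mode -/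

lemma continuous_laplacian {η : ℂ → ℂ} (hη : ContDiff ℝ ∞ η) : Continuous (Δ η) := by
  have hc : ∀ {g : ℂ → ℂ}, ContDiff ℝ ∞ g → ∀ v, ContDiff ℝ ∞ fun w => fderiv ℝ g w v :=
    fun hg v => (hg.fderiv_right (m := ∞) (by norm_cast)).clm_apply contDiff_const
  have : Δ η = fun z => fderiv ℝ (fun w => fderiv ℝ η w 1) z 1 +
      fderiv ℝ (fun w => fderiv ℝ η w Complex.I) z Complex.I :=
    funext (laplacian_eq_fderiv (hη.of_le (by norm_cast)))
  rw [this]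
  exact (hc (hc hη _) _).continuous.add (hc (hc hη _) _).continuous

lemma laplacian_eq_zero_of_notMem_tsupport {η : ℂ → ℂ} {z : ℂ} (hz : z ∉ tsupport η) :
    Δ η z = 0 := by
  rw [notMem_tsupport_iff_eventuallyEq] at hz
  rw [(InnerProductSpace.laplacian_congr_nhds (f₂ := fun _ => (0 : ℂ)) hz).eq_of_nhds,
    InnerProductSpace.laplacian_const]
  rfl

lemma norm_sq_le_iff {z : ℂ} {ρ : ℝ} (hρ : 0 < ρ) : ‖z‖ ^ 2 ≤ ρ ^ 2 ↔ ‖z‖ ≤ ρ := by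
  rw [sq_le_sq₀ (norm_nonneg z) hρ.le]

lemma continuous_matched {gi ge : ℝ → ℂ} (hgi : Continuous gi) (hge : ContinuousOn ge (Ioi 0))
    {T : ℝ} (hT : 0 < T) (h0 : gi T = ge T) :
    Continuous fun t => if t ≤ T then gi t else ge t := by
  -- Replacing t by max(t, T) makes the outer branch continuous on the whole line without altering
  -- it where it is used.
  have hc : Continuous fun t => ge (max t T) :=
    hge.comp_continuous (by fun_prop) fun t => hT.trans_le (le_max_right t T)
  have h := hgi.if_le hc continuous_id continuous_const (fun t (ht : t = T) => by
    rw [ht, max_self, h0])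
  convert h using 2 with t
  simp only [id]
  split_ifs with ht
  · rfl
  · rw [max_eq_left (not_le.1 ht).le]

/-- For each smooth approximant, Green's identity moves the Laplacian off the test function. The
limit is taken afterwards, when the radial equations identify the Laplacian of the approximants on
both sides of the interface. Continuity of the first derivative is what prevents a surface term. -/
lemma isSolution_separated {a ρ E : ℝ} (hρ : 0 < ρ) (l : ℤ) (n : ℕ) {gi ge : ℝ → ℂ}
    (hgi : ContDiff ℝ ∞ gi) (hge : ContDiffOn ℝ ∞ ge (Ioi 0)) (h0 : gi (ρ ^ 2) = ge (ρ ^ 2))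
    (h1 : deriv gi (ρ ^ 2) = deriv ge (ρ ^ 2))
    (hi : ∀ t, 4 * radialOp n gi t = (-a ^ 2 - E : ℝ) * gi t)
    (he : ∀ t, 0 < t → 4 * radialOp n ge t = (-E : ℝ) * ge t) :
    IsSolution (circularWell a ρ) E fun z => signedCoord l z ^ n *
      (if ‖z‖ ^ 2 ≤ ρ ^ 2 then gi (‖z‖ ^ 2) else ge (‖z‖ ^ 2)) := by
  have hT : 0 < ρ ^ 2 := by positivity
  constructor
  · exact ((signedCoord l).continuous.pow n).mul
      ((continuous_matched hgi.continuous hge.continuousOn hT h0).comp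
        (continuous_norm.pow 2))
  intro η hη hs
  obtain ⟨χ, hχ, -, hlim, hlimop, hbd⟩ := exists_smooth_approx n hgi hge hT h0 h1
  obtain ⟨R, hR⟩ := hs.isBounded.subset_closedBall 0
  obtain ⟨B, hB⟩ := hbd (R ^ 2)
  set e := signedCoord l
  set F : ℕ → ℂ → ℂ := fun j z => (e z ^ n * χ j (‖z‖ ^ 2)) * (-(Δ η z)) +
    Δ (fun z => e z ^ n * χ j (‖z‖ ^ 2)) z * η z
  have hsm : ∀ j, ContDiff ℝ ∞ fun z => e z ^ n * χ j (‖z‖ ^ 2) := fun j =>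
    contDiff_separated l n (hχ j)
  have hsΔ : HasCompactSupport (Δ η) := by
    refine HasCompactSupport.intro hs fun z hz => laplacian_eq_zero_of_notMem_tsupport hz
  have hF0 : ∀ j, ∫ z, F j z = 0 := by
    intro j
    have i1 : Integrable fun z => (e z ^ n * χ j (‖z‖ ^ 2)) * (-(Δ η z)) :=
      ((hsm j).continuous.mul (continuous_laplacian hη).neg).integrable_of_hasCompactSupport
        (HasCompactSupport.mul_left hsΔ.neg)
    have i2 : Integrable fun z => Δ (fun z => e z ^ n * χ j (‖z‖ ^ 2)) z * η z :=
      ((continuous_laplacian (hsm j)).mul hη.continuous).integrable_of_hasCompactSupport hs.mul_left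
    simp only [F]
    rw [integral_add i1 i2, ← integral_mul_laplacian (hsm j) hη hs]
    simp only [mul_neg]
    rw [integral_neg, neg_add_cancel]
  have hlimF := tendsto_integral_of_dominated_convergence (μ := volume) (F := F)
    (f := fun z => (e z ^ n * (if ‖z‖ ^ 2 ≤ ρ ^ 2 then gi (‖z‖ ^ 2) else ge (‖z‖ ^ 2))) *
      (-(Δ η z) + ((circularWell a ρ z - E : ℝ) : ℂ) * η z))
    (fun z => R ^ n * B * ‖Δ η z‖ + R ^ n * (4 * B) * ‖η z‖)
    (fun j => (((hsm j).continuous.mul (continuous_laplacian hη).neg).add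
      ((continuous_laplacian (hsm j)).mul hη.continuous)).aestronglyMeasurable)
    ?_ (fun j => Eventually.of_forall fun z => ?_) (Eventually.of_forall fun z => ?_)
  · simp only [hF0] at hlimF
    exact tendsto_nhds_unique hlimF tendsto_const_nhds
  · refine (((continuous_laplacian hη).integrable_of_hasCompactSupport hsΔ).norm.const_mul _).add
      ((hη.continuous.integrable_of_hasCompactSupport hs).norm.const_mul _)
  · by_cases hz : z ∈ tsupport η
    · have hzR : ‖z‖ ≤ R := by simpa using hR hz
      have hzt : ‖z‖ ^ 2 ∈ Icc 0 (R ^ 2) := ⟨by positivity, by gcongr⟩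
      obtain ⟨hb1, hb2⟩ := hB j _ hzt
      have hR0 : 0 ≤ R := (norm_nonneg z).trans hzR
      refine (norm_add_le _ _).trans (add_le_add ?_ ?_)
      · rw [norm_mul, norm_mul, norm_pow, norm_neg, norm_signedCoord]
        gcongr
      · rw [laplacian_separated l n (hχ j), norm_mul, norm_mul, norm_pow, norm_signedCoord,
          norm_mul]
        have : ‖(4 : ℂ)‖ = 4 := by simp
        rw [this]
        gcongr
    · have : F j z = 0 := by
        simp [F, laplacian_eq_zero_of_notMem_tsupport hz, image_eq_zero_of_notMem_tsupport hz]
      rw [this, laplacian_eq_zero_of_notMem_tsupport hz, image_eq_zero_of_notMem_tsupport hz]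
      simp
  · have hd : Tendsto (fun j => F j z) atTop (𝓝 ((e z ^ n * (if ‖z‖ ^ 2 ≤ ρ ^ 2 then gi (‖z‖ ^ 2)
        else ge (‖z‖ ^ 2))) * (-(Δ η z)) + (e z ^ n * (4 * (if ‖z‖ ^ 2 ≤ ρ ^ 2 then
          radialOp n gi (‖z‖ ^ 2) else radialOp n ge (‖z‖ ^ 2)))) * η z)) := by
      simp only [F, e, laplacian_separated l n (hχ _)]
      exact (((hlim _).const_mul _).mul_const _).add
        ((((hlimop _).const_mul _).const_mul _).mul_const _)
    convert hd using 2
    rw [circularWell]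
    simp only [← norm_sq_le_iff hρ]
    split_ifs with hz
    · rw [hi]
      ring
    · rw [he _ (hT.trans (not_le.1 hz))]
      push_cast
      ring

lemma measurable_circularWell (a ρ : ℝ) : Measurable (circularWell a ρ) :=
  Measurable.ite (measurableSet_le measurable_norm measurable_const) measurable_const
    measurable_const

/-- The test functions are smooth approximations of a compactly supported matched profile. The
interior equation removes the contribution of the disc. No equation is imposed on `ge`, so that a
cut-off solution may be used; its defect is all that survives. -/
lemma IsSolution.integral_matched_eq_zero {a ρ E : ℝ} {u : ℂ → ℂ}
    (hu : IsSolution (circularWell a ρ) E u) (hρ : 0 < ρ) (l : ℤ) (n : ℕ) {gi ge : ℝ → ℂ}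
    (hgi : ContDiff ℝ ∞ gi) (hge : ContDiffOn ℝ ∞ ge (Ioi 0)) (h0 : gi (ρ ^ 2) = ge (ρ ^ 2))
    (h1 : deriv gi (ρ ^ 2) = deriv ge (ρ ^ 2))
    (hi : ∀ t, 4 * radialOp n gi t = (-a ^ 2 - E : ℝ) * gi t)
    {T₂ : ℝ} (hT₂ : ρ ^ 2 + 1 ≤ T₂) (hvan : ∀ t, T₂ ≤ t → ge t = 0) :
    ∫ z, u z * (signedCoord l z ^ n * (if ‖z‖ ^ 2 ≤ ρ ^ 2 then 0 else
      -(4 * radialOp n ge (‖z‖ ^ 2)) - E * ge (‖z‖ ^ 2))) = 0 := by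
  have hT : 0 < ρ ^ 2 := by positivity
  have hT₂0 : 0 < T₂ := by linarith
  obtain ⟨χ, hχ, hχge, hlim, hlimop, hbd⟩ := exists_smooth_approx n hgi hge hT h0 h1
  obtain ⟨B, hB⟩ := hbd T₂
  set e := signedCoord l
  have hsm : ∀ j, ContDiff ℝ ∞ fun z => e z ^ n * χ j (‖z‖ ^ 2) := fun j =>
    contDiff_separated l n (hχ j)
  have hχ0 : ∀ j t, T₂ ≤ t → χ j t = 0 := fun j t ht => by
    rw [hχge j t (hT₂.trans ht), hvan t ht]
  set K : Set ℂ := Metric.closedBall 0 (√T₂)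
  have hK : ∀ z : ℂ, z ∈ K ↔ ‖z‖ ^ 2 ≤ T₂ := fun z => by
    rw [mem_closedBall_zero_iff, Real.le_sqrt (norm_nonneg z) hT₂0.le]
  have hcs : ∀ j, HasCompactSupport fun z => e z ^ n * χ j (‖z‖ ^ 2) := by
    intro j
    refine HasCompactSupport.intro (isCompact_closedBall (0 : ℂ) (√T₂)) fun z hz => ?_
    have hz' : ¬ ‖z‖ ^ 2 ≤ T₂ := fun h => hz ((hK z).2 h)
    rw [hχ0 j _ (not_le.1 hz').le, mul_zero]
  set F : ℕ → ℂ → ℂ := fun j z => u z * (-(Δ (fun z => e z ^ n * χ j (‖z‖ ^ 2)) z) +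
    ((circularWell a ρ z - E : ℝ) : ℂ) * (e z ^ n * χ j (‖z‖ ^ 2)))
  have hF0 : ∀ j, ∫ z, F j z = 0 := fun j => hu.weak _ (hsm j) (hcs j)
  obtain ⟨M, hM⟩ := (isCompact_closedBall (0 : ℂ) (√T₂)).exists_bound_of_continuousOn
    hu.continuous.continuousOn
  have hlimF := tendsto_integral_of_dominated_convergence (μ := volume) (F := F)
    (f := fun z => u z * (e z ^ n * (if ‖z‖ ^ 2 ≤ ρ ^ 2 then 0 else
      -(4 * radialOp n ge (‖z‖ ^ 2)) - E * ge (‖z‖ ^ 2))))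
    (K.indicator fun _ => M * (√T₂ ^ n * (4 * B) + (a ^ 2 + |E|) * (√T₂ ^ n * B)))
    (fun j => ?_) ?_ (fun j => Eventually.of_forall fun z => ?_) (Eventually.of_forall fun z => ?_)
  · simp only [hF0] at hlimF
    exact tendsto_nhds_unique hlimF tendsto_const_nhds
  · refine (hu.continuous.measurable.mul ((continuous_laplacian (hsm j)).measurable.neg.add
      (Measurable.mul ?_ (hsm j).continuous.measurable))).aestronglyMeasurable
    exact Complex.measurable_ofReal.comp ((measurable_circularWell a ρ).sub_const E)
  · exact (integrable_indicator_iff Metric.isClosed_closedBall.measurableSet).2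
      (integrableOn_const (isCompact_closedBall (0 : ℂ) (√T₂)).measure_lt_top.ne)
  · by_cases hz : z ∈ K
    · rw [indicator_of_mem hz]
      have hzR : ‖z‖ ≤ √T₂ := by simpa [K] using hz
      obtain ⟨hb1, hb2⟩ := hB j (‖z‖ ^ 2) ⟨by positivity, (hK z).1 hz⟩
      have hMz := hM z hz
      have hM0 : 0 ≤ M := (norm_nonneg _).trans hMz
      have hB0 : 0 ≤ B := (norm_nonneg _).trans hb1
      have hV : ‖((circularWell a ρ z - E : ℝ) : ℂ)‖ ≤ a ^ 2 + |E| := by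
        rw [Complex.norm_real, Real.norm_eq_abs]
        refine (abs_sub _ _).trans (add_le_add ?_ le_rfl)
        rw [circularWell]
        split_ifs
        · rw [abs_neg, abs_of_nonneg (by positivity)]
        · simp [sq_nonneg]
      simp only [F]
      rw [norm_mul]
      refine mul_le_mul hMz ((norm_add_le _ _).trans (add_le_add ?_ ?_)) (norm_nonneg _) hM0
      · rw [norm_neg, laplacian_separated l n (hχ j), norm_mul, norm_pow, norm_signedCoord,
          norm_mul, show ‖(4 : ℂ)‖ = 4 by simp]
        gcongr
      · rw [norm_mul, norm_mul, norm_pow, norm_signedCoord]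
        gcongr
    · rw [indicator_of_notMem hz]
      have hz' : T₂ < ‖z‖ ^ 2 := not_le.1 fun h => hz ((hK z).2 h)
      have hev : χ j =ᶠ[𝓝 (‖z‖ ^ 2)] fun _ => 0 := by
        filter_upwards [lt_mem_nhds hz'] with t ht using hχ0 j t ht.le
      have hop : radialOp n (χ j) (‖z‖ ^ 2) = 0 := by
        rw [radialOp_congr n hev]
        simp [radialOp]
      simp only [F, e]
      rw [laplacian_separated l n (hχ j), hop, hev.eq_of_nhds]
      simp
  · have hd : Tendsto (fun j => F j z) atTop (𝓝 (u z * (-(e z ^ n * (4 * (if ‖z‖ ^ 2 ≤ ρ ^ 2 then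
          radialOp n gi (‖z‖ ^ 2) else radialOp n ge (‖z‖ ^ 2)))) +
          ((circularWell a ρ z - E : ℝ) : ℂ) * (e z ^ n * (if ‖z‖ ^ 2 ≤ ρ ^ 2 then gi (‖z‖ ^ 2)
        else ge (‖z‖ ^ 2)))))) := by
      simp only [F, e, laplacian_separated l n (hχ _)]
      exact (((((hlimop _).const_mul _).const_mul _).neg).add
        (((hlim _).const_mul _).const_mul _)).const_mul _
    convert hd using 2
    rw [circularWell]
    simp only [← norm_sq_le_iff hρ]
    split_ifs with hz
    · rw [hi]
      ring
    · push_cast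
      ring

/-! ### Angular modes of a weak solution -/

lemma integral_polar {F : ℂ → ℂ} (hF : Continuous F) {R : ℝ} (hR : ∀ z, R < ‖z‖ → F z = 0) :
    ∫ z, F z = ∫ r in Ioi (0 : ℝ), (r : ℂ) * ∫ θ in (0 : ℝ)..(2 * π),
      F (r * Complex.exp (Complex.I * θ)) := by
  have hexp : ∀ p : ℝ × ℝ, Complex.polarCoord.symm p =
      p.1 * Complex.exp (Complex.I * p.2) := by
    intro p
    rw [Complex.polarCoord_symm_apply, mul_comm Complex.I, Complex.exp_mul_I]
    push_cast
    ring
  have hcont : Continuous fun p : ℝ × ℝ => p.1 • F (p.1 * Complex.exp (Complex.I * p.2)) := by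
    fun_prop
  have hint : IntegrableOn (fun p : ℝ × ℝ => p.1 • F (p.1 * Complex.exp (Complex.I * p.2)))
      (Ioi (0 : ℝ) ×ˢ Ioo (-π) π) := by
    refine IntegrableOn.of_forall_sdiff_eq_zero (s := Icc 0 R ×ˢ Icc (-π) π)
      (hcont.continuousOn.integrableOn_compact (isCompact_Icc.prod isCompact_Icc))
      (measurableSet_Ioi.prod measurableSet_Ioo) fun p hp => ?_
    have h1 : 0 < p.1 := hp.1.1
    have h2 : R < p.1 := by
      by_contra h
      exact hp.2 ⟨⟨h1.le, not_lt.1 h⟩, ⟨hp.1.2.1.le, hp.1.2.2.le⟩⟩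
    rw [hR _ (by rw [norm_mul, mul_comm Complex.I, Complex.norm_exp_ofReal_mul_I,
      Complex.norm_real, mul_one, Real.norm_eq_abs, abs_of_pos h1]; exact h2), smul_zero]
  rw [← Complex.integral_comp_polarCoord_symm]
  simp only [hexp]
  rw [polarCoord_target, Measure.volume_eq_prod, setIntegral_prod _ hint]
  refine setIntegral_congr_fun measurableSet_Ioi fun r _ => ?_
  simp only [Complex.real_smul]
  rw [integral_const_mul, ← integral_Ioc_eq_integral_Ioo,
    ← intervalIntegral.integral_of_le (by linarith [Real.pi_pos])]
  congr 1
  have hper : Function.Periodic (fun θ : ℝ => F (r * Complex.exp (Complex.I * θ))) (2 * π) := by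
    intro θ
    simp only
    congr 2
    rw [← Complex.exp_periodic (Complex.I * θ)]
    congr 1
    push_cast
    ring
  have := hper.intervalIntegral_add_eq (-π) 0
  rwa [show -π + 2 * π = π by ring, zero_add] at this

/-- The sign -l is the complex conjugate mode: pairing without conjugation against r^{|l|} e^{-ilθ}
extracts the Fourier coefficient of index l. -/
lemma integral_mul_separated {u : ℂ → ℂ} (hu : Continuous u) (l : ℤ) {H : ℝ → ℂ}
    (hH : Continuous H) {R : ℝ} (hR : ∀ r, R < r → H r = 0) :
    ∫ z, u z * (signedCoord (-l) z ^ l.natAbs * H ‖z‖) =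
      2 * π * ∫ r in Ioi (0 : ℝ), (r : ℂ) ^ (l.natAbs + 1) * H r * angularMode u l r := by
  rw [integral_polar (R := R) (by fun_prop) (fun z hz => by rw [hR _ hz]; simp),
    ← integral_const_mul]
  refine setIntegral_congr_fun measurableSet_Ioi fun r (hr : 0 < r) => ?_
  have hpi : (π : ℂ) ≠ 0 := by exact_mod_cast Real.pi_ne_zero
  have h1 : ∀ θ : ℝ, u (r * Complex.exp (Complex.I * θ)) *
      (signedCoord (-l) (r * Complex.exp (Complex.I * θ)) ^ l.natAbs *
        H ‖(r * Complex.exp (Complex.I * θ) : ℂ)‖) =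
      ((r : ℂ) ^ l.natAbs * H r) * (u ((r : ℂ) * Complex.exp (Complex.I * (θ : ℂ))) *
      Complex.exp (-(Complex.I * (l : ℂ) * (θ : ℂ)))) := by
    intro θ
    have h2 := signedCoord_polar (-l) r θ
    rw [Int.natAbs_neg] at h2
    rw [h2, norm_mul, mul_comm Complex.I, Complex.norm_exp_ofReal_mul_I, Complex.norm_real, mul_one,
      Real.norm_eq_abs, abs_of_pos hr]
    push_cast
    rw [show Complex.I * -(l : ℂ) * θ = -(Complex.I * l * θ) by ring]
    ring
  simp only [h1, angularMode]
  rw [intervalIntegral.integral_const_mul]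
  generalize (∫ θ in (0 : ℝ)..(2 * π), u ((r : ℂ) * Complex.exp (Complex.I * (θ : ℂ))) *
      Complex.exp (-(Complex.I * (l : ℂ) * (θ : ℂ)))) = J
  field_simp
  ring

lemma eq_of_hasDerivAt_zero {f : ℝ → ℂ} (hf : ∀ t, 0 < t → HasDerivAt f 0 t) {x y : ℝ}
    (hx : 0 < x) (hy : 0 < y) : f x = f y := by
  refine (convex_Ioi (0 : ℝ)).is_const_of_fderivWithin_eq_zero (𝕜 := ℝ)
    (fun t ht => (hf t ht).differentiableAt.differentiableWithinAt) (fun t ht => ?_) hx hy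
  rw [fderivWithin_of_isOpen isOpen_Ioi ht]
  ext
  simpa using (hf t ht).deriv

/-- The weight t^{n+1} is the integrating factor that puts `radialOp` in divergence form. The
formula is the one-dimensional Green identity, and it makes the weighted Wronskian of two solutions
constant. -/
lemma hasDerivAt_radialWronskian (n : ℕ) {p q : ℝ → ℂ} (hp : ContDiffOn ℝ ∞ p (Ioi 0))
    (hq : ContDiffOn ℝ ∞ q (Ioi 0)) {t : ℝ} (ht : 0 < t) :
    HasDerivAt (fun t : ℝ => (t : ℂ) ^ (n + 1) * (p t * deriv q t - q t * deriv p t))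
      ((t : ℂ) ^ n * (p t * radialOp n q t - q t * radialOp n p t)) t := by
  have hd : ∀ {f : ℝ → ℂ}, ContDiffOn ℝ ∞ f (Ioi 0) → HasDerivAt f (deriv f t) t := fun hf =>
    ((hf.differentiableOn (by simp)).differentiableAt (Ioi_mem_nhds ht)).hasDerivAt
  have hp1 := hp.deriv_of_isOpen (m := ∞) isOpen_Ioi (by norm_cast)
  have hq1 := hq.deriv_of_isOpen (m := ∞) isOpen_Ioi (by norm_cast)
  have hpow : HasDerivAt (fun t : ℝ => (t : ℂ) ^ (n + 1)) ((n + 1) * (t : ℂ) ^ n) t := by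
    have := (hasDerivAt_id t).ofReal_comp.pow (n + 1)
    refine this.congr_deriv ?_
    simp
  refine (hpow.mul (((hd hp).mul (hd hq1)).sub ((hd hq).mul (hd hp1)))).congr_deriv ?_
  simp only [radialOp, Pi.sub_apply, Pi.mul_apply]
  ring

lemma continuousOn_radialOp (n : ℕ) {g : ℝ → ℂ} (hg : ContDiffOn ℝ ∞ g (Ioi 0)) :
    ContinuousOn (radialOp n g) (Ioi 0) := by
  have h1 := hg.deriv_of_isOpen (m := ∞) isOpen_Ioi (by norm_cast)
  have h2 := h1.deriv_of_isOpen (m := ∞) isOpen_Ioi (by norm_cast)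
  exact (continuousOn_const.mul h1.continuousOn).add
    (Complex.continuous_ofReal.continuousOn.mul h2.continuousOn)

/-- An angular mode of a solution, known far out, is matched at `r = ρ` to the regular solution
of the radial equation inside the well. -/
lemma IsSolution.mode_matched {a ρ E : ℝ} {u : ℂ → ℂ}
    (hu : IsSolution (circularWell a ρ) E u) (hρ : 0 < ρ) (l : ℤ) {gi ge p : ℝ → ℂ}
    (hgi : ContDiff ℝ ∞ gi) (hge : ContDiffOn ℝ ∞ ge (Ioi 0)) (hp : ContDiffOn ℝ ∞ p (Ioi 0))
    (h0 : gi (ρ ^ 2) = ge (ρ ^ 2)) (h1 : deriv gi (ρ ^ 2) = deriv ge (ρ ^ 2))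
    (hi : ∀ t, 4 * radialOp l.natAbs gi t = (-a ^ 2 - E : ℝ) * gi t)
    (he : ∀ t, 0 < t → 4 * radialOp l.natAbs ge t = (-E : ℝ) * ge t)
    (hpe : ∀ t, 0 < t → 4 * radialOp l.natAbs p t = (-E : ℝ) * p t) {R : ℝ}
    (hmode : ∀ r, R < r → angularMode u l r = (r : ℂ) ^ l.natAbs * p (r ^ 2)) :
    p (ρ ^ 2) * deriv gi (ρ ^ 2) = gi (ρ ^ 2) * deriv p (ρ ^ 2) := by
  set n := l.natAbs
  set T₀ : ℝ := max (R ^ 2) (ρ ^ 2) + 1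
  have hρ2 : 0 < ρ ^ 2 := by positivity
  have hT₀ρ : ρ ^ 2 + 1 ≤ T₀ := by simp only [T₀]; gcongr; exact le_max_right _ _
  have hT₀R : R ^ 2 + 1 ≤ T₀ := by simp only [T₀]; gcongr; exact le_max_left _ _
  have hT₀ : 0 < T₀ := by linarith
  -- the matched solution, cut off between `T₀ + 1` and `T₀ + 2`
  set ψ : ℝ → ℂ := fun t => 1 - (Real.smoothTransition (t - (T₀ + 1)) : ℂ)
  have hψ : ContDiff ℝ ∞ ψ := contDiff_const.sub (Complex.ofRealCLM.contDiff.comp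
    (Real.smoothTransition.contDiff.comp (contDiff_id.sub contDiff_const)))
  set χ : ℝ → ℂ := fun t => ψ t * ge t
  have hχ : ContDiffOn ℝ ∞ χ (Ioi 0) := hψ.contDiffOn.mul hge
  have hχge : ∀ t, t < T₀ + 1 → χ =ᶠ[𝓝 t] ge := by
    intro t ht
    filter_upwards [gt_mem_nhds ht] with y hy
    simp only [χ, ψ]
    rw [Real.smoothTransition.zero_of_nonpos (by linarith)]
    simp
  have hχ0 : ∀ t, T₀ + 2 ≤ t → χ t = 0 := by
    intro t ht
    simp only [χ, ψ]
    rw [Real.smoothTransition.one_of_one_le (by linarith)]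
    simp
  have hχ0' : ∀ t, T₀ + 2 < t → χ =ᶠ[𝓝 t] fun _ => 0 := by
    intro t ht
    filter_upwards [lt_mem_nhds ht] with y hy using hχ0 y (le_of_lt hy)
  have hρT : ρ ^ 2 < T₀ + 1 := by linarith
  -- The defect of the cut-off solution; it can be nonzero only for T₀ + 1 ≤ t ≤ T₀ + 2, where the
  -- mode of u is known to be r^n p(r²).
  set G : ℝ → ℂ := fun t => -(4 * radialOp n χ t) - E * χ t
  have hG : ContinuousOn G (Ioi 0) :=
    (continuousOn_const.mul (continuousOn_radialOp n hχ)).neg.sub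
      (continuousOn_const.mul hχ.continuousOn)
  have hGlow : ∀ t, 0 < t → t < T₀ + 1 → G t = 0 := by
    intro t ht ht'
    simp only [G]
    rw [radialOp_congr n (hχge t ht'), (hχge t ht').eq_of_nhds, he t ht]
    push_cast
    ring
  have hGhigh : ∀ t, T₀ + 2 < t → G t = 0 := by
    intro t ht
    simp only [G]
    rw [radialOp_congr n (hχ0' t ht), (hχ0' t ht).eq_of_nhds]
    simp [radialOp]
  set H : ℝ → ℂ := fun r => if r ^ 2 ≤ ρ ^ 2 then 0 else G (r ^ 2)
  have hHlow : ∀ r, r ^ 2 < T₀ + 1 → H r = 0 := by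
    intro r hr
    simp only [H]
    split_ifs with h
    · rfl
    · exact hGlow _ (hρ2.trans (not_le.1 h)) hr
  have hH : Continuous H := by
    rw [continuous_iff_continuousAt]
    intro r
    rcases lt_or_ge (r ^ 2) (T₀ + 1) with h | h
    · have : H =ᶠ[𝓝 r] fun _ => 0 := by
        filter_upwards [(continuous_pow 2).continuousAt.eventually (gt_mem_nhds h)] with y hy
          using hHlow y hy
      exact continuousAt_const.congr this.symm
    · have h' : ρ ^ 2 < r ^ 2 := hρT.trans_le h
      have : H =ᶠ[𝓝 r] fun r => G (r ^ 2) := by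
        filter_upwards [(continuous_pow 2).continuousAt.eventually (lt_mem_nhds h')] with y hy
        simp only [H]
        rw [if_neg (not_le.2 hy)]
      refine ContinuousAt.congr ?_ this.symm
      exact ContinuousAt.comp (f := fun r : ℝ => r ^ 2)
        (hG.continuousAt (Ioi_mem_nhds (hρ2.trans h'))) (by fun_prop)
  set r₁ := √T₀
  set r₂ := √(T₀ + 3)
  have hr₁ : r₁ ^ 2 = T₀ := Real.sq_sqrt hT₀.le
  have hr₂ : r₂ ^ 2 = T₀ + 3 := Real.sq_sqrt (by linarith)
  have hr₁0 : 0 < r₁ := Real.sqrt_pos.2 hT₀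
  have hr₂0 : 0 < r₂ := Real.sqrt_pos.2 (by linarith)
  have hr₁₂ : r₁ ≤ r₂ := Real.sqrt_le_sqrt (by linarith)
  have hHhigh : ∀ r, r₂ < r → H r = 0 := by
    intro r hr
    have : T₀ + 3 < r ^ 2 := by rw [← hr₂]; gcongr
    simp only [H]
    rw [if_neg (by linarith), hGhigh _ (by linarith)]
  have hI := hu.integral_matched_eq_zero hρ (-l) n hgi hχ
    (h0.trans (hχge _ hρT).eq_of_nhds.symm) (h1.trans (hχge _ hρT).deriv_eq.symm) hi
    (T₂ := T₀ + 2) (by linarith) hχ0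
  have hI2 := integral_mul_separated hu.continuous l hH hHhigh
  rw [show (∫ z, u z * (signedCoord (-l) z ^ l.natAbs * H ‖z‖)) = 0 from hI] at hI2
  have hpi : (2 * π : ℂ) ≠ 0 := by
    exact_mod_cast mul_ne_zero two_ne_zero Real.pi_ne_zero
  have hI3 : ∫ r in Ioi (0 : ℝ), (r : ℂ) ^ (n + 1) * H r * angularMode u l r = 0 := by
    rcases mul_eq_zero.1 hI2.symm with h | h
    · exact absurd h hpi
    · exact h
  -- The interval from √T₀ to √(T₀+3) contains the support of the defect and lies beyond both R and
  -- ρ, so the angular mode may be replaced by its known form.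
  have hI4 : ∫ r in r₁..r₂, (r : ℂ) ^ (n + 1) * G (r ^ 2) * ((r : ℂ) ^ n * p (r ^ 2)) = 0 := by
    rw [intervalIntegral.integral_of_le hr₁₂, ← hI3]
    rw [setIntegral_eq_of_subset_of_forall_sdiff_eq_zero (s := Ioc r₁ r₂) (t := Ioi 0)
      (f := fun r : ℝ => (r : ℂ) ^ (n + 1) * H r * angularMode u l r) measurableSet_Ioi (fun r hr => hr₁0.trans hr.1)]
    · refine setIntegral_congr_fun measurableSet_Ioc fun r hr => ?_
      have hr2 : T₀ < r ^ 2 := by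
        have := hr.1
        rw [← hr₁]
        gcongr
      have hRr : R < r := by
        by_contra h
        have : r ^ 2 ≤ R ^ 2 := pow_le_pow_left₀ (hr₁0.trans hr.1).le (not_lt.1 h) 2
        linarith
      rw [hmode r hRr]
      simp only [H]
      rw [if_neg (by linarith)]
    · intro r hr
      have h0r : 0 < r := hr.1
      have : H r = 0 := by
        rcases le_or_gt r r₁ with h | h
        · refine hHlow r ?_
          have : r ^ 2 ≤ r₁ ^ 2 := pow_le_pow_left₀ h0r.le h 2
          linarith
        · refine hHhigh r ?_
          by_contra h'
          exact hr.2 ⟨h, not_lt.1 h'⟩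
      rw [this]
      simp
  -- By Green's identity the integrand is the r-derivative of -2Φ(r²): the factor 2 comes from d(r²)
  -- = 2r dr, and the equation of p turns χ `radialOp` p into the term with E.
  set Φ : ℝ → ℂ := fun t => (t : ℂ) ^ (n + 1) * (p t * deriv χ t - χ t * deriv p t)
  have hΦ : ∀ r ∈ uIcc r₁ r₂, HasDerivAt (fun r : ℝ => -2 * Φ (r ^ 2))
      ((r : ℂ) ^ (n + 1) * G (r ^ 2) * ((r : ℂ) ^ n * p (r ^ 2))) r := by
    intro r hr
    rw [uIcc_of_le hr₁₂] at hr
    have hr0 : 0 < r := hr₁0.trans_le hr.1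
    have hr20 : 0 < r ^ 2 := by positivity
    have h2 : HasDerivAt (fun r : ℝ => r ^ 2) (2 * r) r := by simpa using hasDerivAt_pow 2 r
    have h := (HasDerivAt.scomp (h := fun r : ℝ => r ^ 2) r
      (hasDerivAt_radialWronskian n hp hχ hr20) h2).const_mul (-2 : ℂ)
    refine h.congr_deriv ?_
    have := hpe (r ^ 2) hr20
    simp only [G, Complex.real_smul]
    push_cast at this ⊢
    linear_combination (r : ℂ) ^ (2 * n + 1) * χ (r ^ 2) * this
  have hcont : ContinuousOn (fun r : ℝ => (r : ℂ) ^ (n + 1) * G (r ^ 2) * ((r : ℂ) ^ n * p (r ^ 2)))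
      (uIcc r₁ r₂) := by
    rw [uIcc_of_le hr₁₂]
    have hm : MapsTo (fun r : ℝ => r ^ 2) (Icc r₁ r₂) (Ioi 0) := fun r hr => by
      have : 0 < r := hr₁0.trans_le hr.1
      exact pow_pos this 2
    have c1 : ContinuousOn (fun r : ℝ => G (r ^ 2)) (Icc r₁ r₂) :=
      hG.comp (continuous_pow 2).continuousOn hm
    have c2 : ContinuousOn (fun r : ℝ => p (r ^ 2)) (Icc r₁ r₂) :=
      hp.continuousOn.comp (continuous_pow 2).continuousOn hm
    have c3 : ∀ m : ℕ, ContinuousOn (fun r : ℝ => (r : ℂ) ^ m) (Icc r₁ r₂) := fun m =>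
      (Complex.continuous_ofReal.pow m).continuousOn
    exact ((c3 _).mul c1).mul ((c3 _).mul c2)
  rw [intervalIntegral.integral_eq_sub_of_hasDerivAt hΦ hcont.intervalIntegrable, hr₁, hr₂] at hI4
  have hΦ2 : Φ (T₀ + 3) = 0 := by
    simp only [Φ]
    rw [(hχ0' (T₀ + 3) (by linarith)).deriv_eq, (hχ0' (T₀ + 3) (by linarith)).eq_of_nhds]
    simp
  have hΦ1 : Φ T₀ = (T₀ : ℂ) ^ (n + 1) * (p T₀ * deriv ge T₀ - ge T₀ * deriv p T₀) := by
    simp only [Φ]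
    rw [(hχge T₀ (by linarith)).deriv_eq, (hχge T₀ (by linarith)).eq_of_nhds]
  -- Φ vanishes past the cut-off, hence also at T₀, where χ is still `ge`. The Wronskian of p and
  -- `ge` is constant, so its vanishing is transported from T₀ inward to ρ².
  have hconst := eq_of_hasDerivAt_zero (f := fun t : ℝ => (t : ℂ) ^ (n + 1) *
    (p t * deriv ge t - ge t * deriv p t)) (fun t ht => by
      refine (hasDerivAt_radialWronskian n hp hge ht).congr_deriv ?_
      linear_combination (t : ℂ) ^ n / 4 * (p t * he t ht - ge t * hpe t ht)) hρ2 hT₀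
  rw [← hΦ1, show Φ T₀ = 0 by simpa [hΦ2] using hI4] at hconst
  have hρ2' : ((ρ ^ 2 : ℝ) : ℂ) ^ (n + 1) ≠ 0 := pow_ne_zero _ (by exact_mod_cast hρ2.ne')
  rw [h0, h1]
  exact sub_eq_zero.1 ((mul_eq_zero.1 hconst).resolve_left hρ2')

/-! ### Radial solutions -/

lemma contDiffOn_besselD (n : ℕ) : ContDiffOn ℝ ∞ (besselD n) (Ioi 0) := by
  rw [contDiffOn_infty]
  intro m
  induction m generalizing n with
  | zero =>
    exact contDiffOn_zero.2 fun s hs =>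
      (hasDerivAt_besselD n hs).continuousAt.continuousWithinAt
  | succ m ih =>
    push_cast
    rw [contDiffOn_succ_iff_deriv_of_isOpen isOpen_Ioi]
    refine ⟨fun s hs => (hasDerivAt_besselD n hs).differentiableAt.differentiableWithinAt,
      by simp, ?_⟩
    exact (ih (n + 1)).neg.congr fun s hs => (hasDerivAt_besselD n hs).deriv

/-- The general solution `α C_n(kt) + β D_n(kt)` of `t g'' + (n + 1) g' + k g = 0`. -/
def radialSol (n : ℕ) (k : ℝ) (α β : ℂ) (t : ℝ) : ℂ :=
  α * (besselC n (k * t) : ℂ) + β * (besselD n (k * t) : ℂ)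

lemma hasDerivAt_comp_const_mul {f : ℝ → ℝ} {d k t : ℝ} (hf : HasDerivAt f d (k * t)) :
    HasDerivAt (fun t : ℝ => (f (k * t) : ℂ)) (k * d) t := by
  have h2 : HasDerivAt (fun t : ℝ => k * t) k t := by
    simpa using (hasDerivAt_id t).const_mul k
  refine (hf.comp t h2).ofReal_comp.congr_deriv ?_
  push_cast
  ring

lemma hasDerivAt_besselC_scaled (n : ℕ) (k : ℝ) (α : ℂ) (t : ℝ) :
    HasDerivAt (fun t => α * (besselC n (k * t) : ℂ))
      ((-(k * α)) * (besselC (n + 1) (k * t) : ℂ)) t := by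
  refine ((hasDerivAt_comp_const_mul (hasDerivAt_besselC n (k * t))).const_mul α).congr_deriv ?_
  push_cast
  ring

lemma contDiff_besselC_scaled (n : ℕ) (k : ℝ) (α : ℂ) :
    ContDiff ℝ ∞ fun t : ℝ => α * (besselC n (k * t) : ℂ) :=
  contDiff_const.mul (Complex.ofRealCLM.contDiff.comp
    ((contDiff_besselC n).comp (contDiff_const.mul contDiff_id)))

lemma deriv_besselC_scaled (n : ℕ) (k : ℝ) (α : ℂ) :
    deriv (fun t : ℝ => α * (besselC n (k * t) : ℂ)) =
      fun t => (-(k * α)) * (besselC (n + 1) (k * t) : ℂ) :=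
  funext fun t => (hasDerivAt_besselC_scaled n k α t).deriv

lemma radialOp_besselC_scaled (n : ℕ) (k : ℝ) (α : ℂ) (t : ℝ) :
    4 * radialOp n (fun t : ℝ => α * (besselC n (k * t) : ℂ)) t =
      (-(4 * k) : ℝ) * (α * (besselC n (k * t) : ℂ)) := by
  have h := congrArg ((↑) : ℝ → ℂ) (besselC_recurrence n (k * t))
  rw [radialOp, deriv_besselC_scaled, deriv_besselC_scaled]
  push_cast at h ⊢
  linear_combination 4 * k * α * h

lemma contDiffOn_radialSol (n : ℕ) {k : ℝ} (hk : 0 < k) (α β : ℂ) :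
    ContDiffOn ℝ ∞ (radialSol n k α β) (Ioi 0) := by
  refine (contDiff_besselC_scaled n k α).contDiffOn.add (contDiffOn_const.mul ?_)
  exact Complex.ofRealCLM.contDiff.comp_contDiffOn ((contDiffOn_besselD n).comp
    (contDiff_const.mul contDiff_id).contDiffOn fun t ht => mul_pos hk ht)

lemma hasDerivAt_radialSol (n : ℕ) {k : ℝ} (hk : 0 < k) (α β : ℂ) {t : ℝ} (ht : 0 < t) :
    HasDerivAt (radialSol n k α β) (radialSol (n + 1) k (-(k * α)) (-(k * β)) t) t := by
  refine ((hasDerivAt_besselC_scaled n k α t).add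
    ((hasDerivAt_comp_const_mul (hasDerivAt_besselD n (mul_pos hk ht))).const_mul β)).congr_deriv ?_
  rw [radialSol]
  push_cast
  ring

lemma radialOp_radialSol (n : ℕ) {k : ℝ} (hk : 0 < k) (α β : ℂ) {t : ℝ} (ht : 0 < t) :
    4 * radialOp n (radialSol n k α β) t = (-(4 * k) : ℝ) * radialSol n k α β t := by
  have h1 := congrArg ((↑) : ℝ → ℂ) (besselC_recurrence n (k * t))
  have h2 := congrArg ((↑) : ℝ → ℂ) (besselD_recurrence n (mul_pos hk ht))
  have hd : deriv (radialSol n k α β) =ᶠ[𝓝 t] radialSol (n + 1) k (-(k * α)) (-(k * β)) := by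
    filter_upwards [lt_mem_nhds ht] with y hy using (hasDerivAt_radialSol n hk α β hy).deriv
  rw [radialOp, hd.deriv_eq, hd.eq_of_nhds, (hasDerivAt_radialSol _ hk _ _ ht).deriv]
  simp only [radialSol]
  push_cast at h1 h2 ⊢
  linear_combination 4 * k * α * h1 + 4 * k * β * h2

/-- The determinant matching `C_n` to the regular solution in the well. -/
def matchN (n : ℕ) (A s : ℝ) : ℝ :=
  (s + A) * besselC (n + 1) (s + A) * besselC n s - s * besselC (n + 1) s * besselC n (s + A)

/-- The determinant matching `D_n` to the regular solution in the well. -/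
def matchM (n : ℕ) (A s : ℝ) : ℝ :=
  (s + A) * besselC (n + 1) (s + A) * besselD n s - s * besselD (n + 1) s * besselC n (s + A)

/-- M and N are real, so a zero would annihilate both. They are the images of the interior data
under an invertible system whose determinant is the Wronskian; the interior data C_n(s+A) and
C_{n+1}(s+A) would then both vanish, which is impossible. -/
lemma matchM_sub_ne_zero (n : ℕ) {A s : ℝ} (hA : 0 < A) (hs : 0 < s) :
    (matchM n A s : ℂ) - Complex.I * (π * matchN n A s : ℝ) ≠ 0 := by
  intro h
  have h1 := congrArg Complex.re h
  have h2 := congrArg Complex.im h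
  simp [Real.pi_ne_zero] at h1 h2
  have hW := wronskian n hs
  have hx : (s + A) * besselC (n + 1) (s + A) = 0 := by
    have := congrArg (fun x => s ^ (n + 1) * x)
      (show (besselC (n + 1) s * matchM n A s - besselD (n + 1) s * matchN n A s) = 0 by
        rw [h1, h2]; ring)
    simp only [matchM, matchN] at this
    linear_combination this - (s + A) * besselC (n + 1) (s + A) * hW
  have hy : s * besselC n (s + A) = 0 := by
    have := congrArg (fun x => s ^ (n + 1) * x)
      (show (besselC n s * matchM n A s - besselD n s * matchN n A s) = 0 by
        rw [h1, h2]; ring)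
    simp only [matchM, matchN] at this
    linear_combination this - s * besselC n (s + A) * hW
  rcases besselC_ne_zero_or n (add_pos hs hA) with h | h
  · exact h ((mul_eq_zero.1 hy).resolve_left hs.ne')
  · exact h ((mul_eq_zero.1 hx).resolve_left (add_pos hs hA).ne')

/-- Cramer's rule for continuing the interior solution outside; the factor s^n, together with the s
contained in M and N, is the inverse of the determinant given by the Wronskian. -/
lemma matched_radialSol {a ρ lam : ℝ} (hρ : 0 < ρ) (hlam : 0 < lam) (n : ℕ) (α : ℂ) :
    let s := lam ^ 2 * ρ ^ 2 / 4
    let A := a ^ 2 * ρ ^ 2 / 4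
    let gi := fun t : ℝ => α * (besselC n ((a ^ 2 + lam ^ 2) / 4 * t) : ℂ)
    let ge := radialSol n (lam ^ 2 / 4) (α * s ^ n * matchM n A s) (-(α * s ^ n * matchN n A s))
    gi (ρ ^ 2) = ge (ρ ^ 2) ∧ deriv gi (ρ ^ 2) = deriv ge (ρ ^ 2) := by
  intro s A gi ge
  have hs : 0 < s := by positivity
  have hρ2 : 0 < ρ ^ 2 := by positivity
  have hρc : (ρ : ℂ) ≠ 0 := by exact_mod_cast hρ.ne'
  have hW := congrArg ((↑) : ℝ → ℂ) (wronskian n hs)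
  have hτ : (a ^ 2 + lam ^ 2) / 4 * ρ ^ 2 = s + A := by simp only [s, A]; ring
  have hk : lam ^ 2 / 4 * ρ ^ 2 = s := by simp only [s]; ring
  have hk' : ((lam : ℂ) ^ 2 / 4) = s / ρ ^ 2 := by
    rw [← hk]; push_cast; field_simp
  have hτ' : (((a : ℂ) ^ 2 + lam ^ 2) / 4) = (s + A) / ρ ^ 2 := by
    rw [← Complex.ofReal_add, ← hτ]; push_cast; field_simp
  constructor
  · simp only [gi, ge, radialSol, hτ, hk, matchM, matchN]
    push_cast at hW ⊢
    linear_combination -(α * (besselC n (s + A) : ℂ)) * hW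
  · rw [show deriv ge (ρ ^ 2) = _ from
      (hasDerivAt_radialSol n (by positivity) _ _ hρ2).deriv]
    simp only [gi, deriv_besselC_scaled]
    simp only [radialSol, hτ, hk, matchM, matchN]
    push_cast at hW ⊢
    rw [hk', hτ']
    field_simp
    linear_combination (α * (s + A) * (besselC (n + 1) (s + A) : ℂ)) * hW

/-! ### Resonances at zero -/

lemma integral_exp_int_mul (m : ℤ) (hm : m ≠ 0) :
    ∫ θ in (0 : ℝ)..(2 * π), Complex.exp (Complex.I * m * θ) = 0 := by
  have hc : Complex.I * (m : ℂ) ≠ 0 := mul_ne_zero Complex.I_ne_zero (by exact_mod_cast hm)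
  rw [integral_exp_mul_complex hc]
  have : Complex.exp (Complex.I * m * ((2 * π : ℝ) : ℂ)) = 1 := by
    rw [← Complex.exp_int_mul_two_pi_mul_I m]
    congr 1
    push_cast
    ring
  rw [this]
  simp

lemma angularMode_separated (l m : ℤ) (g : ℝ → ℂ) {r : ℝ} (hr : 0 < r) :
    angularMode (fun z => signedCoord l z ^ l.natAbs * g (‖z‖ ^ 2)) m r =
      if m = l then (r : ℂ) ^ l.natAbs * g (r ^ 2) else 0 := by
  have h1 : ∀ θ : ℝ, signedCoord l (r * Complex.exp (Complex.I * θ)) ^ l.natAbs *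
      g (‖(r * Complex.exp (Complex.I * θ) : ℂ)‖ ^ 2) *
        Complex.exp (-(Complex.I * (m : ℂ) * (θ : ℂ))) =
      ((r : ℂ) ^ l.natAbs * g (r ^ 2)) * Complex.exp (Complex.I * (l - m : ℤ) * θ) := by
    intro θ
    rw [signedCoord_polar, norm_mul, mul_comm Complex.I (θ : ℂ), Complex.norm_exp_ofReal_mul_I,
      Complex.norm_real, mul_one, Real.norm_eq_abs, abs_of_pos hr,
      show Complex.I * (l - m : ℤ) * (θ : ℂ) = Complex.I * l * θ + -(Complex.I * m * θ) by
        push_cast; ring, Complex.exp_add]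
    ring
  have hpi : (π : ℂ) ≠ 0 := by exact_mod_cast Real.pi_ne_zero
  simp only [angularMode, h1]
  rw [intervalIntegral.integral_const_mul]
  split_ifs with h
  · subst h
    simp
    field_simp
  · rw [integral_exp_int_mul _ (sub_ne_zero.2 (Ne.symm h))]
    simp

lemma hasDerivAt_inv_ofReal {t : ℝ} (ht : 0 < t) (β : ℂ) (m : ℕ) :
    HasDerivAt (fun t : ℝ => β * ((t : ℂ) ^ m)⁻¹) (-(m * β) * ((t : ℂ) ^ (m + 1))⁻¹) t := by
  have ht' : (t : ℂ) ≠ 0 := by exact_mod_cast ht.ne'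
  have h := (((hasDerivAt_id t).ofReal_comp.pow m).inv (pow_ne_zero m ht')).const_mul β
  refine h.congr_deriv ?_
  rcases m with _ | m
  · simp
  · simp only [Nat.add_sub_cancel, id, Pi.pow_apply]
    field_simp
    simp
    ring

lemma contDiffOn_inv_ofReal : ContDiffOn ℝ ∞ (fun t : ℝ => (t : ℂ)⁻¹) (Ioi 0) :=
  Complex.ofRealCLM.contDiff.contDiffOn.inv fun t ht => by
    simpa using (mem_Ioi.1 ht).ne'

/-- The solutions `α + β / t` of `t g'' + 2 g' = 0`. -/
lemma radialOp_const_add_inv (α β : ℂ) {t : ℝ} (ht : 0 < t) :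
    deriv (fun t : ℝ => α + β * (t : ℂ)⁻¹) t = -β * ((t : ℂ) ^ 2)⁻¹ ∧
      radialOp 1 (fun t : ℝ => α + β * (t : ℂ)⁻¹) t = 0 := by
  have ht' : (t : ℂ) ≠ 0 := by exact_mod_cast ht.ne'
  have h1 : ∀ t : ℝ, 0 < t → HasDerivAt (fun t : ℝ => α + β * (t : ℂ)⁻¹)
      (-β * ((t : ℂ) ^ 2)⁻¹) t := fun t ht => by
    simpa using (hasDerivAt_inv_ofReal ht β 1).const_add α
  have hd : deriv (fun t : ℝ => α + β * (t : ℂ)⁻¹) =ᶠ[𝓝 t] fun t : ℝ => -β * ((t : ℂ) ^ 2)⁻¹ := by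
    filter_upwards [lt_mem_nhds ht] with y hy using (h1 y hy).deriv
  refine ⟨(h1 t ht).deriv, ?_⟩
  rw [radialOp, hd.deriv_eq, hd.eq_of_nhds, (hasDerivAt_inv_ofReal ht (-β) 2).deriv]
  push_cast
  field_simp
  ring

/-- The solutions `α + β log t` of `t g'' + g' = 0`. -/
lemma radialOp_const_add_log (α β : ℂ) {t : ℝ} (ht : 0 < t) :
    deriv (fun t : ℝ => α + β * (Real.log t : ℂ)) t = β * (t : ℂ)⁻¹ ∧
      radialOp 0 (fun t : ℝ => α + β * (Real.log t : ℂ)) t = 0 := by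
  have ht' : (t : ℂ) ≠ 0 := by exact_mod_cast ht.ne'
  have h1 : ∀ t : ℝ, 0 < t → HasDerivAt (fun t : ℝ => α + β * (Real.log t : ℂ))
      (β * (t : ℂ)⁻¹) t := fun t ht => by
    simpa using (((Real.hasDerivAt_log ht.ne').ofReal_comp).const_mul β).const_add α
  have hd : deriv (fun t : ℝ => α + β * (Real.log t : ℂ)) =ᶠ[𝓝 t] fun t : ℝ => β * (t : ℂ)⁻¹ := by
    filter_upwards [lt_mem_nhds ht] with y hy using (h1 y hy).deriv
  refine ⟨(h1 t ht).deriv, ?_⟩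
  have h2 : HasDerivAt (fun t : ℝ => β * (t : ℂ)⁻¹) (-β * ((t : ℂ) ^ 2)⁻¹) t := by
    simpa using hasDerivAt_inv_ofReal ht β 1
  rw [radialOp, hd.deriv_eq, hd.eq_of_nhds, h2.deriv]
  push_cast
  field_simp
  ring

lemma besselJ_one_eq_zero_iff {a ρ : ℝ} (ha : 0 < a) (hρ : 0 < ρ) :
    besselJ 1 (a * ρ) = 0 ↔ besselC 1 (a ^ 2 * ρ ^ 2 / 4) = 0 := by
  simp only [besselJ, zero_le_one, if_true, Int.natAbs_one, besselJNat_eq]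
  rw [show (a * ρ) ^ 2 / 4 = a ^ 2 * ρ ^ 2 / 4 by ring]
  have : a * ρ / 2 ≠ 0 := by positivity
  simp [this]

lemma radialOp_interior_zero (a : ℝ) (n : ℕ) (t : ℝ) :
    4 * radialOp n (fun t : ℝ => 1 * (besselC n (a ^ 2 / 4 * t) : ℂ)) t =
      (-a ^ 2 - 0 : ℝ) * (1 * (besselC n (a ^ 2 / 4 * t) : ℂ)) := by
  rw [radialOp_besselC_scaled]
  push_cast
  ring

lemma HasSResonance.hasZeroResonance {V : ℂ → ℝ} (h : HasSResonance V) : HasZeroResonance V := by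
  obtain ⟨u, c, hu, hc, h0⟩ := h
  refine ⟨u, c, hu, hc, ?_⟩
  rintro rfl
  obtain ⟨R, hR, hm⟩ := hc
  have := hm (R + 1) (by linarith) 0
  simp [angularMode] at this
  exact h0 this.symm

lemma HasPResonance.hasZeroResonance {V : ℂ → ℝ} (h : HasPResonance V) : HasZeroResonance V := by
  obtain ⟨u, c, hu, hc, -, h1⟩ := h
  refine ⟨u, c, hu, hc, ?_⟩
  rintro rfl
  obtain ⟨R, hR, hm⟩ := hc
  have hR' : ((R + 1 : ℝ) : ℂ) ≠ 0 := by exact_mod_cast (by linarith : R + 1 ≠ 0)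
  have key : ∀ l, c l = 0 := by
    intro l
    have := hm (R + 1) (by linarith) l
    simp only [angularMode, Pi.zero_apply, zero_mul, intervalIntegral.integral_zero, mul_zero] at this
    exact (mul_eq_zero.1 this.symm).resolve_right (zpow_ne_zero _ hR')
  rcases h1 with h1 | h1 <;> exact h1 (key _)

/-- In the modes ±1 the zero-energy exterior solutions are g = α + β/t, and outgoing means α = 0.
Matching β/t to C_1 requires A C_2(A) = C_1(A), which by the recurrence is C_0(A) = 0. -/
lemma hasPResonance_iff {a ρ : ℝ} (hρ : 0 < ρ) :
    HasPResonance (circularWell a ρ) ↔ besselC 0 (a ^ 2 * ρ ^ 2 / 4) = 0 := by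
  set A := a ^ 2 * ρ ^ 2 / 4
  have hT : 0 < ρ ^ 2 := by positivity
  have hρc : (ρ : ℂ) ≠ 0 := by exact_mod_cast hρ.ne'
  have hA : a ^ 2 / 4 * ρ ^ 2 = A := by simp only [A]; ring
  have hA' : (A : ℂ) = (a : ℂ) ^ 2 / 4 * ρ ^ 2 := by rw [← hA]; push_cast; ring
  have hrec := congrArg ((↑) : ℝ → ℂ) (besselC_recurrence 0 A)
  simp only [zero_add, CharP.cast_eq_zero, one_mul] at hrec
  push_cast at hrec
  have hext : ∀ α β : ℂ, ContDiffOn ℝ ∞ (fun t : ℝ => α + β * (t : ℂ)⁻¹) (Ioi 0) := fun α β =>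
    contDiffOn_const.add (contDiffOn_const.mul contDiffOn_inv_ofReal)
  have hode : ∀ α β : ℂ, ∀ t : ℝ, 0 < t → 4 * radialOp 1 (fun t : ℝ => α + β * (t : ℂ)⁻¹) t =
      (-0 : ℝ) * (α + β * (t : ℂ)⁻¹) := fun α β t ht => by
    rw [(radialOp_const_add_inv α β ht).2]
    simp
  constructor
  · rintro ⟨u, c, hu, ⟨R, hR, hm⟩, -, hc⟩
    have key : ∀ l : ℤ, l.natAbs = 1 → c l ≠ 0 → besselC 0 A = 0 := by
      intro l hl hcl
      set Y := deriv (fun t : ℝ => 1 * (besselC 1 (a ^ 2 / 4 * t) : ℂ)) (ρ ^ 2) with hY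
      -- The coefficients of `ge` solve the two matching equations at ρ²: β = -ρ⁴ Y from the slope
      -- and then α from the value.
      have hm' := hu.mode_matched hρ l (gi := fun t : ℝ => 1 * (besselC 1 (a ^ 2 / 4 * t) : ℂ))
        (ge := fun t : ℝ => ((besselC 1 A : ℂ) + ρ ^ 2 * Y) + (-((ρ : ℂ) ^ 4 * Y)) * (t : ℂ)⁻¹)
        (p := fun t : ℝ => 0 + c l * (t : ℂ)⁻¹) (contDiff_besselC_scaled _ _ _)
        (hext _ _) (hext _ _)
        (by simp only [hA]; push_cast; field_simp; ring)
        (by rw [(radialOp_const_add_inv _ _ hT).1, ← hY]; push_cast; field_simp)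
        (by rw [hl]; exact radialOp_interior_zero a 1)
        (by rw [hl]; exact hode _ _) (by rw [hl]; exact hode _ _) (R := R)
        (fun r hr => by
          have hr0 : (r : ℂ) ≠ 0 := by exact_mod_cast (hR.trans hr).ne'
          rw [hm r hr l, hl, show |l| = 1 by rw [Int.abs_eq_natAbs, hl]; rfl]
          push_cast
          rw [zpow_neg_one]
          field_simp
          simp)
      rw [(radialOp_const_add_inv _ _ hT).1] at hm'
      simp only [deriv_besselC_scaled, hA] at hm'
      push_cast at hm'
      rw [zero_add] at hm'
      field_simp at hm'
      have : (besselC 0 A : ℂ) = 0 := by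
        rw [hA'] at hrec
        linear_combination hrec + (1 / 4) * hm'
      exact_mod_cast this
    rcases hc with hc | hc
    · exact key 1 rfl hc
    · exact key (-1) rfl hc
  · intro h0
    have hA0 : 0 < A ∨ besselC 1 A ≠ 0 := by
      rcases eq_or_ne a 0 with rfl | ha
      · right
        simp [A, besselC_zero_right]
      · left
        positivity
    have h1 : besselC 1 A ≠ 0 := by
      rcases hA0 with hA0 | h
      · exact (besselC_ne_zero_or 0 hA0).resolve_left fun h => h h0
      · exact h
    have hge0 : (fun t : ℝ => 1 * (besselC 1 (a ^ 2 / 4 * t) : ℂ)) (ρ ^ 2) =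
        0 + ((ρ : ℂ) ^ 2 * besselC 1 A) * ((ρ ^ 2 : ℝ) : ℂ)⁻¹ := by
      simp only [hA]
      push_cast
      field_simp
      ring
    have hu := isSolution_separated (a := a) (E := 0) hρ 1 1
      (gi := fun t : ℝ => 1 * (besselC 1 (a ^ 2 / 4 * t) : ℂ))
      (ge := fun t : ℝ => 0 + ((ρ : ℂ) ^ 2 * besselC 1 A) * (t : ℂ)⁻¹)
      (contDiff_besselC_scaled _ _ _) (hext _ _) hge0
      (by
        rw [(radialOp_const_add_inv _ _ hT).1, deriv_besselC_scaled]
        simp only [hA]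
        rw [h0, hA', Complex.ofReal_zero] at hrec
        push_cast
        field_simp
        linear_combination (-4) * hrec)
      (radialOp_interior_zero a 1) (hode _ _)
    refine ⟨_, fun m => if m = 1 then (ρ : ℂ) ^ 2 * besselC 1 A else 0, hu, ⟨ρ, hρ, ?_⟩, by simp,
      Or.inl ?_⟩
    · intro r hr m
      have hr0 : 0 < r := hρ.trans hr
      have hr0' : (r : ℂ) ≠ 0 := by exact_mod_cast hr0.ne'
      have hlt : ¬ r ^ 2 ≤ ρ ^ 2 := by
        rw [not_le]
        gcongr
      have := angularMode_separated 1 m (fun t => if t ≤ ρ ^ 2 then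
        1 * (besselC 1 (a ^ 2 / 4 * t) : ℂ) else
        0 + ((ρ : ℂ) ^ 2 * besselC 1 A) * (t : ℂ)⁻¹) hr0
      simp only [Int.natAbs_one] at this
      rw [this]
      split_ifs with hm
      · subst hm
        simp
        field_simp
      · simp [hm]
    · simp [h1, hρ.ne']

/-- In mode 0 the zero-energy exterior solutions are α + β log t, and outgoing means β = 0. A
constant matches the interior solution only if the latter has zero slope at the edge, and that slope
is a nonzero multiple of C_1(A). -/
lemma hasSResonance_iff {a ρ : ℝ} (ha : 0 < a) (hρ : 0 < ρ) :
    HasSResonance (circularWell a ρ) ↔ besselC 1 (a ^ 2 * ρ ^ 2 / 4) = 0 := by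
  set A := a ^ 2 * ρ ^ 2 / 4
  have hA0 : 0 < A := by positivity
  have hT : 0 < ρ ^ 2 := by positivity
  have hρc : (ρ : ℂ) ≠ 0 := by exact_mod_cast hρ.ne'
  have hac : (a : ℂ) ≠ 0 := by exact_mod_cast ha.ne'
  have hA : a ^ 2 / 4 * ρ ^ 2 = A := by simp only [A]; ring
  have hext : ∀ α β : ℂ, ContDiffOn ℝ ∞ (fun t : ℝ => α + β * (Real.log t : ℂ)) (Ioi 0) :=
    fun α β => contDiffOn_const.add (contDiffOn_const.mul
      (Complex.ofRealCLM.contDiff.comp_contDiffOn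
        (Real.contDiffOn_log.mono fun t ht => (mem_Ioi.1 ht).ne')))
  have hode : ∀ α β : ℂ, ∀ t : ℝ, 0 < t →
      4 * radialOp 0 (fun t : ℝ => α + β * (Real.log t : ℂ)) t =
      (-0 : ℝ) * (α + β * (Real.log t : ℂ)) := fun α β t ht => by
    rw [(radialOp_const_add_log α β ht).2]
    simp
  constructor
  · rintro ⟨u, c, hu, ⟨R, hR, hm⟩, hc⟩
    set Y := deriv (fun t : ℝ => 1 * (besselC 0 (a ^ 2 / 4 * t) : ℂ)) (ρ ^ 2) with hY
    have hm' := hu.mode_matched hρ 0 (gi := fun t : ℝ => 1 * (besselC 0 (a ^ 2 / 4 * t) : ℂ))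
      (ge := fun t : ℝ => ((besselC 0 A : ℂ) - ρ ^ 2 * Y * Real.log (ρ ^ 2)) +
        (ρ ^ 2 * Y) * (Real.log t : ℂ))
      (p := fun t : ℝ => c 0 + 0 * (Real.log t : ℂ)) (contDiff_besselC_scaled _ _ _)
      (hext _ _) (hext _ _)
      (by simp only [hA]; ring)
      (by rw [(radialOp_const_add_log _ _ hT).1, ← hY]; push_cast; field_simp)
      (radialOp_interior_zero a 0) (hode _ _) (hode _ _) (R := R)
      (fun r hr => by
        rw [hm r hr 0]
        simp)
    rw [(radialOp_const_add_log _ _ hT).1] at hm'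
    simp only [deriv_besselC_scaled, hA] at hm'
    simpa [hc, hac] using hm'
  · intro h1
    have h0 : besselC 0 A ≠ 0 := (besselC_ne_zero_or 0 hA0).resolve_right fun h => h h1
    have hu := isSolution_separated (a := a) (E := 0) hρ 0 0
      (gi := fun t : ℝ => 1 * (besselC 0 (a ^ 2 / 4 * t) : ℂ))
      (ge := fun t : ℝ => (besselC 0 A : ℂ) + 0 * (Real.log t : ℂ))
      (contDiff_besselC_scaled _ _ _) (hext _ _) (by simp [hA])
      (by
        rw [(radialOp_const_add_log _ _ hT).1, deriv_besselC_scaled]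
        simp [hA, h1])
      (radialOp_interior_zero a 0) (hode _ _)
    refine ⟨_, fun m => if m = 0 then (besselC 0 A : ℂ) else 0, hu, ⟨ρ, hρ, ?_⟩, by simpa using h0⟩
    intro r hr m
    have hr0 : 0 < r := hρ.trans hr
    have hlt : ¬ r ^ 2 ≤ ρ ^ 2 := by
      rw [not_le]
      gcongr
    have := angularMode_separated 0 m (fun t => if t ≤ ρ ^ 2 then
      1 * (besselC 0 (a ^ 2 / 4 * t) : ℂ) else (besselC 0 A : ℂ) + 0 * (Real.log t : ℂ)) hr0
    simp only [Int.natAbs_zero] at this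
    rw [this]
    split_ifs with hm
    · subst hm
      simp
    · simp [hm]

/-! ### The scattering matrix -/

/-- The eigenvalue of the scattering matrix on the modes `e^{±inθ}`. -/
def scatteringEigenvalue (n : ℕ) (A s : ℝ) : ℂ :=
  ((matchM n A s : ℂ) + Complex.I * (π * matchN n A s : ℝ)) /
    ((matchM n A s : ℂ) - Complex.I * (π * matchN n A s : ℝ))

/-- The factor between Hankel functions and the functions `C_n`, `D_n`. -/
def hankelScale (l : ℤ) (lam : ℝ) : ℂ :=
  (if 0 ≤ l then 1 else (-1) ^ l.natAbs) * ((lam : ℂ) / 2) ^ l.natAbs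

lemma hankelScale_ne_zero (l : ℤ) {lam : ℝ} (hlam : 0 < lam) : hankelScale l lam ≠ 0 := by
  have : (lam : ℂ) ≠ 0 := by exact_mod_cast hlam.ne'
  rw [hankelScale]
  split_ifs <;> simp [this]

lemma hankel_combination (l : ℤ) {lam r : ℝ} (hlam : 0 < lam) (hr : 0 < r) (c d : ℂ) :
    c * hankel1 l (lam * r) + d * hankel2 l (lam * r) =
      (r : ℂ) ^ l.natAbs * radialSol l.natAbs (lam ^ 2 / 4) (hankelScale l lam * (c + d))
        (hankelScale l lam * (Complex.I / π * (c - d))) (r ^ 2) := by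
  have h1 := besselJNat_eq l.natAbs (lam * r)
  have h2 := besselYNat_eq l.natAbs (mul_pos hlam hr)
  have hpi : (π : ℂ) ≠ 0 := by exact_mod_cast Real.pi_ne_zero
  rw [show (lam * r) ^ 2 / 4 = lam ^ 2 / 4 * r ^ 2 by ring] at h1 h2
  simp only [hankel1, hankel2, besselJ, besselY, hankelScale, radialSol, h1, h2]
  split_ifs
  · push_cast
    field_simp
    ring
  · push_cast
    field_simp
    ring

lemma fourierCoeff_angularBasis (l m : ℤ) :
    fourierCoeff (angularBasis l) m = if m = l then 1 else 0 := by
  rw [← fourierBasis_repr, angularBasis, ← coe_fourierBasis, HilbertBasis.repr_self]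
  simp [lp.single_apply, Pi.single_apply]

lemma fourierCoeff_smul_angularBasis (w : ℂ) (l m : ℤ) :
    fourierCoeff ((w • angularBasis l : L2Circle)) m = if m = l then w else 0 := by
  have h := fourierCoeff_angularBasis l m
  rw [← fourierBasis_repr] at h ⊢
  rw [map_smul, lp.coeFn_smul, Pi.smul_apply, h]
  simp

/-- With incoming amplitude 1 and outgoing amplitude w, the exterior mode is proportional to (w+1)
C_n + (i/π)(w-1) D_n. Matching at ρ is one linear equation in w, so the eigenvalue does not depend
on the choice of the scattering matrix or of the solution. -/
lemma IsScatteringMatrix.eigenvalue_eq {a ρ lam : ℝ} (ha : 0 < a) (hρ : 0 < ρ) (hlam : 0 < lam)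
    {S : L2Circle →L[ℂ] L2Circle} (hS : IsScatteringMatrix (circularWell a ρ) lam S) {l : ℤ} {w : ℂ}
    (hw : S (angularBasis l) = w • angularBasis l) :
    w = scatteringEigenvalue l.natAbs (a ^ 2 * ρ ^ 2 / 4) (lam ^ 2 * ρ ^ 2 / 4) := by
  obtain ⟨u, hu, R, hR, hm⟩ := hS l
  set n := l.natAbs
  set A := a ^ 2 * ρ ^ 2 / 4
  set s := lam ^ 2 * ρ ^ 2 / 4
  have hA : 0 < A := by positivity
  have hs : 0 < s := by positivity
  have hk : 0 < lam ^ 2 / 4 := by positivity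
  have hT : 0 < ρ ^ 2 := by positivity
  have hρc : (ρ : ℂ) ≠ 0 := by exact_mod_cast hρ.ne'
  have hE : -(4 * (lam ^ 2 / 4)) = -lam ^ 2 := by ring
  obtain ⟨h0, h1⟩ := matched_radialSol (a := a) hρ hlam n 1
  have hmm := hu.mode_matched hρ l
    (gi := fun t : ℝ => 1 * (besselC n ((a ^ 2 + lam ^ 2) / 4 * t) : ℂ))
    (p := radialSol n (lam ^ 2 / 4) (hankelScale l lam * (w + 1))
        (hankelScale l lam * (Complex.I / π * (w - 1))))
    (contDiff_besselC_scaled _ _ _) (contDiffOn_radialSol n hk _ _)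
    (contDiffOn_radialSol n hk _ _) h0 h1
    (fun t => by
      rw [radialOp_besselC_scaled]
      push_cast
      ring)
    (fun t ht => by rw [radialOp_radialSol n hk _ _ ht, hE])
    (fun t ht => by rw [radialOp_radialSol n hk _ _ ht, hE]) (R := R)
    (fun r hr => by
      rw [hm r hr l, hw]
      beta_reduce
      rw [fourierCoeff_smul_angularBasis, if_pos rfl, Pi.single_eq_same,
        hankel_combination l hlam (hR.trans hr)])
  have hτ : (a ^ 2 + lam ^ 2) / 4 * ρ ^ 2 = s + A := by simp only [s, A]; ring
  have hk1 : lam ^ 2 / 4 * ρ ^ 2 = s := by simp only [s]; ring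
  have hk' : ((lam : ℂ) ^ 2 / 4) = s / ρ ^ 2 := by
    rw [← hk1]; push_cast; field_simp
  have hτ' : (((a : ℂ) ^ 2 + lam ^ 2) / 4) = (s + A) / ρ ^ 2 := by
    rw [← Complex.ofReal_add, ← hτ]; push_cast; field_simp
  rw [(hasDerivAt_radialSol n hk _ _ hT).deriv, deriv_besselC_scaled] at hmm
  simp only [radialSol, hτ, hk1] at hmm
  push_cast at hmm
  rw [hk', hτ'] at hmm
  have hpi : (π : ℂ) ≠ 0 := by exact_mod_cast Real.pi_ne_zero
  have hsc := hankelScale_ne_zero l hlam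
  have hne := matchM_sub_ne_zero n hA hs
  rw [scatteringEigenvalue, eq_div_iff hne]
  -- The matching condition after removing the nonzero scale factor; solving it for w gives the
  -- quotient.
  have key : (w + 1) * (π * matchN n A s) + Complex.I * (w - 1) * matchM n A s = 0 := by
    simp only [matchM, matchN]
    push_cast
    field_simp at hmm
    linear_combination -hmm
  push_cast
  linear_combination (-Complex.I) * key + ((w - 1) * matchM n A s) * Complex.I_sq

/-- Unimodular multiples of an orthonormal basis are again orthonormal, so the diagonal prescription
extends to an isometry. -/
lemma exists_diagonal_operator (w : ℤ → ℂ) (hw : ∀ l, ‖w l‖ = 1) :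
    ∃ S : L2Circle →L[ℂ] L2Circle, ∀ l, S (angularBasis l) = w l • angularBasis l := by
  have hon : Orthonormal ℂ (fun l => w l • angularBasis l) := by
    have hb : Orthonormal ℂ angularBasis := orthonormal_fourier
    constructor
    · intro l
      rw [norm_smul, hw, hb.1, one_mul]
    · intro l m hlm
      rw [inner_smul_left, inner_smul_right, hb.2 hlm]
      simp
  refine ⟨hon.orthogonalFamily.linearIsometry.toContinuousLinearMap.comp
    (fourierBasis (T := 2 * π)).repr.toContinuousLinearEquiv.toContinuousLinearMap, fun l => ?_⟩
  have : (fourierBasis (T := 2 * π)).repr (angularBasis l) = lp.single 2 l (1 : ℂ) := by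
    rw [angularBasis, ← coe_fourierBasis, HilbertBasis.repr_self]
  simp only [ContinuousLinearMap.comp_apply]
  erw [this]
  simp

lemma norm_scatteringEigenvalue (n : ℕ) {A s : ℝ} (hA : 0 < A) (hs : 0 < s) :
    ‖scatteringEigenvalue n A s‖ = 1 := by
  have hne := matchM_sub_ne_zero n hA hs
  have hconj : (matchM n A s : ℂ) + Complex.I * (π * matchN n A s : ℝ) =
      (starRingEnd ℂ) ((matchM n A s : ℂ) - Complex.I * (π * matchN n A s : ℝ)) := by
    simp
  rw [scatteringEigenvalue, hconj, norm_div, Complex.norm_conj, div_self (norm_ne_zero_iff.2 hne)]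

lemma exists_scatteringMatrix {a ρ lam : ℝ} (ha : 0 < a) (hρ : 0 < ρ) (hlam : 0 < lam) :
    ∃ S : L2Circle →L[ℂ] L2Circle, IsScatteringMatrix (circularWell a ρ) lam S ∧
      ∀ l : ℤ, S (angularBasis l) = scatteringEigenvalue l.natAbs (a ^ 2 * ρ ^ 2 / 4)
        (lam ^ 2 * ρ ^ 2 / 4) • angularBasis l := by
  set A := a ^ 2 * ρ ^ 2 / 4
  set s := lam ^ 2 * ρ ^ 2 / 4
  have hA : 0 < A := by positivity
  have hs : 0 < s := by positivity
  have hk : 0 < lam ^ 2 / 4 := by positivity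
  have hE : -(4 * (lam ^ 2 / 4)) = -lam ^ 2 := by ring
  obtain ⟨S, hS⟩ := exists_diagonal_operator (fun l => scatteringEigenvalue l.natAbs A s)
    fun l => norm_scatteringEigenvalue l.natAbs hA hs
  refine ⟨S, fun l => ?_, hS⟩
  set n := l.natAbs
  have hne := matchM_sub_ne_zero n hA hs
  set q := (matchM n A s : ℂ) - Complex.I * (π * matchN n A s : ℝ) with hq
  have hpi : (π : ℂ) ≠ 0 := by exact_mod_cast Real.pi_ne_zero
  have hsc : (s : ℂ) ^ n ≠ 0 := pow_ne_zero _ (by exact_mod_cast hs.ne')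
  -- The interior amplitude is normalised so that the incoming Hankel coefficient is 1: with w the
  -- eigenvalue, w + 1 = 2M/q and (i/π)(w - 1) = -2N/q.
  set α : ℂ := hankelScale l lam * (2 / q) / s ^ n
  obtain ⟨h0, h1⟩ := matched_radialSol (a := a) hρ hlam n α
  have hu := isSolution_separated (a := a) (E := lam ^ 2) hρ l n
    (contDiff_besselC_scaled n ((a ^ 2 + lam ^ 2) / 4) α)
    (contDiffOn_radialSol n hk _ _) h0 h1
    (fun t => by
      rw [radialOp_besselC_scaled]
      push_cast
      ring)
    (fun t ht => by rw [radialOp_radialSol n hk _ _ ht, hE])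
  refine ⟨_, hu, ρ, hρ, fun r hr m => ?_⟩
  have hr0 : 0 < r := hρ.trans hr
  have hlt : ¬ r ^ 2 ≤ ρ ^ 2 := by
    rw [not_le]
    gcongr
  have hmode := angularMode_separated l m (fun t => if t ≤ ρ ^ 2 then
    α * (besselC n ((a ^ 2 + lam ^ 2) / 4 * t) : ℂ) else
      radialSol n (lam ^ 2 / 4) (α * s ^ n * matchM n A s) (-(α * s ^ n * matchN n A s)) t) hr0
  refine Eq.trans hmode ?_
  rw [hS l, if_neg hlt]
  beta_reduce
  rw [fourierCoeff_smul_angularBasis]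
  split_ifs with hml
  · subst hml
    rw [Pi.single_eq_same, hankel_combination m hlam hr0, scatteringEigenvalue, ← hq]
    congr 2
    · simp only [α]
      field_simp
      rw [hq]
      push_cast
      ring
    · simp only [α]
      field_simp
      rw [hq]
      push_cast
      linear_combination (-2 * π * (matchN n A s : ℂ) * hankelScale m lam) * Complex.I_sq
  · rw [Pi.single_eq_of_ne hml]
    simp

/-! ### The derivative of a phase shift -/

lemma hasDerivAt_mul_succ {f g : ℝ → ℝ} {f₂ d : ℝ} {n : ℕ} {s : ℝ}
    (hg : HasDerivAt g (-f₂) s) (hrec : s * f₂ = (n + 1) * g s - f s) (hd : d = f s - n * g s) :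
    HasDerivAt (fun s => s * g s) d s := by
  refine ((hasDerivAt_id s).mul hg).congr_deriv ?_
  simp only [id]
  rw [hd]
  linear_combination -hrec

lemma hasDerivAt_mul_besselC (n : ℕ) (s : ℝ) :
    HasDerivAt (fun s => s * besselC (n + 1) s) (besselC n s - n * besselC (n + 1) s) s :=
  hasDerivAt_mul_succ (hasDerivAt_besselC (n + 1) s) (besselC_recurrence n s) rfl

lemma hasDerivAt_mul_besselD (n : ℕ) {s : ℝ} (hs : 0 < s) :
    HasDerivAt (fun s => s * besselD (n + 1) s) (besselD n s - n * besselD (n + 1) s) s :=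
  hasDerivAt_mul_succ (hasDerivAt_besselD (n + 1) hs) (besselD_recurrence n hs) rfl

lemma hasDerivAt_comp_add_const' {f : ℝ → ℝ} {d s A : ℝ} (hf : HasDerivAt f d (s + A)) :
    HasDerivAt (fun s => f (s + A)) d s := by
  simpa using hf.comp_add_const s A

/-- N is a combination of C_n(s) and C_{n+1}(s), and M is the same combination of D_n(s) and
D_{n+1}(s). The derivatives keep this form with common coefficients, so N'M - NM' factors into a 2×2
determinant of coefficients times the Wronskian. -/
lemma hasDerivAt_matchN (n : ℕ) (A s : ℝ) :
    HasDerivAt (matchN n A) (-(n * besselC (n + 1) (s + A)) * besselC n s +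
      (n * besselC n (s + A) - A * besselC (n + 1) (s + A)) * besselC (n + 1) s) s := by
  have h1 := (hasDerivAt_comp_add_const' (hasDerivAt_mul_besselC n (s + A))).mul
    (hasDerivAt_besselC n s)
  have h2 := (hasDerivAt_mul_besselC n s).mul
    (hasDerivAt_comp_add_const' (hasDerivAt_besselC n (s + A)))
  refine (h1.sub h2).congr_deriv ?_
  ring

lemma hasDerivAt_matchM (n : ℕ) (A : ℝ) {s : ℝ} (hs : 0 < s) :
    HasDerivAt (matchM n A) (-(n * besselC (n + 1) (s + A)) * besselD n s +
      (n * besselC n (s + A) - A * besselC (n + 1) (s + A)) * besselD (n + 1) s) s := by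
  have h1 := (hasDerivAt_comp_add_const' (hasDerivAt_mul_besselC n (s + A))).mul
    (hasDerivAt_besselD n hs)
  have h2 := (hasDerivAt_mul_besselD n hs).mul
    (hasDerivAt_comp_add_const' (hasDerivAt_besselC n (s + A)))
  refine (h1.sub h2).congr_deriv ?_
  ring

/-- The derivative, with respect to `s = lam² ρ² / 4`, of the phase shift in the modes
`e^{±inθ}`. -/
def phaseDensity (n : ℕ) (A s : ℝ) : ℝ :=
  A * besselC (n + 1) (s + A) * (n * besselC n (s + A) - (s + A) * besselC (n + 1) (s + A)) /
    (s ^ (n + 1) * (matchM n A s ^ 2 + (π * matchN n A s) ^ 2))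

lemma matchM_sq_add_pos (n : ℕ) {A s : ℝ} (hA : 0 < A) (hs : 0 < s) :
    0 < matchM n A s ^ 2 + (π * matchN n A s) ^ 2 := by
  have h := matchM_sub_ne_zero n hA hs
  by_contra hle
  have h1 := sq_nonneg (matchM n A s)
  have h2 := sq_nonneg (π * matchN n A s)
  have h3 : matchM n A s = 0 := by
    rw [← sq_eq_zero_iff]
    linarith
  have h4 : π * matchN n A s = 0 := by
    rw [← sq_eq_zero_iff]
    linarith
  exact h (by rw [h3, h4]; simp)

lemma matchM_add_ne_zero (n : ℕ) {A s : ℝ} (hA : 0 < A) (hs : 0 < s) :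
    (matchM n A s : ℂ) + Complex.I * (π * matchN n A s : ℝ) ≠ 0 := by
  have := norm_scatteringEigenvalue n hA hs
  rw [scatteringEigenvalue] at this
  intro h
  rw [h] at this
  simp at this

lemma hasDerivAt_scatteringEigenvalue (n : ℕ) {A s : ℝ} (hA : 0 < A) (hs : 0 < s) :
    HasDerivAt (scatteringEigenvalue n A)
      (2 * π * Complex.I * phaseDensity n A s * scatteringEigenvalue n A s) s := by
  have hM := (hasDerivAt_matchM n A hs).ofReal_comp
  have hN := (((hasDerivAt_matchN n A s).const_mul π).ofReal_comp).const_mul Complex.I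
  have hne := matchM_sub_ne_zero n hA hs
  have hne' := matchM_add_ne_zero n hA hs
  refine ((hM.add hN).div (hM.sub hN) hne).congr_deriv ?_
  have hW := congrArg ((↑) : ℝ → ℂ) (wronskian n hs)
  have hpos := (matchM_sq_add_pos n hA hs).ne'
  have hsq : ((matchM n A s ^ 2 + (π * matchN n A s) ^ 2 : ℝ) : ℂ) =
      ((matchM n A s : ℂ) - Complex.I * (π * matchN n A s : ℝ)) *
        ((matchM n A s : ℂ) + Complex.I * (π * matchN n A s : ℝ)) := by
    push_cast
    linear_combination (π * matchN n A s : ℂ) ^ 2 * Complex.I_sq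
  have hsn : (s : ℂ) ^ (n + 1) ≠ 0 := pow_ne_zero _ (by exact_mod_cast hs.ne')
  rw [phaseDensity, scatteringEigenvalue, Complex.ofReal_div, Complex.ofReal_mul (s ^ (n + 1)), hsq]
  simp only [Pi.add_apply, Pi.sub_apply]
  set P := (matchM n A s : ℂ) + Complex.I * (π * matchN n A s : ℝ) with hP
  set Q := (matchM n A s : ℂ) - Complex.I * (π * matchN n A s : ℝ) with hQ
  push_cast
  field_simp
  rw [hP, hQ]
  simp only [matchM, matchN]
  push_cast at hW ⊢
  linear_combination (2 * π * Complex.I * A * besselC (n + 1) (s + A) * (n * besselC n (s + A) -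
    (s + A) * besselC (n + 1) (s + A))) * hW

/-- A continuous phase agrees near x with a fixed branch of the logarithm of g/g(x). Keeping |f(y) -
f(x)| below 1/2 puts the argument 2π(f(y) - f(x)) inside (-π, π). -/
lemma hasDerivAt_of_exp_eq {f : ℝ → ℝ} {g : ℝ → ℂ} {x d : ℝ} (hf : ContinuousAt f x)
    (hfg : ∀ᶠ y in 𝓝 x, Complex.exp (2 * (π : ℂ) * Complex.I * (f y : ℂ)) = g y)
    (hg : HasDerivAt g (2 * π * Complex.I * d * g x) x) : HasDerivAt f d x := by
  have hgx : g x ≠ 0 := by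
    rw [← hfg.self_of_nhds]
    exact Complex.exp_ne_zero _
  have h1 := (hg.div_const (g x)).clog_real (by simp [div_self hgx])
  have h2 := (Complex.imCLM.hasFDerivAt.comp_hasDerivAt x h1).div_const (2 * π)
  have h3 := h2.const_add (f x)
  have hpi := Real.pi_pos
  have hd : d = Complex.imCLM (2 * π * Complex.I * d * g x / g x / (g x / g x)) / (2 * π) := by
    rw [div_self hgx, div_one, mul_div_assoc, div_self hgx]
    simp
  rw [hd]
  refine h3.congr_of_eventuallyEq ?_
  have hnear : ∀ᶠ y in 𝓝 x, |f y - f x| < 1 / 2 := by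
    have := Metric.continuousAt_iff'.1 hf (1 / 2) (by norm_num)
    simpa [Real.dist_eq] using this
  filter_upwards [hfg, hnear] with y hy hy'
  have hexp : g y / g x = Complex.exp ((2 * π * (f y - f x) : ℝ) * Complex.I) := by
    rw [← hy, ← hfg.self_of_nhds, ← Complex.exp_sub]
    congr 1
    push_cast
    ring
  rw [abs_lt] at hy'
  simp only [Function.comp]
  rw [hexp, Complex.log_exp (by simp; nlinarith) (by simp; nlinarith)]
  simp

/-! ### Behaviour of the matching determinants at `s = 0` -/

/-- `s ^ n D_n(s)`. -/
def besselDh (n : ℕ) (s : ℝ) : ℝ := s ^ n * besselD n s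

lemma besselDh_eq (n : ℕ) {s : ℝ} (hs : 0 < s) :
    besselDh n s = s ^ n * (Real.log s * besselC n s - besselE n s) -
      ∑ k ∈ Finset.range n, ((n - k - 1)! : ℝ) / (k ! : ℝ) * s ^ k := by
  have : s ^ n * ∑ k ∈ Finset.range n, ((n - k - 1)! : ℝ) / (k ! : ℝ) *
      s ^ ((k : ℤ) - (n : ℤ)) = ∑ k ∈ Finset.range n, ((n - k - 1)! : ℝ) / (k ! : ℝ) * s ^ k := by
    rw [Finset.mul_sum]
    refine Finset.sum_congr rfl fun k _ => ?_
    rw [zpow_sub₀ hs.ne', zpow_natCast, zpow_natCast]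
    field_simp
  rw [besselDh, besselD, ← this]
  ring

/-- The scaled matching determinant `s ^ n M_n`. -/
def matchMh (n : ℕ) (A s : ℝ) : ℝ := s ^ n * matchM n A s

lemma matchMh_eq (n : ℕ) (A s : ℝ) : matchMh n A s =
    (s + A) * besselC (n + 1) (s + A) * besselDh n s - besselC n (s + A) * besselDh (n + 1) s := by
  rw [matchMh, matchM, besselDh, besselDh]
  ring

/-- The recurrences cancel the leading singular terms of the defining formula and expose C_m(s+A) as
the coefficient of the dominant term; its zeros at s = 0 are the exceptional cases. -/
lemma matchMh_succ (m : ℕ) (A : ℝ) {s : ℝ} (hs : 0 < s) : matchMh (m + 1) A s =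
    s * besselC (m + 1) (s + A) * besselDh m s - besselC m (s + A) * besselDh (m + 1) s := by
  have h1 := besselC_recurrence m (s + A)
  have h2 := besselD_recurrence m hs
  rw [matchMh, matchM, besselDh, besselDh, show m + 1 + 1 = m + 2 by ring]
  linear_combination (s ^ (m + 1) * besselD (m + 1) s) * h1 -
    (s ^ (m + 1) * besselC (m + 1) (s + A)) * h2

lemma matchN_succ (m : ℕ) (A s : ℝ) : matchN (m + 1) A s =
    besselC (m + 1) (s + A) * besselC m s - besselC m (s + A) * besselC (m + 1) s := by
  have h1 := besselC_recurrence m (s + A)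
  have h2 := besselC_recurrence m s
  rw [matchN, show m + 1 + 1 = m + 2 by ring]
  linear_combination besselC (m + 1) s * h1 - besselC (m + 1) (s + A) * h2

/-- The scaled matching determinant `π s ^ n N_n`. -/
def matchNh (n : ℕ) (A s : ℝ) : ℝ := π * s ^ n * matchN n A s

lemma phaseDensity_zero_eq (A s : ℝ) : phaseDensity 0 A s =
    -(A * (s + A) * besselC 1 (s + A) ^ 2) / (matchMh 0 A s ^ 2 + matchNh 0 A s ^ 2) / s := by
  rw [phaseDensity, matchMh, matchNh, div_div]
  congr 1
  · push_cast
    ring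
  · ring

/-- After scaling the determinants by s^{m+1}, the power s^m moves to the numerator. This power is
why high modes are negligible at low energy. -/
lemma phaseDensity_succ_eq (m : ℕ) (A : ℝ) {s : ℝ} (hs : 0 < s) : phaseDensity (m + 1) A s =
    A * besselC m (s + A) * besselC (m + 2) (s + A) * s ^ m /
      (matchMh (m + 1) A s ^ 2 + matchNh (m + 1) A s ^ 2) := by
  have h1 := besselC_recurrence m (s + A)
  have h2 : ((m + 1 : ℕ) : ℝ) * besselC (m + 1) (s + A) -
      (s + A) * besselC (m + 1 + 1) (s + A) = besselC m (s + A) := by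
    push_cast
    linear_combination -h1
  have hs' := hs.ne'
  rw [phaseDensity, h2, matchMh, matchNh, show (s ^ (m + 1) * matchM (m + 1) A s) ^ 2 +
    (π * s ^ (m + 1) * matchN (m + 1) A s) ^ 2 =
    s ^ m * (s ^ (m + 1 + 1) * (matchM (m + 1) A s ^ 2 + (π * matchN (m + 1) A s) ^ 2)) by ring,
    mul_comm _ (s ^ m), mul_div_mul_left _ _ (pow_ne_zero m hs'), show m + 1 + 1 = m + 2 by ring]
  congr 1
  ring

lemma abs_besselC_add_sub_le (n : ℕ) {A s : ℝ} (hA : 0 < A) (hs : s ∈ Icc (0 : ℝ) 1) :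
    |besselC n (s + A) - besselC n A| ≤ Real.exp (1 + A) * s := by
  have h := norm_le_of_deriv_bound (T := 0) (R := 1) (C := Real.exp (1 + A))
    (f := fun s => besselC n (s + A) - besselC n A) (f' := fun s => -besselC (n + 1) (s + A))
    (fun t _ => (hasDerivAt_comp_add_const' (hasDerivAt_besselC n (t + A))).sub_const _)
    (by simp) (fun t ht => ?_) hs
  · simpa using h
  · rw [norm_neg, Real.norm_eq_abs]
    refine (abs_besselC_le _ _).trans ?_
    have h1 : (1 : ℝ) ≤ ((n + 1)! : ℝ) := by exact_mod_cast Nat.factorial_pos _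
    have h2 : |t + A| ≤ 1 + A := by
      rw [abs_of_nonneg (by linarith [ht.1])]
      linarith [ht.2]
    calc _ ≤ 1 * Real.exp (1 + A) := by
          gcongr
          exact div_le_one_of_le₀ h1 (by positivity)
      _ = _ := one_mul _

lemma abs_besselC_taylor_le (n : ℕ) {A s : ℝ} (hA : 0 < A) (hs : s ∈ Icc (0 : ℝ) 1) :
    |besselC n (s + A) - besselC n A + s * besselC (n + 1) A| ≤ Real.exp (1 + A) * s * s := by
  have h := norm_le_of_deriv_bound (T := 0) (R := s) (C := Real.exp (1 + A) * s)
    (f := fun s => besselC n (s + A) - besselC n A + s * besselC (n + 1) A)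
    (f' := fun s => -besselC (n + 1) (s + A) + 1 * besselC (n + 1) A)
    (fun t _ => ((hasDerivAt_comp_add_const' (hasDerivAt_besselC n (t + A))).sub_const _).add
      ((hasDerivAt_id t).mul_const _))
    (by simp) (fun t ht => ?_) ⟨hs.1, le_rfl⟩
  · simpa using h
  · rw [one_mul, neg_add_eq_sub, Real.norm_eq_abs, abs_sub_comm]
    refine (abs_besselC_add_sub_le (n + 1) hA ⟨ht.1, ht.2.trans hs.2⟩).trans ?_
    have := ht.2
    gcongr

lemma eventually_mem_Icc_zero_one : ∀ᶠ s : ℝ in 𝓝[>] 0, s ∈ Icc (0 : ℝ) 1 := by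
  filter_upwards [Ioo_mem_nhdsGT (show (0 : ℝ) < 1 by norm_num)] with s hs using ⟨hs.1.le, hs.2.le⟩

lemma eventually_pos : ∀ᶠ s : ℝ in 𝓝[>] 0, 0 < s := self_mem_nhdsWithin

lemma isBigO_besselC_add (n : ℕ) {A : ℝ} (hA : 0 < A) :
    (fun s => besselC n (s + A) - besselC n A) =O[𝓝[>] 0] fun s : ℝ => s := by
  refine .of_bound (Real.exp (1 + A)) ?_
  filter_upwards [eventually_mem_Icc_zero_one] with s hs
  rw [Real.norm_eq_abs, Real.norm_eq_abs, abs_of_nonneg hs.1]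
  exact abs_besselC_add_sub_le n hA hs

lemma isBigO_besselC_taylor (n : ℕ) {A : ℝ} (hA : 0 < A) :
    (fun s => besselC n (s + A) - besselC n A + s * besselC (n + 1) A) =O[𝓝[>] 0]
      fun s : ℝ => s * s := by
  refine .of_bound (Real.exp (1 + A)) ?_
  filter_upwards [eventually_mem_Icc_zero_one] with s hs
  rw [Real.norm_eq_abs, Real.norm_eq_abs, abs_of_nonneg (mul_nonneg hs.1 hs.1), ← mul_assoc]
  exact abs_besselC_taylor_le n hA hs

lemma isBigO_one_of_continuous {f : ℝ → ℝ} (hf : Continuous f) :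
    f =O[𝓝[>] 0] fun _ : ℝ => (1 : ℝ) :=
  ((hf.tendsto 0).mono_left nhdsWithin_le_nhds).isBigO_one ℝ

lemma isBigO_besselC_one (n : ℕ) (A : ℝ) :
    (fun s => besselC n (s + A)) =O[𝓝[>] 0] fun _ : ℝ => (1 : ℝ) :=
  isBigO_one_of_continuous ((continuous_besselC n).comp (continuous_id.add continuous_const))

lemma tendsto_log_atBot : Tendsto Real.log (𝓝[>] 0) atBot := Real.tendsto_log_nhdsGT_zero

lemma isBigO_one_log : (fun _ : ℝ => (1 : ℝ)) =O[𝓝[>] 0] Real.log := by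
  refine .of_bound 1 ?_
  filter_upwards [tendsto_log_atBot.eventually (eventually_le_atBot (-1))] with s hs
  rw [norm_one, one_mul, Real.norm_eq_abs]
  exact le_abs.2 (Or.inr (by linarith))

lemma isBigO_self_mul_log : (fun s : ℝ => s) =O[𝓝[>] 0] fun s : ℝ => s * Real.log s := by
  simpa using (isBigO_refl (fun s : ℝ => s) (𝓝[>] 0)).mul isBigO_one_log

lemma isBigO_self_one : (fun s : ℝ => s) =O[𝓝[>] 0] fun _ : ℝ => (1 : ℝ) :=
  isBigO_one_of_continuous continuous_id

lemma isBigO_altExp_sub {b : ℕ → ℝ} {B : ℝ} (hb : ∀ k, |b k| ≤ B) :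
    (fun s => altExp b s - altExp b 0) =O[𝓝[>] 0] fun s : ℝ => s := by
  have h := (hasDerivAt_altExp hb 0).isBigO_sub
  simpa using h.mono nhdsWithin_le_nhds

lemma isBigO_besselDh_zero :
    (fun s => besselDh 0 s - (Real.log s + 2 * Real.eulerMascheroniConstant)) =O[𝓝[>] 0]
      fun s : ℝ => s * Real.log s := by
  have h1 : (fun s => besselC 0 s - 1) =O[𝓝[>] 0] fun s : ℝ => s := by
    have : (fun s => besselC 0 s - besselC 0 0) =O[𝓝[>] 0] fun s : ℝ => s :=
      isBigO_altExp_sub (abs_coeffC_le 0)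
    simpa [besselC_zero_right] using this
  have h2 : (fun s => besselE 0 s - besselE 0 0) =O[𝓝[>] 0] fun s : ℝ => s :=
    isBigO_altExp_sub (abs_coeffE_le 0)
  refine ((h1.mul (isBigO_refl Real.log _)).sub (h2.trans isBigO_self_mul_log)).congr'
    ?_ EventuallyEq.rfl
  filter_upwards [eventually_pos] with s hs
  rw [besselDh_eq 0 hs, besselE_zero_zero]
  simp
  ring

lemma isBigO_pow_succ (m : ℕ) : (fun s : ℝ => s ^ (m + 1)) =O[𝓝[>] 0] fun s : ℝ => s := by
  simpa [pow_succ] using (isBigO_one_of_continuous (continuous_pow m)).mul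
    (isBigO_refl (fun s : ℝ => s) _)

lemma isBigO_besselDh_succ (m : ℕ) :
    (fun s => besselDh (m + 1) s - (-(m ! : ℝ))) =O[𝓝[>] 0] fun s : ℝ => s * Real.log s := by
  have h1 : (fun s => s ^ (m + 1) * (Real.log s * besselC (m + 1) s - besselE (m + 1) s)) =O[𝓝[>] 0]
      fun s : ℝ => s * Real.log s := by
    refine (isBigO_pow_succ m).mul (IsBigO.sub ?_ ?_)
    · simpa using (isBigO_refl Real.log (𝓝[>] 0)).mul
        (isBigO_one_of_continuous (continuous_besselC (m + 1)))
    · exact (isBigO_one_of_continuous (continuous_besselE (m + 1))).trans isBigO_one_log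
  have h2 : (fun s : ℝ => ∑ k ∈ Finset.range m, ((m + 1 - (k + 1) - 1)! : ℝ) / ((k + 1)! : ℝ) *
      s ^ (k + 1)) =O[𝓝[>] 0] fun s : ℝ => s :=
    IsBigO.fun_sum fun k _ => (isBigO_pow_succ k).const_mul_left _
  refine (h1.sub (h2.trans isBigO_self_mul_log)).congr' ?_ EventuallyEq.rfl
  filter_upwards [eventually_pos] with s hs
  rw [besselDh_eq _ hs, Finset.sum_range_succ']
  simp
  ring

lemma isBigO_besselDh_zero_log : besselDh 0 =O[𝓝[>] 0] Real.log := by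
  have h : (fun s : ℝ => s * Real.log s) =O[𝓝[>] 0] Real.log := by
    simpa using isBigO_self_one.mul (isBigO_refl Real.log (𝓝[>] 0))
  have := (isBigO_besselDh_zero.trans h).add ((isBigO_refl Real.log (𝓝[>] 0)).add
    ((isBigO_one_log.const_mul_left (2 * Real.eulerMascheroniConstant))))
  refine this.congr_left fun s => ?_
  ring

lemma isBigO_mul_log_one : (fun s : ℝ => s * Real.log s) =O[𝓝[>] 0] fun _ : ℝ => (1 : ℝ) :=
  tendsto_mul_log_zero.isBigO_one ℝ

lemma isBigO_besselDh_succ_one (m : ℕ) : besselDh (m + 1) =O[𝓝[>] 0] fun _ : ℝ => (1 : ℝ) := by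
  have := ((isBigO_besselDh_succ m).trans isBigO_mul_log_one).add
    (isBigO_const_const (-(m ! : ℝ)) one_ne_zero (𝓝[>] (0 : ℝ)))
  simpa using this

lemma isBigO_besselDh_log (m : ℕ) : besselDh m =O[𝓝[>] 0] Real.log := by
  rcases m with _ | m
  · exact isBigO_besselDh_zero_log
  · exact (isBigO_besselDh_succ_one m).trans isBigO_one_log

/-! ### Behaviour of the phase densities at `s = 0` -/

lemma eventually_ne_of_isEquivalent {l : Filter ℝ} {Q Q₀ : ℝ → ℝ} (h : IsEquivalent l Q Q₀)
    (h0 : ∀ᶠ s in l, Q₀ s ≠ 0) : ∀ᶠ s in l, Q s ≠ 0 := by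
  have h' : (Q - Q₀) =o[l] Q₀ := h
  filter_upwards [h'.def (show (0 : ℝ) < 1 / 2 by norm_num), h0] with s hs hs0 hQ
  have : 0 < ‖Q₀ s‖ := norm_pos_iff.2 hs0
  simp only [Pi.sub_apply, hQ, zero_sub, norm_neg] at hs
  linarith

/-- The hypothesis on Q is a relative error e → 0, which makes Q and Q₀ equivalent; the quotient
then inherits the error e measured against 1/Q₀. -/
lemma isBigO_div_sub_div {l : Filter ℝ} {P P₀ Q Q₀ e : ℝ → ℝ}
    (hP : (fun s => P s - P₀ s) =O[l] e) (hP₀ : P₀ =O[l] fun _ => (1 : ℝ))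
    (hQ : (fun s => Q s - Q₀ s) =O[l] fun s => e s * Q₀ s) (he : Tendsto e l (𝓝 0))
    (hQ₀ : ∀ᶠ s in l, Q₀ s ≠ 0) :
    (fun s => P s / Q s - P₀ s / Q₀ s) =O[l] fun s => e s / Q₀ s := by
  have hequiv : IsEquivalent l Q Q₀ := by
    have h1 : (fun s => e s * Q₀ s) =o[l] Q₀ := by
      simpa using ((isLittleO_one_iff ℝ).2 he).mul_isBigO (isBigO_refl Q₀ l)
    exact hQ.trans_isLittleO h1
  have hinv : (fun s => (Q s)⁻¹) =O[l] fun s => (Q₀ s)⁻¹ := hequiv.inv.isBigO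
  have h1 : (fun s => (P s - P₀ s) * (Q s)⁻¹) =O[l] fun s => e s / Q₀ s := by
    simpa only [div_eq_mul_inv] using hP.mul hinv
  have h2 : (fun s => P₀ s * (Q s - Q₀ s) * (Q s)⁻¹ * (Q₀ s)⁻¹) =O[l] fun s => e s / Q₀ s := by
    refine (((hP₀.mul hQ).mul hinv).mul (isBigO_refl (fun s => (Q₀ s)⁻¹) l)).congr'
      EventuallyEq.rfl ?_
    filter_upwards [hQ₀] with s hs
    field_simp
  refine (h1.sub h2).congr' ?_ EventuallyEq.rfl
  filter_upwards [hQ₀, eventually_ne_of_isEquivalent hequiv hQ₀] with s hs hs'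
  field_simp
  ring

lemma isBigO_sq_sub_sq {l : Filter ℝ} {M M₀ e g : ℝ → ℝ}
    (hM : (fun s => M s - M₀ s) =O[l] fun s => e s * g s) (hM₀ : M₀ =O[l] g)
    (he : e =O[l] fun _ => (1 : ℝ)) :
    (fun s => M s ^ 2 - M₀ s ^ 2) =O[l] fun s => e s * (g s * g s) := by
  have h1 : (fun s => e s * g s) =O[l] g := by simpa using he.mul (isBigO_refl g l)
  refine (hM.mul ((hM.trans h1).add (hM₀.const_mul_left 2))).congr (fun s => ?_) fun s => ?_
  · ring
  · ring

/-- Comparison of the quotients `P / (M² + N²)` in the bounded case. -/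
lemma isBigO_div_sq_const {P M N : ℝ → ℝ} {p m : ℝ} (hm : m ≠ 0)
    (hP : (fun s => P s - p) =O[𝓝[>] 0] fun s : ℝ => s * Real.log s)
    (hM : (fun s => M s - m) =O[𝓝[>] 0] fun s : ℝ => s * Real.log s)
    (hN : N =O[𝓝[>] 0] fun s : ℝ => s) :
    (fun s => P s / (M s ^ 2 + N s ^ 2) - p / m ^ 2) =O[𝓝[>] 0] fun s : ℝ => s * Real.log s := by
  have hM2 := isBigO_sq_sub_sq (g := fun _ => (1 : ℝ)) (M₀ := fun _ => m)
    (by simpa using hM) (isBigO_const_const m one_ne_zero _) isBigO_mul_log_one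
  have hN2 := isBigO_sq_sub_sq (g := fun _ => (1 : ℝ)) (M₀ := fun _ => 0) (M := N)
    (e := fun s => s * Real.log s)
    (by simpa using hN.trans isBigO_self_mul_log) (isBigO_zero _ _) isBigO_mul_log_one
  have hQ : (fun s => (M s ^ 2 + N s ^ 2) - m ^ 2) =O[𝓝[>] 0]
      fun s : ℝ => s * Real.log s * m ^ 2 := by
    have h := hM2.add hN2
    simp only [mul_one] at h
    have h' : (fun s : ℝ => s * Real.log s) =O[𝓝[>] 0] fun s : ℝ => s * Real.log s * m ^ 2 :=
      (isBigO_const_mul_self (m ^ 2)⁻¹ (fun s : ℝ => s * Real.log s * m ^ 2) _).congr_left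
        fun s => by field_simp
    exact (h.trans h').congr_left fun s => by ring
  have h := isBigO_div_sub_div (Q₀ := fun _ => m ^ 2) (P₀ := fun _ => p) hP
    (isBigO_const_const p one_ne_zero _) hQ tendsto_mul_log_zero
    (Eventually.of_forall fun _ => pow_ne_zero 2 hm)
  refine h.trans ?_
  simpa [div_eq_inv_mul] using isBigO_const_mul_self (m ^ 2)⁻¹ (fun s : ℝ => s * Real.log s) (𝓝[>] 0)

lemma isBigO_log_add_const (k : ℝ) : Real.log =O[𝓝[>] 0] fun s => Real.log s + k := by
  have h : (fun _ : ℝ => k) =o[𝓝[>] 0] Real.log :=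
    isLittleO_const_left.2 (Or.inr (tendsto_abs_atBot_atTop.comp tendsto_log_atBot))
  exact h.right_isBigO_add'

/-- Comparison of the quotients `P / (M² + N²)` when `M` has a logarithmic singularity. -/
lemma isBigO_div_sq_log {P M N : ℝ → ℝ} {p c k : ℝ} (hc : c ≠ 0)
    (hP : (fun s => P s - p) =O[𝓝[>] 0] fun s : ℝ => s)
    (hM : (fun s => M s - c * (Real.log s + k)) =O[𝓝[>] 0] fun s : ℝ => s * Real.log s)
    (hN : (fun s => N s - π * c) =O[𝓝[>] 0] fun s : ℝ => s) :
    (fun s => P s / (M s ^ 2 + N s ^ 2) - (p / c ^ 2) / ((Real.log s + k) ^ 2 + π ^ 2)) =O[𝓝[>] 0]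
      fun s : ℝ => s / Real.log s ^ 2 := by
  have hlogk : (fun s => Real.log s + k) =O[𝓝[>] 0] Real.log :=
    (isBigO_refl _ _).add ((isBigO_one_log.const_mul_left k).congr_left fun s => mul_one k)
  have hM2 := isBigO_sq_sub_sq (M₀ := fun s => c * (Real.log s + k)) (g := Real.log)
    (e := fun s => s) hM (hlogk.const_mul_left c) isBigO_self_one
  have hN2 := isBigO_sq_sub_sq (M₀ := fun _ => π * c) (g := Real.log) (e := fun s => s)
    (hN.trans isBigO_self_mul_log)
    ((isBigO_one_log.const_mul_left (π * c)).congr_left fun s => mul_one _) isBigO_self_one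
  -- The model denominator is of order log² s, so an error of size s log² s is a relative error s.
  -- This is the source of the gain s/log² s.
  set Q₀ : ℝ → ℝ := fun s => (c * (Real.log s + k)) ^ 2 + (π * c) ^ 2
  have hQ₀pos : ∀ s, 0 < Q₀ s := fun s => by
    have : π * c ≠ 0 := mul_ne_zero Real.pi_ne_zero hc
    positivity
  have hlogQ : (fun s => Real.log s * Real.log s) =O[𝓝[>] 0] Q₀ := by
    have h1 : Real.log =O[𝓝[>] 0] fun s => c * (Real.log s + k) :=
      (isBigO_log_add_const k).trans (isBigO_self_const_mul hc _ _)
    refine (h1.mul h1).trans (.of_bound 1 (Eventually.of_forall fun s => ?_))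
    rw [one_mul, Real.norm_eq_abs, Real.norm_eq_abs, abs_of_pos (hQ₀pos s), abs_mul_self]
    simp only [Q₀]
    nlinarith [sq_nonneg (π * c)]
  have hQ : (fun s => (M s ^ 2 + N s ^ 2) - Q₀ s) =O[𝓝[>] 0] fun s : ℝ => s * Q₀ s := by
    refine ((hM2.add hN2).trans ((isBigO_refl (fun s : ℝ => s) _).mul hlogQ)).congr_left
      fun s => ?_
    simp only [Q₀]
    ring
  have h := isBigO_div_sub_div (Q₀ := Q₀) (P₀ := fun _ => p) hP
    (isBigO_const_const p one_ne_zero _) hQ (tendsto_id.mono_left nhdsWithin_le_nhds)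
    (Eventually.of_forall fun s => (hQ₀pos s).ne')
  have hinv : (fun s => (Q₀ s)⁻¹) =O[𝓝[>] 0] fun s => (Real.log s * Real.log s)⁻¹ := by
    refine hlogQ.inv_rev ?_
    filter_upwards [tendsto_log_atBot.eventually (eventually_lt_atBot 0)] with s hs h0
    exact absurd h0 (mul_ne_zero hs.ne hs.ne)
  refine (h.trans (((isBigO_refl (fun s : ℝ => s) _).mul hinv).congr (fun s => ?_) fun s => ?_)
    ).congr_left fun s => ?_
  · rw [div_eq_mul_inv]
  · rw [div_eq_mul_inv, sq]
  · simp only [Q₀]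
    have : (c * (Real.log s + k)) ^ 2 + (π * c) ^ 2 = c ^ 2 * ((Real.log s + k) ^ 2 + π ^ 2) := by
      ring
    rw [this, div_div]

/-! ### Leading terms of the scaled determinants -/

lemma isBigO_add_mul_besselC (n : ℕ) {A : ℝ} (hA : 0 < A) :
    (fun s => (s + A) * besselC n (s + A) - A * besselC n A) =O[𝓝[>] 0] fun s : ℝ => s := by
  have h1 := (isBigO_besselC_add n hA).const_mul_left A
  have h2 : (fun s => s * besselC n (s + A)) =O[𝓝[>] 0] fun s : ℝ => s := by
    simpa using (isBigO_refl (fun s : ℝ => s) (𝓝[>] 0)).mul (isBigO_besselC_one n A)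
  refine (h1.add h2).congr_left fun s => ?_
  ring

lemma isBigO_matchMh_zero {A : ℝ} (hA : 0 < A) :
    (fun s => matchMh 0 A s - (A * besselC 1 A * (Real.log s + 2 * Real.eulerMascheroniConstant) +
      besselC 0 A)) =O[𝓝[>] 0] fun s : ℝ => s * Real.log s := by
  have h1 := (isBigO_add_mul_besselC 1 hA).mul isBigO_besselDh_zero_log
  have h2 := isBigO_besselDh_zero.const_mul_left (A * besselC 1 A)
  have h3 : (fun s => (besselC 0 (s + A) - besselC 0 A) * besselDh 1 s) =O[𝓝[>] 0]
      fun s : ℝ => s := by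
    simpa using (isBigO_besselC_add 0 hA).mul (isBigO_besselDh_succ_one 0)
  have h4 := (isBigO_besselDh_succ 0).const_mul_left (besselC 0 A)
  refine (((h1.add h2).sub (h3.trans isBigO_self_mul_log)).sub h4).congr_left fun s => ?_
  rw [matchMh_eq]
  simp
  ring

lemma isBigO_matchNh_zero {A : ℝ} (hA : 0 < A) :
    (fun s => matchNh 0 A s - π * (A * besselC 1 A)) =O[𝓝[>] 0] fun s : ℝ => s := by
  have hc : (fun s => besselC 0 s - 1) =O[𝓝[>] 0] fun s : ℝ => s := by
    have : (fun s => besselC 0 s - besselC 0 0) =O[𝓝[>] 0] fun s : ℝ => s :=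
      isBigO_altExp_sub (abs_coeffC_le 0)
    simpa [besselC_zero_right] using this
  have h1 : (fun s => ((s + A) * besselC 1 (s + A) - A * besselC 1 A) * besselC 0 s) =O[𝓝[>] 0]
      fun s : ℝ => s := by
    simpa using (isBigO_add_mul_besselC 1 hA).mul
      (isBigO_one_of_continuous (continuous_besselC 0))
  have h2 := hc.const_mul_left (A * besselC 1 A)
  have h3 : (fun s => s * (besselC 1 s * besselC 0 (s + A))) =O[𝓝[>] 0] fun s : ℝ => s := by
    simpa using (isBigO_refl (fun s : ℝ => s) (𝓝[>] 0)).mul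
      ((isBigO_one_of_continuous (continuous_besselC 1)).mul (isBigO_besselC_one 0 A))
  refine (((h1.add h2).sub h3).const_mul_left π).congr_left fun s => ?_
  rw [matchNh, matchN]
  simp
  ring

lemma isBigO_matchMh_succ (m : ℕ) {A : ℝ} (hA : 0 < A) :
    (fun s => matchMh (m + 1) A s - m ! * besselC m A) =O[𝓝[>] 0]
      fun s : ℝ => s * Real.log s := by
  have h1 : (fun s => s * besselC (m + 1) (s + A) * besselDh m s) =O[𝓝[>] 0]
      fun s : ℝ => s * Real.log s := by
    simpa using ((isBigO_refl (fun s : ℝ => s) (𝓝[>] 0)).mul (isBigO_besselC_one (m + 1) A)).mul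
      (isBigO_besselDh_log m)
  have h3 : (fun s => (besselC m (s + A) - besselC m A) * besselDh (m + 1) s) =O[𝓝[>] 0]
      fun s : ℝ => s := by
    simpa using (isBigO_besselC_add m hA).mul (isBigO_besselDh_succ_one m)
  have h4 := (isBigO_besselDh_succ m).const_mul_left (besselC m A)
  refine ((h1.sub (h3.trans isBigO_self_mul_log)).sub h4).congr' ?_ EventuallyEq.rfl
  filter_upwards [eventually_pos] with s hs
  rw [matchMh_succ m A hs]
  ring

lemma isBigO_matchNh_succ (m : ℕ) (A : ℝ) :
    matchNh (m + 1) A =O[𝓝[>] 0] fun s : ℝ => s ^ (m + 1) := by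
  have h : (fun s => matchN (m + 1) A s) =O[𝓝[>] 0] fun _ : ℝ => (1 : ℝ) := by
    refine isBigO_one_of_continuous (continuous_iff_continuousAt.2 fun s =>
      (hasDerivAt_matchN (m + 1) A s).continuousAt)
  have h' := ((isBigO_refl (fun s : ℝ => s ^ (m + 1)) (𝓝[>] 0)).const_mul_left π).mul h
  simp only [mul_one] at h'
  exact h'

lemma isBigO_div_self {f g : ℝ → ℝ} (h : f =O[𝓝[>] 0] fun s : ℝ => s * g s) :
    (fun s => f s / s) =O[𝓝[>] 0] g := by
  refine ((h.mul (isBigO_refl (fun s : ℝ => s⁻¹) (𝓝[>] 0))).congr'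
    (Eventually.of_forall fun s => (div_eq_mul_inv _ _).symm) ?_)
  filter_upwards [eventually_pos] with s hs
  field_simp

lemma isBigO_besselC_div (m : ℕ) {A : ℝ} (hA : 0 < A) (h0 : besselC m A = 0) :
    (fun s => besselC m (s + A) / s - -besselC (m + 1) A) =O[𝓝[>] 0] fun s : ℝ => s := by
  refine (isBigO_div_self (isBigO_besselC_taylor m hA)).congr' ?_ EventuallyEq.rfl
  filter_upwards [eventually_pos] with s hs
  rw [h0]
  field_simp
  ring

/-- When the dominant coefficient vanishes at s = 0, one power of s factors out. The two surviving
terms are C_{m+1}(A) s^m D_m and, since C_m' = -C_{m+1}, a contribution -m! C_{m+1}(A). -/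
lemma isBigO_matchMh_div (m : ℕ) {A : ℝ} (hA : 0 < A) (h0 : besselC m A = 0) :
    (fun s => matchMh (m + 1) A s / s - besselC (m + 1) A * (besselDh m s - m !)) =O[𝓝[>] 0]
      fun s : ℝ => s * Real.log s := by
  have h1 := (isBigO_besselC_add (m + 1) hA).mul (isBigO_besselDh_log m)
  have h3 : (fun s => (besselC m (s + A) / s - -besselC (m + 1) A) * besselDh (m + 1) s) =O[𝓝[>] 0]
      fun s : ℝ => s := by
    simpa using (isBigO_besselC_div m hA h0).mul (isBigO_besselDh_succ_one m)
  have h4 := (isBigO_besselDh_succ m).const_mul_left (besselC (m + 1) A)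
  refine ((h1.sub (h3.trans isBigO_self_mul_log)).add h4).congr' ?_ EventuallyEq.rfl
  filter_upwards [eventually_pos] with s hs
  rw [matchMh_succ m A hs]
  field_simp
  ring

/-- Here the factor D_0 is logarithmic, so mode 1 acquires the same type of singularity as mode 0.
The extra -1 becomes the shift -1/2 in the p-resonance formula, because log s = 2 log(λρ/2). -/
lemma isBigO_matchMh_one_div {A : ℝ} (hA : 0 < A) (h0 : besselC 0 A = 0) :
    (fun s => matchMh 1 A s / s - besselC 1 A *
      (Real.log s + (2 * Real.eulerMascheroniConstant - 1))) =O[𝓝[>] 0]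
      fun s : ℝ => s * Real.log s := by
  refine ((isBigO_matchMh_div 0 hA h0).add
    (isBigO_besselDh_zero.const_mul_left (besselC 1 A))).congr_left fun s => ?_
  simp
  ring

lemma isBigO_matchMh_succ_succ_div (m : ℕ) {A : ℝ} (hA : 0 < A) (h0 : besselC (m + 1) A = 0) :
    (fun s => matchMh (m + 2) A s / s - -(besselC (m + 2) A * (m ! + (m + 1)!))) =O[𝓝[>] 0]
      fun s : ℝ => s * Real.log s := by
  refine ((isBigO_matchMh_div (m + 1) hA h0).add
    ((isBigO_besselDh_succ m).const_mul_left (besselC (m + 2) A))).congr_left fun s => ?_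
  ring

lemma isBigO_matchNh_one_div {A : ℝ} (hA : 0 < A) (h0 : besselC 0 A = 0) :
    (fun s => matchNh 1 A s / s - π * besselC 1 A) =O[𝓝[>] 0] fun s : ℝ => s := by
  have hc : (fun s => besselC 0 s - 1) =O[𝓝[>] 0] fun s : ℝ => s := by
    have : (fun s => besselC 0 s - besselC 0 0) =O[𝓝[>] 0] fun s : ℝ => s :=
      isBigO_altExp_sub (abs_coeffC_le 0)
    simpa [besselC_zero_right] using this
  have h1 : (fun s => (besselC 1 (s + A) - besselC 1 A) * besselC 0 s) =O[𝓝[>] 0]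
      fun s : ℝ => s := by
    simpa using (isBigO_besselC_add 1 hA).mul (isBigO_one_of_continuous (continuous_besselC 0))
  have h2 := hc.const_mul_left (besselC 1 A)
  have h3 : (fun s => (besselC 0 (s + A) - besselC 0 A) * besselC 1 s) =O[𝓝[>] 0]
      fun s : ℝ => s := by
    simpa using (isBigO_besselC_add 0 hA).mul (isBigO_one_of_continuous (continuous_besselC 1))
  refine (((h1.add h2).sub h3).const_mul_left π).congr' ?_ EventuallyEq.rfl
  filter_upwards [eventually_pos] with s hs
  rw [matchNh, matchN_succ, h0]
  field_simp
  ring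

lemma isBigO_matchNh_succ_succ_div (m : ℕ) (A : ℝ) :
    (fun s => matchNh (m + 2) A s / s) =O[𝓝[>] 0] fun s : ℝ => s := by
  refine (isBigO_div_self (g := fun s => s ^ (m + 1)) ?_).trans (isBigO_pow_succ m)
  exact (isBigO_matchNh_succ (m + 1) A).congr_right fun s => by ring

/-! ### Low-energy behaviour of the density in each mode -/

lemma isBigO_phaseDensity_zero {A : ℝ} (hA : 0 < A) (h1 : besselC 1 A ≠ 0) :
    (fun s => s * phaseDensity 0 A s - (-1) / ((Real.log s + (2 * Real.eulerMascheroniConstant +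
      besselC 0 A / (A * besselC 1 A))) ^ 2 + π ^ 2)) =O[𝓝[>] 0] fun s : ℝ => s / Real.log s ^ 2 := by
  have hc : A * besselC 1 A ≠ 0 := mul_ne_zero hA.ne' h1
  have hP : (fun s => -(A * (s + A) * besselC 1 (s + A) ^ 2) - -(A * besselC 1 A) ^ 2) =O[𝓝[>] 0]
      fun s : ℝ => s := by
    have e1 : (fun s => ((s + A) * besselC 1 (s + A) - A * besselC 1 A) * besselC 1 (s + A))
        =O[𝓝[>] 0] fun s : ℝ => s := by
      simpa using (isBigO_add_mul_besselC 1 hA).mul (isBigO_besselC_one 1 A)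
    have e2 := (isBigO_besselC_add 1 hA).const_mul_left (A * besselC 1 A)
    refine ((e1.add e2).const_mul_left (-A)).congr_left fun s => ?_
    ring
  have hM : (fun s => matchMh 0 A s - A * besselC 1 A * (Real.log s +
      (2 * Real.eulerMascheroniConstant + besselC 0 A / (A * besselC 1 A)))) =O[𝓝[>] 0]
      fun s : ℝ => s * Real.log s := by
    refine (isBigO_matchMh_zero hA).congr_left fun s => ?_
    field_simp
    ring
  refine (isBigO_div_sq_log hc hP hM (isBigO_matchNh_zero hA)).congr' ?_ EventuallyEq.rfl
  filter_upwards [eventually_pos] with s hs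
  rw [phaseDensity_zero_eq, neg_div _ ((A * besselC 1 A) ^ 2), div_self (pow_ne_zero 2 hc)]
  field_simp

lemma isBigO_phaseDensity_zero_of_eq_zero {A : ℝ} (hA : 0 < A) (h1 : besselC 1 A = 0) :
    phaseDensity 0 A =O[𝓝[>] 0] fun s : ℝ => s * Real.log s := by
  have h0 : besselC 0 A ≠ 0 := (besselC_ne_zero_or 0 hA).resolve_right fun h => h h1
  have hP : (fun s => -(A * (besselC 1 (s + A) / s) * ((s + A) * besselC 1 (s + A))) - 0) =O[𝓝[>] 0]
      fun s : ℝ => s * Real.log s := by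
    have e1 : (fun s => besselC 1 (s + A) / s) =O[𝓝[>] 0] fun _ : ℝ => (1 : ℝ) := by
      refine isBigO_div_self ((isBigO_besselC_add 1 hA).congr (fun s => ?_) fun s => ?_)
      · rw [h1, sub_zero]
      · rw [mul_one]
    have e2 := isBigO_add_mul_besselC 1 hA
    simp only [h1, mul_zero, sub_zero] at e2
    have e3 : (fun s => A * (besselC 1 (s + A) / s) * ((s + A) * besselC 1 (s + A))) =O[𝓝[>] 0]
        fun s : ℝ => s := by
      simpa using (e1.const_mul_left A).mul e2
    simpa using (e3.trans isBigO_self_mul_log).neg_left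
  have hM : (fun s => matchMh 0 A s - besselC 0 A) =O[𝓝[>] 0] fun s : ℝ => s * Real.log s := by
    simpa [h1] using isBigO_matchMh_zero hA
  have hN : matchNh 0 A =O[𝓝[>] 0] fun s : ℝ => s := by
    simpa [h1] using isBigO_matchNh_zero hA
  refine (isBigO_div_sq_const h0 hP hM hN).congr' ?_ EventuallyEq.rfl
  filter_upwards [eventually_pos] with s hs
  rw [phaseDensity_zero_eq, zero_div, sub_zero]
  field_simp

lemma isBigO_phaseDensity_one {A : ℝ} (hA : 0 < A) (h0 : besselC 0 A ≠ 0) :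
    (fun s => phaseDensity 1 A s - A * besselC 2 A / besselC 0 A) =O[𝓝[>] 0]
      fun s : ℝ => s * Real.log s := by
  have hP : (fun s => A * besselC 0 (s + A) * besselC 2 (s + A) * s ^ 0 -
      A * besselC 0 A * besselC 2 A) =O[𝓝[>] 0] fun s : ℝ => s * Real.log s := by
    have e1 : (fun s => (besselC 0 (s + A) - besselC 0 A) * besselC 2 (s + A)) =O[𝓝[>] 0]
        fun s : ℝ => s := by
      simpa using (isBigO_besselC_add 0 hA).mul (isBigO_besselC_one 2 A)
    have e2 := (isBigO_besselC_add 2 hA).const_mul_left (besselC 0 A)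
    refine (((e1.add e2).const_mul_left A).trans isBigO_self_mul_log).congr_left fun s => ?_
    ring
  have hM : (fun s => matchMh 1 A s - besselC 0 A) =O[𝓝[>] 0] fun s : ℝ => s * Real.log s := by
    simpa using isBigO_matchMh_succ 0 hA
  have hN : matchNh 1 A =O[𝓝[>] 0] fun s : ℝ => s := by
    simpa using isBigO_matchNh_succ 0 A
  refine (isBigO_div_sq_const h0 hP hM hN).congr' ?_ EventuallyEq.rfl
  filter_upwards [eventually_pos] with s hs
  rw [phaseDensity_succ_eq 0 A hs]
  congr 1
  field_simp

lemma isBigO_phaseDensity_one_of_eq_zero {A : ℝ} (hA : 0 < A) (h0 : besselC 0 A = 0) :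
    (fun s => s * phaseDensity 1 A s - (-1) / ((Real.log s +
      (2 * Real.eulerMascheroniConstant - 1)) ^ 2 + π ^ 2)) =O[𝓝[>] 0]
      fun s : ℝ => s / Real.log s ^ 2 := by
  have h1 : besselC 1 A ≠ 0 := (besselC_ne_zero_or 0 hA).resolve_left fun h => h h0
  -- At a zero of C_0 the recurrence reads A C_2(A) = C_1(A); this makes the limiting numerator
  -- -C_1(A)² and the coefficient exactly -1.
  have hrec := besselC_recurrence 0 A
  simp only [h0, zero_add, CharP.cast_eq_zero, one_mul, sub_zero] at hrec
  have hP : (fun s => A * (besselC 0 (s + A) / s) * besselC 2 (s + A) - -besselC 1 A ^ 2) =O[𝓝[>] 0]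
      fun s : ℝ => s := by
    have e1 : (fun s => (besselC 0 (s + A) / s - -besselC 1 A) * besselC 2 (s + A)) =O[𝓝[>] 0]
        fun s : ℝ => s := by
      simpa using (isBigO_besselC_div 0 hA h0).mul (isBigO_besselC_one 2 A)
    have e2 := (isBigO_besselC_add 2 hA).const_mul_left (-besselC 1 A)
    refine ((e1.add e2).const_mul_left A).congr_left fun s => ?_
    linear_combination besselC 1 A * hrec
  refine (isBigO_div_sq_log h1 hP (isBigO_matchMh_one_div hA h0)
    (isBigO_matchNh_one_div hA h0)).congr' ?_ EventuallyEq.rfl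
  filter_upwards [eventually_pos] with s hs
  rw [phaseDensity_succ_eq 0 A hs, neg_div _ (besselC 1 A ^ 2), div_self (pow_ne_zero 2 h1)]
  field_simp

lemma isBigO_phaseDensity_add_two (m : ℕ) {A : ℝ} (hA : 0 < A) (h0 : besselC (m + 1) A ≠ 0) :
    phaseDensity (m + 2) A =O[𝓝[>] 0] fun s : ℝ => s * Real.log s := by
  have hP : (fun s => A * besselC (m + 1) (s + A) * besselC (m + 3) (s + A) * s ^ (m + 1) - 0)
      =O[𝓝[>] 0] fun s : ℝ => s * Real.log s := by
    have e1 := (((isBigO_besselC_one (m + 1) A).const_mul_left A).mul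
      (isBigO_besselC_one (m + 3) A)).mul (isBigO_pow_succ m)
    simp only [one_mul] at e1
    simpa using e1.trans isBigO_self_mul_log
  have hm : ((m + 1)! : ℝ) * besselC (m + 1) A ≠ 0 := mul_ne_zero (by positivity) h0
  refine (isBigO_div_sq_const hm hP (isBigO_matchMh_succ (m + 1) hA)
    ((isBigO_matchNh_succ (m + 1) A).trans (isBigO_pow_succ (m + 1)))).congr' ?_ EventuallyEq.rfl
  filter_upwards [eventually_pos] with s hs
  rw [phaseDensity_succ_eq (m + 1) A hs, zero_div, sub_zero]

lemma phaseDensity_add_two_eq_div (m : ℕ) (A : ℝ) {s : ℝ} (hs : 0 < s) :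
    phaseDensity (m + 2) A s = A * (besselC (m + 1) (s + A) / s) * besselC (m + 3) (s + A) * s ^ m /
      ((matchMh (m + 2) A s / s) ^ 2 + (matchNh (m + 2) A s / s) ^ 2) := by
  rw [phaseDensity_succ_eq (m + 1) A hs]
  field_simp
  ring

lemma besselC_succ_ne_zero {m : ℕ} {A : ℝ} (hA : 0 < A) (h0 : besselC m A = 0) :
    besselC (m + 1) A ≠ 0 :=
  (besselC_ne_zero_or m hA).resolve_left fun h => h h0

/-- Numerator and denominator are divided by s². The quotient C_{m+2}(s+A)/s stays bounded and the
denominator has a nonzero limit, so the remaining s^{m+1} gives the decay. -/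
lemma isBigO_phaseDensity_add_three_of_eq_zero (m : ℕ) {A : ℝ} (hA : 0 < A)
    (h0 : besselC (m + 2) A = 0) :
    phaseDensity (m + 3) A =O[𝓝[>] 0] fun s : ℝ => s * Real.log s := by
  have hP : (fun s => A * (besselC (m + 2) (s + A) / s) * besselC (m + 4) (s + A) * s ^ (m + 1) - 0)
      =O[𝓝[>] 0] fun s : ℝ => s * Real.log s := by
    have e0 : (fun s => besselC (m + 2) (s + A) / s) =O[𝓝[>] 0] fun _ : ℝ => (1 : ℝ) := by
      refine isBigO_div_self ((isBigO_besselC_add (m + 2) hA).congr (fun s => ?_) fun s => ?_)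
      · rw [h0, sub_zero]
      · rw [mul_one]
    have e1 := ((e0.const_mul_left A).mul (isBigO_besselC_one (m + 4) A)).mul (isBigO_pow_succ m)
    simp only [one_mul] at e1
    simpa using e1.trans isBigO_self_mul_log
  have hm : -(besselC (m + 3) A * ((m + 1)! + (m + 2)! : ℝ)) ≠ 0 :=
    neg_ne_zero.2 (mul_ne_zero (besselC_succ_ne_zero hA h0) (by positivity))
  refine (isBigO_div_sq_const hm hP (isBigO_matchMh_succ_succ_div (m + 1) hA h0)
    (isBigO_matchNh_succ_succ_div (m + 1) A)).congr' ?_ EventuallyEq.rfl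
  filter_upwards [eventually_pos] with s hs
  rw [phaseDensity_add_two_eq_div (m + 1) A hs, zero_div, sub_zero]

lemma isBigO_phaseDensity_add_three (m : ℕ) {A : ℝ} (hA : 0 < A) :
    phaseDensity (m + 3) A =O[𝓝[>] 0] fun s : ℝ => s * Real.log s := by
  by_cases h0 : besselC (m + 2) A = 0
  · exact isBigO_phaseDensity_add_three_of_eq_zero m hA h0
  · exact isBigO_phaseDensity_add_two (m + 1) hA h0

/-- In this degenerate mode no power of s is left over. The recurrence gives A C_3(A) = 2 C_2(A), so
the limit is -2 C_2(A)²/(2 C_2(A))², whatever the value of A. -/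
lemma isBigO_phaseDensity_two_of_eq_zero {A : ℝ} (hA : 0 < A) (h0 : besselC 1 A = 0) :
    (fun s => phaseDensity 2 A s - -(1 / 2)) =O[𝓝[>] 0] fun s : ℝ => s * Real.log s := by
  have h2 := besselC_succ_ne_zero hA h0
  have hrec := besselC_recurrence 1 A
  rw [h0] at hrec
  norm_num at hrec h2
  have hP : (fun s => A * (besselC 1 (s + A) / s) * besselC 3 (s + A) * s ^ 0 -
      -(2 * besselC 2 A ^ 2)) =O[𝓝[>] 0] fun s : ℝ => s * Real.log s := by
    have e1 : (fun s => (besselC 1 (s + A) / s - -besselC 2 A) * besselC 3 (s + A)) =O[𝓝[>] 0]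
        fun s : ℝ => s := by
      simpa using (isBigO_besselC_div 1 hA h0).mul (isBigO_besselC_one 3 A)
    have e2 := (isBigO_besselC_add 3 hA).const_mul_left (-besselC 2 A)
    refine (((e1.add e2).const_mul_left A).trans isBigO_self_mul_log).congr_left fun s => ?_
    linear_combination besselC 2 A * hrec
  have hM : (fun s => matchMh 2 A s / s - -(2 * besselC 2 A)) =O[𝓝[>] 0]
      fun s : ℝ => s * Real.log s := by
    refine (isBigO_matchMh_succ_succ_div 0 hA h0).congr_left fun s => ?_
    norm_num
    ring
  refine (isBigO_div_sq_const (neg_ne_zero.2 (mul_ne_zero two_ne_zero h2)) hP hM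
    (isBigO_matchNh_succ_succ_div 0 A)).congr' ?_ EventuallyEq.rfl
  filter_upwards [eventually_pos] with s hs
  rw [phaseDensity_add_two_eq_div 0 A hs]
  congr 1
  field_simp

/-! ### The eigenvalues tend to `1` at zero energy -/

/-- The quotient is the Cayley transform of N/M, which tends to 0; the lower bound on M guarantees
that the division is legitimate near 0. -/
lemma tendsto_cayley {M N : ℝ → ℝ} (h1 : (fun _ : ℝ => (1 : ℝ)) =O[𝓝[>] 0] M)
    (hN : N =o[𝓝[>] 0] M) :
    Tendsto (fun s => ((M s : ℂ) + Complex.I * N s) / ((M s : ℂ) - Complex.I * N s)) (𝓝[>] 0)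
      (𝓝 1) := by
  have hq : Tendsto (fun s => ((N s / M s : ℝ) : ℂ)) (𝓝[>] 0) (𝓝 ((0 : ℝ) : ℂ)) :=
    (Complex.continuous_ofReal.tendsto 0).comp hN.tendsto_div_nhds_zero
  have hne : ∀ᶠ s in 𝓝[>] 0, M s ≠ 0 := by
    obtain ⟨c, hc⟩ := h1.bound
    filter_upwards [hc] with s hs h0
    rw [h0] at hs
    norm_num at hs
  have h := (hq.const_mul Complex.I).const_add 1 |>.div ((hq.const_mul Complex.I).const_sub 1)
    (by simp)
  simp only [Complex.ofReal_zero, mul_zero, add_zero, sub_zero, div_one] at h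
  refine h.congr' ?_
  filter_upwards [hne] with s hs
  have hs' : (M s : ℂ) ≠ 0 := by exact_mod_cast hs
  simp only [Pi.div_apply]
  push_cast
  rw [← mul_div_mul_left _ _ hs']
  congr 1 <;> field_simp

lemma tendsto_cayley_of_const {M N : ℝ → ℝ} {m : ℝ} (hm : m ≠ 0)
    (hM : (fun s => M s - m) =O[𝓝[>] 0] fun s : ℝ => s * Real.log s)
    (hN : N =O[𝓝[>] 0] fun s : ℝ => s) :
    Tendsto (fun s => ((M s : ℂ) + Complex.I * N s) / ((M s : ℂ) - Complex.I * N s)) (𝓝[>] 0)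
      (𝓝 1) := by
  have hMlim : Tendsto M (𝓝[>] 0) (𝓝 m) := by
    simpa using (hM.trans_tendsto tendsto_mul_log_zero).add_const m
  have h1 : (fun _ : ℝ => (1 : ℝ)) =O[𝓝[>] 0] M := by
    have := (hMlim.inv₀ hm).isBigO_one ℝ
    refine (this.mul (isBigO_refl M _)).congr' ?_ (Eventually.of_forall fun s => one_mul _)
    filter_upwards [hMlim.eventually_ne hm] with s hs using inv_mul_cancel₀ hs
  refine tendsto_cayley h1 (IsLittleO.trans_isBigO ?_ h1)
  exact (isLittleO_one_iff ℝ).2 (hN.trans_tendsto (tendsto_id.mono_left nhdsWithin_le_nhds))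

lemma tendsto_cayley_of_log {M N : ℝ → ℝ} {c k : ℝ} (hc : c ≠ 0)
    (hM : (fun s => M s - c * (Real.log s + k)) =O[𝓝[>] 0] fun s : ℝ => s * Real.log s)
    (hN : (fun s => N s - π * c) =O[𝓝[>] 0] fun s : ℝ => s) :
    Tendsto (fun s => ((M s : ℂ) + Complex.I * N s) / ((M s : ℂ) - Complex.I * N s)) (𝓝[>] 0)
      (𝓝 1) := by
  have hlog : Real.log =O[𝓝[>] 0] fun s => c * (Real.log s + k) :=
    (isBigO_log_add_const k).trans (isBigO_self_const_mul hc _ _)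
  have hequiv : IsEquivalent (𝓝[>] 0) M fun s => c * (Real.log s + k) := by
    refine IsBigO.trans_isLittleO hM (IsLittleO.trans_isBigO ?_ hlog)
    simpa using ((isLittleO_one_iff ℝ).2 (tendsto_id.mono_left
      (nhdsWithin_le_nhds (a := (0 : ℝ)) (s := Ioi 0)))).mul_isBigO (isBigO_refl Real.log _)
  have hlogM : Real.log =O[𝓝[>] 0] M := hlog.trans hequiv.isBigO_symm
  have h1 : (fun _ : ℝ => (1 : ℝ)) =o[𝓝[>] 0] Real.log :=
    isLittleO_const_left.2 (Or.inr (tendsto_abs_atBot_atTop.comp tendsto_log_atBot))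
  have hN1 : N =O[𝓝[>] 0] fun _ : ℝ => (1 : ℝ) := by
    simpa using (hN.trans isBigO_self_one).add
      (isBigO_const_const (π * c) one_ne_zero (𝓝[>] (0 : ℝ)))
  exact tendsto_cayley (isBigO_one_log.trans hlogM)
    (hN1.trans_isLittleO (h1.trans_isBigO hlogM))

lemma scatteringEigenvalue_eq_scaled (n : ℕ) (A : ℝ) {s x : ℝ} (hs : 0 < s) (hx : x ≠ 0) :
    scatteringEigenvalue n A s =
      (((matchMh n A s / x : ℝ) : ℂ) + Complex.I * (matchNh n A s / x : ℝ)) /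
        (((matchMh n A s / x : ℝ) : ℂ) - Complex.I * (matchNh n A s / x : ℝ)) := by
  have hx' : (s : ℂ) ^ n / x ≠ 0 :=
    div_ne_zero (pow_ne_zero _ (by exact_mod_cast hs.ne')) (by exact_mod_cast hx)
  rw [scatteringEigenvalue, ← mul_div_mul_left _ _ hx']
  congr 1
  · rw [matchMh, matchNh]
    push_cast
    ring
  · rw [matchMh, matchNh]
    push_cast
    ring

lemma tendsto_scatteringEigenvalue (n : ℕ) {A : ℝ} (hA : 0 < A) :
    Tendsto (scatteringEigenvalue n A) (𝓝[>] 0) (𝓝 1) := by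
  have hev1 : ∀ n, (fun s => (((matchMh n A s : ℝ) : ℂ) + Complex.I * (matchNh n A s : ℝ)) /
        (((matchMh n A s : ℝ) : ℂ) - Complex.I * (matchNh n A s : ℝ))) =ᶠ[𝓝[>] 0]
        scatteringEigenvalue n A := by
    intro n
    filter_upwards [eventually_pos] with s hs
    rw [scatteringEigenvalue_eq_scaled n A hs one_ne_zero]
    simp
  have hev2 : ∀ n, (fun s => (((matchMh n A s / s : ℝ) : ℂ) + Complex.I * (matchNh n A s / s : ℝ)) /
        (((matchMh n A s / s : ℝ) : ℂ) - Complex.I * (matchNh n A s / s : ℝ))) =ᶠ[𝓝[>] 0]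
        scatteringEigenvalue n A := by
    intro n
    filter_upwards [eventually_pos] with s hs
    rw [← scatteringEigenvalue_eq_scaled n A hs hs.ne']
  rcases n with _ | m
  · refine Tendsto.congr' (hev1 0) ?_
    by_cases h1 : besselC 1 A = 0
    · have h0 : besselC 0 A ≠ 0 := (besselC_ne_zero_or 0 hA).resolve_right fun h => h h1
      refine tendsto_cayley_of_const h0 ?_ ?_
      · simpa [h1] using isBigO_matchMh_zero hA
      · simpa [h1] using isBigO_matchNh_zero hA
    · have hc : A * besselC 1 A ≠ 0 := mul_ne_zero hA.ne' h1
      refine tendsto_cayley_of_log (k := 2 * Real.eulerMascheroniConstant +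
        besselC 0 A / (A * besselC 1 A)) hc ?_ (isBigO_matchNh_zero hA)
      refine (isBigO_matchMh_zero hA).congr_left fun s => ?_
      field_simp
      ring
  · by_cases h0 : besselC m A = 0
    · refine Tendsto.congr' (hev2 (m + 1)) ?_
      have hsucc := besselC_succ_ne_zero hA h0
      rcases m with _ | m
      · exact tendsto_cayley_of_log hsucc (isBigO_matchMh_one_div hA h0)
          (isBigO_matchNh_one_div hA h0)
      · exact tendsto_cayley_of_const (neg_ne_zero.2 (mul_ne_zero hsucc (by positivity)))
          (isBigO_matchMh_succ_succ_div m hA h0) (isBigO_matchNh_succ_succ_div m A)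
    · refine Tendsto.congr' (hev1 (m + 1)) ?_
      exact tendsto_cayley_of_const (mul_ne_zero (by positivity) h0) (isBigO_matchMh_succ m hA)
        ((isBigO_matchNh_succ m A).trans (isBigO_pow_succ m))

/-! ### Bounds for large angular momentum -/

/-- The remainder after the constant term carries the factor 1/(n+1)!, so the relative deviation of
C_n from 1/n! is O(1/n) locally uniformly. -/
lemma abs_besselC_sub_le (n : ℕ) (s : ℝ) :
    |besselC n s - 1 / (n ! : ℝ)| ≤ |s| * Real.exp |s| / ((n : ℝ) + 1) * (1 / (n ! : ℝ)) := by
  have hb : ∀ k, |1 / ((n + 1 + k)! : ℝ) / ((k : ℝ) + 1)| ≤ 1 / ((n + 1)! : ℝ) := by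
    intro k
    rw [abs_div, abs_of_pos (by positivity : (0 : ℝ) < (k : ℝ) + 1)]
    exact (div_le_self (abs_nonneg _) (by simp)).trans (abs_coeffC_le (n + 1) k)
  have h : besselC n s = 1 / (n ! : ℝ) -
      s * altExp (fun k => 1 / ((n + 1 + k)! : ℝ) / ((k : ℝ) + 1)) s := by
    rw [besselC, altExp_sub_coeff_zero (abs_coeffC_le n) s]
    simp only [add_zero, add_assoc, add_comm 1]
  rw [h, sub_sub_cancel_left, abs_neg, abs_mul]
  refine (mul_le_mul_of_nonneg_left (abs_altExp_le hb s) (abs_nonneg s)).trans (le_of_eq ?_)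
  rw [Nat.factorial_succ]
  push_cast
  field_simp

lemma eventually_factorial_le_besselC (T : ℝ) :
    ∀ᶠ n : ℕ in atTop, ∀ t ∈ Icc 0 T, 1 / (2 * (n ! : ℝ)) ≤ besselC n t := by
  have h : ∀ᶠ n : ℕ in atTop, 2 * (T * Real.exp T) ≤ (n : ℝ) :=
    tendsto_natCast_atTop_atTop.eventually_ge_atTop _
  filter_upwards [h] with n hn t ht
  have hb := (abs_le.1 (abs_besselC_sub_le n t)).1
  rw [abs_of_nonneg ht.1] at hb
  have hT : t * Real.exp t ≤ T * Real.exp T :=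
    mul_le_mul ht.2 (Real.exp_le_exp.2 ht.2) (Real.exp_pos _).le (ht.1.trans ht.2)
  have hq : t * Real.exp t / ((n : ℝ) + 1) ≤ 1 / 2 := by
    rw [div_le_iff₀ (by positivity)]
    linarith
  have hmul := mul_le_mul_of_nonneg_right hq (show (0 : ℝ) ≤ 1 / (n ! : ℝ) by positivity)
  have he : 1 / (2 * (n ! : ℝ)) = 1 / 2 * (1 / (n ! : ℝ)) := by field_simp
  rw [he]
  linarith

lemma exists_abs_mul_log_le (S : ℝ) : ∃ K, 0 ≤ K ∧ ∀ s ∈ Ioc 0 S, |s * Real.log s| ≤ K := by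
  obtain ⟨K, hK⟩ := (isCompact_Icc (a := (0 : ℝ)) (b := S)).exists_bound_of_continuousOn
    Real.continuous_mul_log.continuousOn
  exact ⟨max K 0, le_max_right _ _, fun s hs =>
    (hK s ⟨hs.1.le, hs.2⟩).trans (le_max_left _ _)⟩

/-- One of the n + 1 powers of s tames the logarithm. What remains grows only geometrically and is
eventually negligible against the n! of the finite sum. -/
lemma exists_abs_log_part_le (S : ℝ) : ∃ K, 0 ≤ K ∧ ∀ (n : ℕ), ∀ s ∈ Ioc 0 S,
    |s ^ (n + 1) * (Real.log s * besselC (n + 1) s - besselE (n + 1) s)| ≤ K * S ^ n := by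
  obtain ⟨K, hK, h⟩ := exists_abs_mul_log_le S
  refine ⟨K * Real.exp |S| + |S| * (4 * Real.exp |S|), by positivity, fun n s hs => ?_⟩
  have hsS : |s| ≤ |S| := by
    rw [abs_of_pos hs.1]
    exact hs.2.trans (le_abs_self S)
  have hexp : Real.exp |s| ≤ Real.exp |S| := Real.exp_le_exp.2 hsS
  have hC : |besselC (n + 1) s| ≤ Real.exp |S| := by
    refine (abs_besselC_le (n + 1) s).trans ?_
    have : 1 / ((n + 1)! : ℝ) ≤ 1 := by
      rw [div_le_one (by positivity)]
      exact_mod_cast Nat.one_le_iff_ne_zero.2 (Nat.factorial_ne_zero _)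
    calc 1 / ((n + 1)! : ℝ) * Real.exp |s| ≤ 1 * Real.exp |S| := by gcongr
      _ = _ := one_mul _
  have hE : |besselE (n + 1) s| ≤ 4 * Real.exp |S| :=
    (abs_besselE_le (n + 1) s).trans (by linarith)
  have hpow : |s ^ n| ≤ S ^ n := by
    rw [abs_of_nonneg (pow_nonneg hs.1.le n)]
    exact pow_le_pow_left₀ hs.1.le hs.2 n
  have e : s ^ (n + 1) * (Real.log s * besselC (n + 1) s - besselE (n + 1) s) =
      (s * Real.log s * besselC (n + 1) s - s * besselE (n + 1) s) * s ^ n := by ring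
  rw [e, abs_mul]
  refine mul_le_mul ((abs_sub _ _).trans ?_) hpow (abs_nonneg _) (by positivity)
  rw [abs_mul (s * Real.log s), abs_mul s (besselE _ _)]
  exact add_le_add (mul_le_mul (h s hs) hC (abs_nonneg _) hK)
    (mul_le_mul hsS hE (abs_nonneg _) (abs_nonneg _))

lemma factorial_le_sum_besselDh (n : ℕ) {s : ℝ} (hs : 0 ≤ s) :
    (n ! : ℝ) ≤ ∑ k ∈ Finset.range (n + 1), ((n + 1 - k - 1)! : ℝ) / (k ! : ℝ) * s ^ k := by
  have h := Finset.single_le_sum (f := fun k => ((n + 1 - k - 1)! : ℝ) / (k ! : ℝ) * s ^ k)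
    (s := Finset.range (n + 1)) (fun k _ => by positivity) (Finset.mem_range.2 n.succ_pos)
  simpa using h

lemma sum_besselDh_le (n : ℕ) {s : ℝ} (hs : 0 ≤ s) :
    ∑ k ∈ Finset.range (n + 1), ((n + 1 - k - 1)! : ℝ) / (k ! : ℝ) * s ^ k ≤
      (n ! : ℝ) * Real.exp s := by
  have h := Real.sum_le_exp_of_nonneg hs (n + 1)
  refine le_trans ?_ (mul_le_mul_of_nonneg_left h (Nat.cast_nonneg _))
  rw [Finset.mul_sum]
  refine Finset.sum_le_sum fun k _ => ?_
  have : ((n + 1 - k - 1)! : ℝ) ≤ (n ! : ℝ) := by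
    exact_mod_cast Nat.factorial_le (by omega)
  calc ((n + 1 - k - 1)! : ℝ) / (k ! : ℝ) * s ^ k ≤ (n ! : ℝ) / (k ! : ℝ) * s ^ k := by gcongr
    _ = _ := by ring

lemma eventually_besselDh_bounds (S : ℝ) : ∀ᶠ n : ℕ in atTop, ∀ s ∈ Ioc 0 S,
    (n ! : ℝ) / 2 ≤ -besselDh (n + 1) s ∧
      -besselDh (n + 1) s ≤ (n ! : ℝ) * (Real.exp S + 1) := by
  obtain ⟨K, hK, h⟩ := exists_abs_log_part_le S
  have hlim : Tendsto (fun n : ℕ => K * (S ^ n / (n ! : ℝ))) atTop (𝓝 0) := by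
    simpa using (FloorSemiring.tendsto_pow_div_factorial_atTop S).const_mul K
  filter_upwards [hlim.eventually_le_const (show (0 : ℝ) < 1 / 2 by norm_num)] with n hn s hs
  have hf : (0 : ℝ) < (n ! : ℝ) := by positivity
  rw [← mul_div_assoc, div_le_iff₀ hf] at hn
  have hb := abs_le.1 ((h n s hs).trans hn)
  have hl := factorial_le_sum_besselDh n hs.1.le
  have hu := sum_besselDh_le n hs.1.le
  have hexp := mul_le_mul_of_nonneg_left (Real.exp_le_exp.2 hs.2) hf.le
  rw [besselDh_eq (n + 1) hs.1]
  constructor <;> linarith [hb.1, hb.2]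

lemma eventually_matchMh_ge {A : ℝ} (hA : 0 < A) (S : ℝ) : ∀ᶠ j : ℕ in atTop, ∀ s ∈ Ioc 0 S,
    1 / 8 ≤ matchMh (j + 2) A s := by
  have hD := eventually_besselDh_bounds S
  have hbig : ∀ᶠ j : ℕ in atTop, 8 * (|S| * Real.exp (|S| + A) * (Real.exp S + 1)) ≤ (j : ℝ) :=
    tendsto_natCast_atTop_atTop.eventually_ge_atTop _
  filter_upwards [hD, (tendsto_add_atTop_nat 1).eventually hD, hbig,
    (tendsto_add_atTop_nat 1).eventually (eventually_factorial_le_besselC (|S| + A))]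
    with j h1 h2 hj hC s hs
  have hsS : s ≤ |S| := hs.2.trans (le_abs_self S)
  have hτ : s + A ∈ Icc 0 (|S| + A) := ⟨by linarith [hs.1], by linarith⟩
  obtain ⟨-, hu⟩ := h1 s hs
  obtain ⟨hl, -⟩ := h2 s hs
  have hc := hC (s + A) hτ
  have hc2 : |besselC (j + 2) (s + A)| ≤ 1 / ((j + 2)! : ℝ) * Real.exp (|S| + A) := by
    refine (abs_besselC_le (j + 2) (s + A)).trans ?_
    rw [abs_of_nonneg hτ.1]
    have := Real.exp_le_exp.2 hτ.2
    gcongr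
  have hpos : 0 ≤ -besselDh (j + 1) s := le_trans (by positivity) (h1 s hs).1
  have hf : (0 : ℝ) < ((j + 1)! : ℝ) := by positivity
  -- The factorials cancel: C_{j+1} is at least 1/(2(j+1)!) and the other factor at least (j+1)!/2.
  have hmain : 1 / 4 ≤ besselC (j + 1) (s + A) * -besselDh (j + 2) s := by
    have := mul_le_mul hc hl (by positivity) (le_trans (by positivity) hc)
    refine le_trans (le_of_eq ?_) this
    field_simp
    norm_num
  -- In the other term the factorials leave 1/((j+1)(j+2)), which beats any constant depending only
  -- on S and A.
  have herr : s * besselC (j + 2) (s + A) * -besselDh (j + 1) s ≤ 1 / 8 := by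
    have h3 : s * besselC (j + 2) (s + A) ≤ |S| * (1 / ((j + 2)! : ℝ) * Real.exp (|S| + A)) :=
      (mul_le_mul_of_nonneg_left ((le_abs_self _).trans hc2) hs.1.le).trans
        (mul_le_mul_of_nonneg_right hsS (by positivity))
    have h4 := mul_le_mul h3 hu hpos (by positivity)
    refine h4.trans ?_
    have h5 : |S| * (1 / ((j + 2)! : ℝ) * Real.exp (|S| + A)) * ((j ! : ℝ) * (Real.exp S + 1)) =
        |S| * Real.exp (|S| + A) * (Real.exp S + 1) / (((j : ℝ) + 2) * ((j : ℝ) + 1)) := by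
      rw [Nat.factorial_succ, Nat.factorial_succ]
      push_cast
      field_simp
      ring
    rw [h5, div_le_iff₀ (by positivity)]
    nlinarith [(Nat.cast_nonneg j : (0 : ℝ) ≤ j)]
  have e := matchMh_succ (j + 1) A hs.1
  rw [show j + 1 + 1 = j + 2 by ring] at e
  rw [e]
  linarith

/-- For large angular momentum the phase densities are summable, uniformly on `(0, S]`. -/
lemma exists_phaseDensity_le {A : ℝ} (hA : 0 < A) (S : ℝ) : ∃ K, 0 ≤ K ∧
    ∀ᶠ j : ℕ in atTop, ∀ s ∈ Ioc 0 S,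
      |phaseDensity (j + 2) A s| ≤ s * (K * (S ^ j / (j ! : ℝ))) := by
  refine ⟨64 * A * Real.exp (|S| + A) ^ 2, by positivity, ?_⟩
  filter_upwards [eventually_matchMh_ge hA S] with j hM s hs
  have hsS : s ≤ |S| := hs.2.trans (le_abs_self S)
  have hC : ∀ n, |besselC n (s + A)| ≤ 1 / (n ! : ℝ) * Real.exp (|S| + A) := by
    intro n
    refine (abs_besselC_le n (s + A)).trans ?_
    rw [abs_of_pos (by linarith [hs.1])]
    gcongr
  have hC1 := hC (j + 1)
  have hC3 := hC (j + 3)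
  -- The square of the lower bound 1/8 for the determinant; it accounts for the constant 64.
  have hden : 1 / 64 ≤ matchMh (j + 2) A s ^ 2 + matchNh (j + 2) A s ^ 2 := by
    nlinarith [hM s hs, sq_nonneg (matchNh (j + 2) A s)]
  have hj1 : 1 / ((j + 1)! : ℝ) ≤ 1 / (j ! : ℝ) := (le_abs_self _).trans (abs_coeffC_le j 1)
  have hj3 : 1 / ((j + 3)! : ℝ) ≤ 1 := by
    simpa using (le_abs_self _).trans (abs_coeffC_le 0 (j + 3))
  have hpow : s ^ j ≤ S ^ j := pow_le_pow_left₀ hs.1.le hs.2 j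
  have hs0 := hs.1.le
  rw [phaseDensity_succ_eq (j + 1) A hs.1, abs_div, abs_of_pos (lt_of_lt_of_le (by norm_num) hden),
    div_le_iff₀ (lt_of_lt_of_le (by norm_num) hden), abs_mul, abs_mul, abs_mul, abs_of_pos hA,
    abs_of_nonneg (pow_nonneg hs0 _)]
  have hS : 0 ≤ S := hs0.trans hs.2
  calc A * |besselC (j + 1) (s + A)| * |besselC (j + 1 + 2) (s + A)| * s ^ (j + 1)
      ≤ A * (1 / (j ! : ℝ) * Real.exp (|S| + A)) * (1 * Real.exp (|S| + A)) * (S ^ j * s) := by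
        have hC1' := hC1.trans (mul_le_mul_of_nonneg_right hj1 (Real.exp_pos _).le)
        have hC3' := hC3.trans (mul_le_mul_of_nonneg_right hj3 (Real.exp_pos _).le)
        rw [pow_succ]
        gcongr
    _ = s * (64 * A * Real.exp (|S| + A) ^ 2 * (S ^ j / (j ! : ℝ))) * (1 / 64) := by ring
    _ ≤ _ := mul_le_mul_of_nonneg_left hden (by positivity)

/-! ### Phase shifts -/

/-- `f` is the continuous phase, vanishing at `0`, of the eigenvalue of the scattering matrix in
angular momentum `n`. -/
structure IsEigenphase (n : ℕ) (A ρ : ℝ) (f : ℝ → ℝ) : Prop where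
  continuousOn : ContinuousOn f (Ici 0)
  zero : f 0 = 0
  exp_eq : ∀ lam : ℝ, 0 < lam → Complex.exp (2 * (π : ℂ) * Complex.I * (f lam : ℂ)) =
    scatteringEigenvalue n A (lam ^ 2 * ρ ^ 2 / 4)

/-- The derivative of the phase shift in angular momentum `n`. -/
def eigenphaseDeriv (n : ℕ) (A ρ lam : ℝ) : ℝ :=
  lam * ρ ^ 2 / 2 * phaseDensity n A (lam ^ 2 * ρ ^ 2 / 4)

lemma hasDerivAt_scatteringEigenvalue_comp (n : ℕ) {A ρ lam : ℝ} (hA : 0 < A) (hρ : 0 < ρ)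
    (hlam : 0 < lam) :
    HasDerivAt (fun x : ℝ => scatteringEigenvalue n A (x ^ 2 * ρ ^ 2 / 4))
      (2 * π * Complex.I * (eigenphaseDeriv n A ρ lam : ℝ) *
        scatteringEigenvalue n A (lam ^ 2 * ρ ^ 2 / 4)) lam := by
  have hs : 0 < lam ^ 2 * ρ ^ 2 / 4 := by positivity
  have h1 : HasDerivAt (fun x : ℝ => x ^ 2 * ρ ^ 2 / 4) (lam * ρ ^ 2 / 2) lam := by
    refine (((hasDerivAt_pow 2 lam).mul_const (ρ ^ 2)).div_const 4).congr_deriv ?_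
    norm_num
    ring
  refine ((hasDerivAt_scatteringEigenvalue n hA hs).scomp lam h1).congr_deriv ?_
  rw [eigenphaseDeriv, Complex.real_smul]
  push_cast
  ring

lemma IsEigenphase.hasDerivAt {n : ℕ} {A ρ lam : ℝ} {f : ℝ → ℝ} (hf : IsEigenphase n A ρ f)
    (hA : 0 < A) (hρ : 0 < ρ) (hlam : 0 < lam) :
    HasDerivAt f (eigenphaseDeriv n A ρ lam) lam := by
  refine hasDerivAt_of_exp_eq (hf.continuousOn.continuousAt (Ici_mem_nhds hlam)) ?_
    (hasDerivAt_scatteringEigenvalue_comp n hA hρ hlam)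
  filter_upwards [Ioi_mem_nhds hlam] with x hx using hf.exp_eq x hx

lemma tendsto_sq_mul_zero {ρ : ℝ} (hρ : 0 < ρ) :
    Tendsto (fun lam : ℝ => lam ^ 2 * ρ ^ 2 / 4) (𝓝[>] 0) (𝓝[>] 0) := by
  refine tendsto_nhdsWithin_iff.2 ⟨?_, ?_⟩
  · have : Continuous fun lam : ℝ => lam ^ 2 * ρ ^ 2 / 4 := by fun_prop
    have h := this.tendsto 0
    simp only [ne_eq, OfNat.ofNat_ne_zero, not_false_eq_true, zero_pow, zero_mul, zero_div] at h
    exact h.mono_left nhdsWithin_le_nhds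
  · filter_upwards [eventually_pos] with lam hlam
    rw [mem_Ioi]
    positivity

/-- The eigenvalue has modulus one and tends to 1 at zero frequency. Extended by 1 to the
nonpositive half-line it is a continuous path in the circle, which lifts through the exponential
covering with initial value 0. -/
lemma exists_isEigenphase (n : ℕ) {A ρ : ℝ} (hA : 0 < A) (hρ : 0 < ρ) :
    ∃ f, IsEigenphase n A ρ f := by
  let g : ℝ → ℂ := fun x => if 0 < x then scatteringEigenvalue n A (x ^ 2 * ρ ^ 2 / 4) else 1
  have hgpos : ∀ {x}, 0 < x → g x = scatteringEigenvalue n A (x ^ 2 * ρ ^ 2 / 4) :=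
    fun hx => if_pos hx
  have hgnorm : ∀ x, g x ∈ Submonoid.unitSphere ℂ := by
    intro x
    refine mem_sphere_zero_iff_norm.2 ?_
    by_cases hx : 0 < x
    · rw [hgpos hx]
      exact norm_scatteringEigenvalue n hA (by positivity)
    · simp [g, hx]
  have hgcont : Continuous g := by
    rw [continuous_iff_continuousAt]
    intro x
    rcases lt_trichotomy x 0 with hx | hx | hx
    · refine (continuousAt_const (y := (1 : ℂ))).congr ?_
      filter_upwards [Iio_mem_nhds hx] with y hy
      exact (if_neg (not_lt.2 (le_of_lt hy))).symm
    · subst hx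
      have h0 : g 0 = 1 := if_neg (lt_irrefl 0)
      rw [continuousAt_iff_continuous_left'_right']
      constructor
      · refine (continuousWithinAt_const (b := (1 : ℂ))).congr (fun y hy => ?_) h0
        exact if_neg (not_lt.2 (le_of_lt hy))
      · rw [ContinuousWithinAt, h0]
        refine Tendsto.congr' ?_ ((tendsto_scatteringEigenvalue n hA).comp (tendsto_sq_mul_zero hρ))
        filter_upwards [eventually_pos] with y hy using (hgpos hy).symm
    · refine (hasDerivAt_scatteringEigenvalue_comp n hA hρ hx).continuousAt.congr ?_
      filter_upwards [Ioi_mem_nhds hx] with y hy using (hgpos hy).symm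
  let G : C(ℝ, Circle) := ⟨fun x => ⟨g x, hgnorm x⟩, hgcont.subtype_mk _⟩
  have hG : ∀ x, (G x : ℂ) = g x := fun _ => rfl
  obtain ⟨F, ⟨hF0, hF⟩, -⟩ := Circle.isCoveringMap_exp.existsUnique_continuousMap_lifts G 0 0 (by
    ext
    rw [hG]
    simp [g])
  have hpi : (π : ℂ) ≠ 0 := by exact_mod_cast Real.pi_ne_zero
  refine ⟨fun x => F x / (2 * π), ⟨?_, by simp [hF0], fun lam hlam => ?_⟩⟩
  · exact (F.continuous.div_const _).continuousOn
  · have h := congrArg (fun z : Circle => (z : ℂ)) (congrFun hF lam)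
    simp only [Function.comp, Circle.coe_exp] at h
    rw [← hgpos hlam, ← hG, ← h]
    congr 1
    push_cast
    field_simp

lemma summable_comp_natAbs {g : ℕ → ℝ} (hg : Summable g) : Summable fun l : ℤ => g l.natAbs := by
  refine Summable.of_nat_of_neg ?_ ?_ <;> simpa using hg

/-- Uniform summable bounds for the derivatives of the phase shifts. -/
lemma exists_eigenphaseDeriv_le {A : ℝ} (ρ L : ℝ) (hA : 0 < A) (hρ : 0 < ρ) :
    ∃ (N : ℕ) (g : ℕ → ℝ), Summable g ∧ ∀ n, N ≤ n → ∀ lam ∈ Ioc 0 L,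
      |eigenphaseDeriv n A ρ lam| ≤ lam ^ 3 * g n := by
  obtain ⟨K, hK, h⟩ := exists_phaseDensity_le hA (L ^ 2 * ρ ^ 2 / 4)
  obtain ⟨N, hN⟩ := eventually_atTop.1 h
  -- The constant ρ⁴/8 is the chain-rule factor λρ²/2 times s = λ²ρ²/4, with λ³ taken out.
  refine ⟨N + 2, fun n => ρ ^ 4 / 8 * (K * ((L ^ 2 * ρ ^ 2 / 4) ^ (n - 2) / ((n - 2)! : ℝ))),
    ?_, fun n hn lam hlam => ?_⟩
  · refine Summable.mul_left _ (Summable.mul_left _ ?_)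
    rw [← summable_nat_add_iff 2]
    exact Real.summable_pow_div_factorial _
  · obtain ⟨j, rfl⟩ : ∃ j, n = j + 2 := ⟨n - 2, by omega⟩
    have hlam0 := hlam.1
    have hs : lam ^ 2 * ρ ^ 2 / 4 ∈ Ioc 0 (L ^ 2 * ρ ^ 2 / 4) :=
      ⟨by positivity, by have := hlam.2; gcongr⟩
    have hb := hN j (by omega) _ hs
    rw [eigenphaseDeriv, abs_mul, abs_of_pos (by positivity : 0 < lam * ρ ^ 2 / 2)]
    simp only [Nat.add_sub_cancel]
    refine (mul_le_mul_of_nonneg_left hb (by positivity)).trans (le_of_eq ?_)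
    ring

/-- The normalisation f(0) = 0 and the mean value theorem turn a bound on the derivative into a
bound on the phase; this selects the branch for which the series converges. -/
lemma IsEigenphase.abs_le {n : ℕ} {A ρ lam B : ℝ} {f : ℝ → ℝ} (hf : IsEigenphase n A ρ f)
    (hA : 0 < A) (hρ : 0 < ρ) (hlam : 0 < lam)
    (hB : ∀ x ∈ Ioc 0 lam, |eigenphaseDeriv n A ρ x| ≤ x ^ 3 * B) : |f lam| ≤ lam ^ 4 * |B| := by
  obtain ⟨c, hc, h⟩ := exists_hasDerivAt_eq_slope f (eigenphaseDeriv n A ρ) hlam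
    (hf.continuousOn.mono Icc_subset_Ici_self) fun x hx => hf.hasDerivAt hA hρ hx.1
  rw [hf.zero, sub_zero, sub_zero, eq_div_iff hlam.ne'] at h
  rw [← h, abs_mul, abs_of_pos hlam]
  have h1 : |eigenphaseDeriv n A ρ c| ≤ lam ^ 3 * |B| := by
    refine (hB c ⟨hc.1, hc.2.le⟩).trans ?_
    exact (mul_le_mul_of_nonneg_left (le_abs_self B) (pow_nonneg hc.1.le 3)).trans
      (mul_le_mul_of_nonneg_right (pow_le_pow_left₀ hc.1.le hc.2.le 3) (abs_nonneg B))
  calc _ ≤ lam ^ 3 * |B| * lam := mul_le_mul_of_nonneg_right h1 hlam.le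
    _ = _ := by ring

lemma finite_natAbs_lt (N : ℕ) : {l : ℤ | l.natAbs < N}.Finite := by
  refine (Set.finite_Ioo (-(N : ℤ)) N).subset fun l hl => ?_
  rw [mem_Ioo]
  change l.natAbs < N at hl
  omega

lemma summable_eigenphase {A ρ : ℝ} (hA : 0 < A) (hρ : 0 < ρ) {f : ℤ → ℝ → ℝ}
    (hf : ∀ l, IsEigenphase l.natAbs A ρ (f l)) {lam : ℝ} (hlam : 0 ≤ lam) :
    Summable fun l => f l lam := by
  rcases hlam.eq_or_lt with rfl | hlam
  · simp [(hf _).zero]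
  · obtain ⟨N, g, hg, h⟩ := exists_eigenphaseDeriv_le ρ lam hA hρ
    refine Summable.of_norm_bounded_eventually (summable_comp_natAbs (hg.abs.mul_left (lam ^ 4))) ?_
    refine (finite_natAbs_lt N).subset fun l hl => ?_
    by_contra hlN
    exact hl ((hf l).abs_le hA hρ hlam (h l.natAbs (not_lt.1 hlN)))

lemma exists_isScatteringPhase {a ρ : ℝ} (ha : 0 < a) (hρ : 0 < ρ) :
    ∃ σ : ℝ → ℝ, IsScatteringPhase (circularWell a ρ) σ := by
  have hA : 0 < a ^ 2 * ρ ^ 2 / 4 := by positivity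
  choose! S hS hSe using fun (lam : ℝ) (hlam : 0 < lam) => exists_scatteringMatrix ha hρ hlam
  choose f hf using fun n : ℕ => exists_isEigenphase n hA hρ
  refine ⟨fun lam => ∑' l : ℤ, f l.natAbs lam, S, hS, fun l => f l.natAbs, fun l => ?_,
    fun lam hlam => (summable_eigenphase hA hρ (fun l => hf l.natAbs) hlam).hasSum⟩
  refine ⟨(hf _).continuousOn, (hf _).zero, fun lam hlam => ?_⟩
  rw [(hf _).exp_eq lam hlam]
  exact hSe lam hlam l

lemma isEigenphase_of_isPhaseShift {a ρ : ℝ} (ha : 0 < a) (hρ : 0 < ρ)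
    {S : ℝ → L2Circle →L[ℂ] L2Circle}
    (hS : ∀ lam : ℝ, 0 < lam → IsScatteringMatrix (circularWell a ρ) lam (S lam)) {l : ℤ}
    {f : ℝ → ℝ} (hf : IsPhaseShift S l f) : IsEigenphase l.natAbs (a ^ 2 * ρ ^ 2 / 4) ρ f :=
  ⟨hf.continuousOn, hf.zero, fun lam hlam =>
    (hS lam hlam).eigenvalue_eq ha hρ hlam (hf.eigenvalue lam hlam)⟩

/-- On bounded intervals the scattering phase is differentiable, and its derivative is that of
finitely many phase shifts up to a cubically small error. -/
lemma exists_hasDerivAt_scatteringPhase {a ρ : ℝ} (ha : 0 < a) (hρ : 0 < ρ) {σ : ℝ → ℝ}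
    (hσ : IsScatteringPhase (circularWell a ρ) σ) (L : ℝ) :
    ∃ (N : ℕ) (t : ℝ → ℝ) (K : ℝ), ∀ lam ∈ Ioo 0 L,
      HasDerivAt σ (∑ l ∈ Finset.Ioo (-(N + 3 : ℤ)) (N + 3),
        eigenphaseDeriv l.natAbs (a ^ 2 * ρ ^ 2 / 4) ρ lam + t lam) lam ∧
      |t lam| ≤ K * lam ^ 3 := by
  have hA : 0 < a ^ 2 * ρ ^ 2 / 4 := by positivity
  obtain ⟨S, hS, f, hf, hsum⟩ := hσ
  have hf' := fun l => isEigenphase_of_isPhaseShift ha hρ hS (hf l)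
  obtain ⟨N, g, hg, h⟩ := exists_eigenphaseDeriv_le ρ L hA hρ
  -- Outside this range |l| ≥ N, so the uniform bounds hold; the margin 3 ensures that |l| ≤ 2 is
  -- always included. Setting the terms in the range to zero lets the tail be treated as a series
  -- over all integers.
  set I := Finset.Ioo (-(N + 3 : ℤ)) (N + 3) with hI
  set D : ℤ → ℝ → ℝ := fun l lam =>
    if l ∈ I then 0 else eigenphaseDeriv l.natAbs (a ^ 2 * ρ ^ 2 / 4) ρ lam with hD
  set F : ℤ → ℝ → ℝ := fun l lam => if l ∈ I then 0 else f l lam with hF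
  have hFsum : ∀ lam, 0 ≤ lam → Summable fun l => F l lam := by
    intro lam hlam
    refine (hsum lam hlam).summable.abs.of_norm_bounded fun l => ?_
    simp only [hF]
    split_ifs <;> simp
  have hDb : ∀ l, ∀ lam ∈ Ioo 0 L, |D l lam| ≤ lam ^ 3 * |g l.natAbs| := by
    intro l lam hlam
    have := hlam.1
    simp only [hD]
    split_ifs with hl
    · rw [abs_zero]
      positivity
    · refine (h l.natAbs ?_ lam ⟨hlam.1, hlam.2.le⟩).trans ?_
      · rw [hI, Finset.mem_Ioo] at hl
        omega
      · have := le_abs_self (g l.natAbs)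
        gcongr
  have hgs := summable_comp_natAbs hg.abs
  refine ⟨N, fun lam => ∑' l, D l lam, ∑' l : ℤ, |g l.natAbs|, fun lam hlam => ⟨?_, ?_⟩⟩
  · have hL : 0 < L := hlam.1.trans hlam.2
    have h1 : HasDerivAt (fun x => ∑' l, F l x) (∑' l, D l lam) lam := by
      refine hasDerivAt_tsum_of_isPreconnected (hgs.mul_left (L ^ 3)) isOpen_Ioo
        isPreconnected_Ioo (fun l x hx => ?_) (fun l x hx => ?_) hlam (hFsum lam hlam.1.le) hlam
      · simp only [hF, hD]
        split_ifs
        · exact hasDerivAt_const x 0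
        · exact (hf' l).hasDerivAt hA hρ hx.1
      · refine (hDb l x hx).trans ?_
        have := hx.1.le
        have := hx.2.le
        gcongr
    have h2 : HasDerivAt (fun x => ∑ l ∈ I, f l x)
        (∑ l ∈ I, eigenphaseDeriv l.natAbs (a ^ 2 * ρ ^ 2 / 4) ρ lam) lam :=
      HasDerivAt.fun_sum fun l _ => (hf' l).hasDerivAt hA hρ hlam.1
    refine (h2.add h1).congr_of_eventuallyEq ?_
    filter_upwards [Ioi_mem_nhds hlam.1] with x hx
    have h3 : HasSum (fun l => if l ∈ I then f l x else 0) (∑ l ∈ I, f l x) := by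
      have h4 : HasSum (fun l => if l ∈ I then f l x else 0) (∑ l ∈ I, if l ∈ I then f l x else 0) :=
        hasSum_sum_of_ne_finset_zero fun l hl => if_neg hl
      rwa [Finset.sum_congr rfl fun l hl => if_pos hl] at h4
    refine (hsum x (le_of_lt hx)).unique ?_
    refine (h3.add (hFsum x (le_of_lt hx)).hasSum).congr_fun fun l => ?_
    simp only [hF]
    split_ifs <;> simp
  · have h1 : Summable fun l : ℤ => lam ^ 3 * |g l.natAbs| := hgs.mul_left _
    have h2 : ‖∑' l, D l lam‖ ≤ _ := tsum_of_norm_bounded h1.hasSum fun l => hDb l lam hlam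
    rw [tsum_mul_left, mul_comm] at h2
    exact h2

/-! ### From the variable `s` to the frequency -/

lemma log_sq_mul (ρ lam : ℝ) :
    Real.log (lam ^ 2 * ρ ^ 2 / 4) = 2 * Real.log (lam * ρ / 2) := by
  rw [show lam ^ 2 * ρ ^ 2 / 4 = (lam * ρ / 2) ^ 2 by ring, Real.log_pow]
  norm_num

lemma log_sq_mul' {ρ lam : ℝ} (hρ : 0 < ρ) (hlam : 0 < lam) :
    Real.log (lam ^ 2 * ρ ^ 2 / 4) = 2 * (Real.log lam + Real.log (ρ / 2)) := by
  rw [log_sq_mul, mul_div_assoc, Real.log_mul hlam.ne' (by positivity)]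

lemma isBigO_log_sq_mul {ρ : ℝ} (hρ : 0 < ρ) :
    (fun lam : ℝ => Real.log (lam ^ 2 * ρ ^ 2 / 4)) =O[𝓝[>] 0] Real.log := by
  have h : (fun lam => 2 * (Real.log lam + Real.log (ρ / 2))) =O[𝓝[>] 0] Real.log :=
    ((isBigO_refl _ _).add ((isBigO_const_const _ one_ne_zero _).trans isBigO_one_log)).const_mul_left 2
  refine h.congr' ?_ EventuallyEq.rfl
  filter_upwards [eventually_pos] with lam hlam using (log_sq_mul' hρ hlam).symm

lemma isBigO_log_log_sq_mul {ρ : ℝ} (hρ : 0 < ρ) :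
    Real.log =O[𝓝[>] 0] fun lam : ℝ => Real.log (lam ^ 2 * ρ ^ 2 / 4) := by
  refine ((isBigO_log_add_const (Real.log (ρ / 2))).trans
    (isBigO_self_const_mul two_ne_zero _ _)).congr' EventuallyEq.rfl ?_
  filter_upwards [eventually_pos] with lam hlam using (log_sq_mul' hρ hlam).symm

lemma isBigO_eigenphaseDeriv_sub {n : ℕ} {A ρ c : ℝ} (hρ : 0 < ρ)
    (h : (fun s => phaseDensity n A s - c) =O[𝓝[>] 0] fun s : ℝ => s * Real.log s) :
    (fun lam => eigenphaseDeriv n A ρ lam - lam * ρ ^ 2 / 2 * c) =O[𝓝[>] 0]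
      fun lam : ℝ => lam ^ 3 * Real.log lam := by
  have h1 := h.comp_tendsto (tendsto_sq_mul_zero hρ)
  have h2 : (fun lam : ℝ => lam ^ 2 * ρ ^ 2 / 4 * Real.log (lam ^ 2 * ρ ^ 2 / 4)) =O[𝓝[>] 0]
      fun lam : ℝ => lam ^ 2 * Real.log lam := by
    refine IsBigO.mul ?_ (isBigO_log_sq_mul hρ)
    exact ((isBigO_refl (fun lam : ℝ => lam ^ 2) _).const_mul_left (ρ ^ 2 / 4)).congr_left
      fun lam => by ring
  have h3 := ((isBigO_refl (fun lam : ℝ => lam) (𝓝[>] 0)).const_mul_left (ρ ^ 2 / 2)).mul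
    (h1.trans h2)
  refine h3.congr (fun lam => ?_) fun lam => ?_
  · simp only [eigenphaseDeriv, Function.comp]
    ring
  · ring

lemma isBigO_eigenphaseDeriv {n : ℕ} {A ρ : ℝ} (hρ : 0 < ρ)
    (h : phaseDensity n A =O[𝓝[>] 0] fun s : ℝ => s * Real.log s) :
    eigenphaseDeriv n A ρ =O[𝓝[>] 0] fun lam : ℝ => lam ^ 3 * Real.log lam := by
  simpa using isBigO_eigenphaseDeriv_sub (c := 0) hρ (by simpa using h)

/-- The chain-rule factor is λρ²/2 = (2/λ) s, so the coefficient -1 of s times the density becomes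
-2/λ, while log s = 2 log(λρ/2). -/
lemma isBigO_eigenphaseDeriv_log {n : ℕ} {A ρ k : ℝ} (hρ : 0 < ρ)
    (h : (fun s => s * phaseDensity n A s - (-1) / ((Real.log s + k) ^ 2 + π ^ 2)) =O[𝓝[>] 0]
      fun s : ℝ => s / Real.log s ^ 2) :
    (fun lam => eigenphaseDeriv n A ρ lam -
      (-2 / lam) / ((2 * Real.log (lam * ρ / 2) + k) ^ 2 + π ^ 2)) =O[𝓝[>] 0]
      fun lam : ℝ => lam / Real.log lam ^ 2 := by
  have h1 := h.comp_tendsto (tendsto_sq_mul_zero hρ)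
  have hlog : (fun lam : ℝ => (Real.log (lam ^ 2 * ρ ^ 2 / 4))⁻¹) =O[𝓝[>] 0]
      fun lam => (Real.log lam)⁻¹ := by
    refine (isBigO_log_log_sq_mul hρ).inv_rev ?_
    filter_upwards [tendsto_log_atBot.eventually_lt_atBot 0] with lam hlam h0
    exact absurd h0 hlam.ne
  have h2 : (fun lam : ℝ => lam ^ 2 * ρ ^ 2 / 4 / Real.log (lam ^ 2 * ρ ^ 2 / 4) ^ 2) =O[𝓝[>] 0]
      fun lam : ℝ => lam ^ 2 / Real.log lam ^ 2 := by
    refine ((isBigO_refl (fun lam : ℝ => lam ^ 2) (𝓝[>] 0)).mul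
      ((hlog.pow 2).const_mul_left (ρ ^ 2 / 4))).congr (fun lam => ?_) fun lam => ?_
    · rw [inv_pow]
      ring
    · rw [inv_pow]
      ring
  have h3 := ((isBigO_refl (fun lam : ℝ => lam⁻¹) (𝓝[>] 0)).const_mul_left 2).mul (h1.trans h2)
  refine h3.congr' ?_ ?_
  · filter_upwards [eventually_pos] with lam hlam
    simp only [eigenphaseDeriv, Function.comp, log_sq_mul]
    field_simp
    ring
  · filter_upwards [eventually_pos] with lam hlam
    field_simp

lemma isBigO_cube_mul_log :
    (fun lam : ℝ => lam ^ 3 * Real.log lam) =O[𝓝[>] 0] fun lam : ℝ => lam / Real.log lam ^ 2 := by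
  -- The quotient of the two sides is λ² log³ λ, the cube of λ^{2/3} log λ.
  have h0 := (tendsto_log_mul_rpow_nhdsGT_zero (show (0 : ℝ) < 2 / 3 by norm_num)).pow 3
  have h1 := (h0.isBigO_one ℝ).mul (isBigO_refl (fun lam : ℝ => lam / Real.log lam ^ 2) (𝓝[>] 0))
  refine h1.congr' ?_ (Eventually.of_forall fun lam => one_mul _)
  filter_upwards [eventually_pos, tendsto_log_atBot.eventually_lt_atBot 0] with lam hlam hlog
  have : (lam ^ (2 / 3 : ℝ)) ^ 3 = lam ^ 2 := by
    rw [← Real.rpow_natCast, ← Real.rpow_mul hlam.le]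
    norm_num
  have hne := hlog.ne
  rw [mul_pow, this]
  field_simp

lemma isBigO_div_log_sq : (fun lam : ℝ => lam / Real.log lam ^ 2) =O[𝓝[>] 0] fun lam : ℝ => lam := by
  have h : (fun lam => (Real.log lam)⁻¹) =O[𝓝[>] 0] fun _ : ℝ => (1 : ℝ) :=
    (tendsto_log_atBot.inv_tendsto_atBot).isBigO_one ℝ
  refine ((isBigO_refl (fun lam : ℝ => lam) (𝓝[>] 0)).mul (h.pow 2)).congr (fun lam => ?_) fun lam => ?_
  · rw [inv_pow, div_eq_mul_inv]
  · ring

/-! ### The derivative of the scattering phase at low frequency -/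

lemma differentiableOn_scatteringPhase {a ρ : ℝ} (ha : 0 < a) (hρ : 0 < ρ) {σ : ℝ → ℝ}
    (hσ : IsScatteringPhase (circularWell a ρ) σ) : DifferentiableOn ℝ σ (Ioi 0) := by
  intro lam hlam
  obtain ⟨N, t, K, h⟩ := exists_hasDerivAt_scatteringPhase ha hρ hσ (lam + 1)
  exact (h lam ⟨hlam, by linarith⟩).1.differentiableAt.differentiableWithinAt

/-- Finitely many modes with |l| ≥ 3 are each O(λ³ log λ), and the infinite tail is O(λ³). The
factors 2 count the modes l and -l. -/
lemma isBigO_deriv_scatteringPhase {a ρ : ℝ} (ha : 0 < a) (hρ : 0 < ρ) {σ : ℝ → ℝ}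
    (hσ : IsScatteringPhase (circularWell a ρ) σ) :
    (fun lam => deriv σ lam - (eigenphaseDeriv 0 (a ^ 2 * ρ ^ 2 / 4) ρ lam +
      2 * eigenphaseDeriv 1 (a ^ 2 * ρ ^ 2 / 4) ρ lam +
      2 * eigenphaseDeriv 2 (a ^ 2 * ρ ^ 2 / 4) ρ lam)) =O[𝓝[>] 0]
      fun lam : ℝ => lam ^ 3 * Real.log lam := by
  have hA : 0 < a ^ 2 * ρ ^ 2 / 4 := by positivity
  set A := a ^ 2 * ρ ^ 2 / 4
  obtain ⟨N, t, K, h⟩ := exists_hasDerivAt_scatteringPhase ha hρ hσ 1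
  have hev : ∀ᶠ lam : ℝ in 𝓝[>] 0, lam ∈ Ioo (0 : ℝ) 1 := Ioo_mem_nhdsGT one_pos
  have ht : t =O[𝓝[>] 0] fun lam : ℝ => lam ^ 3 * Real.log lam := by
    have h1 : t =O[𝓝[>] 0] fun lam : ℝ => lam ^ 3 := by
      refine IsBigO.of_bound K ?_
      filter_upwards [hev] with lam hlam
      rw [Real.norm_eq_abs, Real.norm_eq_abs, abs_of_pos (pow_pos hlam.1 3)]
      exact (h lam hlam).2
    refine h1.trans ?_
    simpa using (isBigO_refl (fun lam : ℝ => lam ^ 3) (𝓝[>] 0)).mul isBigO_one_log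
  have hsub : Finset.Icc (-2 : ℤ) 2 ⊆ Finset.Ioo (-(N + 3 : ℤ)) (N + 3) := by
    intro l hl
    rw [Finset.mem_Icc] at hl
    rw [Finset.mem_Ioo]
    omega
  have hrest : (fun lam => ∑ l ∈ Finset.Ioo (-(N + 3 : ℤ)) (N + 3) \ Finset.Icc (-2) 2,
      eigenphaseDeriv l.natAbs A ρ lam) =O[𝓝[>] 0] fun lam : ℝ => lam ^ 3 * Real.log lam := by
    refine IsBigO.fun_sum fun l hl => ?_
    obtain ⟨m, hm⟩ : ∃ m, l.natAbs = m + 3 := by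
      rw [Finset.mem_sdiff, Finset.mem_Icc] at hl
      exact ⟨l.natAbs - 3, by omega⟩
    rw [hm]
    exact isBigO_eigenphaseDeriv hρ (isBigO_phaseDensity_add_three m hA)
  refine (hrest.add ht).congr' ?_ EventuallyEq.rfl
  filter_upwards [hev] with lam hlam
  rw [(h lam hlam).1.deriv, ← Finset.sum_sdiff hsub,
    show Finset.Icc (-2 : ℤ) 2 = {-2, -1, 0, 1, 2} by decide]
  simp
  ring

section Asymptotics

variable {a ρ : ℝ} {σ : ℝ → ℝ}

lemma besselJ_zero_eq (a ρ : ℝ) : besselJ 0 (a * ρ) = besselC 0 (a ^ 2 * ρ ^ 2 / 4) := by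
  simp [besselJ, besselJNat_eq, mul_pow]

lemma besselJ_one_eq (a ρ : ℝ) :
    besselJ 1 (a * ρ) = a * ρ / 2 * besselC 1 (a ^ 2 * ρ ^ 2 / 4) := by
  simp [besselJ, besselJNat_eq, mul_pow]

lemma besselJ_two_eq (a ρ : ℝ) :
    besselJ 2 (a * ρ) = a ^ 2 * ρ ^ 2 / 4 * besselC 2 (a ^ 2 * ρ ^ 2 / 4) := by
  have h : besselJ 2 (a * ρ) = besselJNat 2 (a * ρ) := rfl
  rw [h, besselJNat_eq, mul_pow]
  ring

lemma isBigO_deriv_of_besselJ_zero_eq_zero (ha : 0 < a) (hρ : 0 < ρ)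
    (hσ : IsScatteringPhase (circularWell a ρ) σ) (hJ : besselJ 0 (a * ρ) = 0) :
    (fun lam : ℝ => deriv σ lam -
        ((-2 / lam) / (4 * (Real.log (lam * ρ / 2) + Real.eulerMascheroniConstant) ^ 2 + π ^ 2)
          + (-4 / lam) / (4 * (Real.log (lam * ρ / 2) - 1 / 2 + Real.eulerMascheroniConstant) ^ 2
              + π ^ 2))) =O[𝓝[>] 0] fun lam : ℝ => lam / Real.log lam ^ 2 := by
  have hA : 0 < a ^ 2 * ρ ^ 2 / 4 := by positivity
  rw [besselJ_zero_eq] at hJ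
  have h1 := besselC_succ_ne_zero hA hJ
  have e := (isBigO_deriv_scatteringPhase ha hρ hσ).trans isBigO_cube_mul_log
  have e0 := isBigO_eigenphaseDeriv_log hρ (isBigO_phaseDensity_zero hA h1)
  have e1 := isBigO_eigenphaseDeriv_log hρ (isBigO_phaseDensity_one_of_eq_zero hA hJ)
  have e2 := (isBigO_eigenphaseDeriv hρ (isBigO_phaseDensity_add_two 0 hA h1)).trans
    isBigO_cube_mul_log
  refine (((e.add e0).add (e1.const_mul_left 2)).add (e2.const_mul_left 2)).congr_left fun lam => ?_
  rw [hJ, show 4 * (Real.log (lam * ρ / 2) + Real.eulerMascheroniConstant) ^ 2 =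
      (2 * Real.log (lam * ρ / 2) + (2 * Real.eulerMascheroniConstant +
        0 / (a ^ 2 * ρ ^ 2 / 4 * besselC 1 (a ^ 2 * ρ ^ 2 / 4)))) ^ 2 by rw [zero_div]; ring,
    show 4 * (Real.log (lam * ρ / 2) - 1 / 2 + Real.eulerMascheroniConstant) ^ 2 =
      (2 * Real.log (lam * ρ / 2) + (2 * Real.eulerMascheroniConstant - 1)) ^ 2 by ring]
  ring

lemma isBigO_deriv_of_besselJ_one_eq_zero (ha : 0 < a) (hρ : 0 < ρ)
    (hσ : IsScatteringPhase (circularWell a ρ) σ) (hJ : besselJ 1 (a * ρ) = 0) :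
    (fun lam : ℝ => deriv σ lam - (-(3 / 2) * ρ ^ 2 * lam)) =O[𝓝[>] 0]
      fun lam : ℝ => lam ^ 3 * Real.log lam := by
  have hA : 0 < a ^ 2 * ρ ^ 2 / 4 := by positivity
  have h1 : besselC 1 (a ^ 2 * ρ ^ 2 / 4) = 0 := by
    rw [besselJ_one_eq] at hJ
    exact (mul_eq_zero.1 hJ).resolve_left (by positivity)
  have h0 : besselC 0 (a ^ 2 * ρ ^ 2 / 4) ≠ 0 :=
    (besselC_ne_zero_or 0 hA).resolve_right fun h => h h1
  have e := isBigO_deriv_scatteringPhase ha hρ hσ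
  have e0 := isBigO_eigenphaseDeriv hρ (isBigO_phaseDensity_zero_of_eq_zero hA h1)
  have e1 := isBigO_eigenphaseDeriv_sub hρ (isBigO_phaseDensity_one hA h0)
  have e2 := isBigO_eigenphaseDeriv_sub hρ (isBigO_phaseDensity_two_of_eq_zero hA h1)
  -- With C_1(A) = 0 the recurrence gives A C_2(A) = -C_0(A). The modes ±1 then contribute -ρ²λ and
  -- the modes ±2 contribute -ρ²λ/2, which add up to the coefficient -3/2.
  have hq : a ^ 2 * ρ ^ 2 / 4 * besselC 2 (a ^ 2 * ρ ^ 2 / 4) / besselC 0 (a ^ 2 * ρ ^ 2 / 4) = -1 := by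
    rw [div_eq_iff h0, besselC_recurrence 0]
    simp [h1]
  rw [hq] at e1
  refine (((e.add e0).add (e1.const_mul_left 2)).add (e2.const_mul_left 2)).congr_left fun lam => ?_
  ring

lemma isBigO_deriv_of_besselJ_ne_zero (ha : 0 < a) (hρ : 0 < ρ)
    (hσ : IsScatteringPhase (circularWell a ρ) σ) (hJ0 : besselJ 0 (a * ρ) ≠ 0)
    (hJ1 : besselJ 1 (a * ρ) ≠ 0) :
    (fun lam : ℝ => deriv σ lam -
        ((-2 / lam) / (4 * (Real.log (lam / 2) + wellConst ρ a + Real.eulerMascheroniConstant) ^ 2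
            + π ^ 2)
          + besselJ 2 (a * ρ) / besselJ 0 (a * ρ) * ρ ^ 2 * lam))
      =O[𝓝[>] 0] fun lam : ℝ => lam / Real.log lam ^ 2 := by
  have hA : 0 < a ^ 2 * ρ ^ 2 / 4 := by positivity
  have h0 : besselC 0 (a ^ 2 * ρ ^ 2 / 4) ≠ 0 := by rwa [besselJ_zero_eq] at hJ0
  have h1 : besselC 1 (a ^ 2 * ρ ^ 2 / 4) ≠ 0 := by
    rw [besselJ_one_eq] at hJ1
    exact right_ne_zero_of_mul hJ1
  have e := (isBigO_deriv_scatteringPhase ha hρ hσ).trans isBigO_cube_mul_log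
  have e0 := isBigO_eigenphaseDeriv_log hρ (isBigO_phaseDensity_zero hA h1)
  have e1 := (isBigO_eigenphaseDeriv_sub hρ (isBigO_phaseDensity_one hA h0)).trans
    isBigO_cube_mul_log
  have e2 := (isBigO_eigenphaseDeriv hρ (isBigO_phaseDensity_add_two 0 hA h1)).trans
    isBigO_cube_mul_log
  refine (((e.add e0).add (e1.const_mul_left 2)).add (e2.const_mul_left 2)).congr' ?_
    EventuallyEq.rfl
  filter_upwards [eventually_pos] with lam hlam
  -- Since J_1(aρ) = (aρ/2) C_1(A), the Bessel quotient in `wellConst` is half of C_0(A)/(A C_1(A));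
  -- the other half is supplied by log s = 2 log(λρ/2).
  have hlog : 4 * (Real.log (lam / 2) + wellConst ρ a + Real.eulerMascheroniConstant) ^ 2 =
      (2 * Real.log (lam * ρ / 2) + (2 * Real.eulerMascheroniConstant +
        besselC 0 (a ^ 2 * ρ ^ 2 / 4) /
          (a ^ 2 * ρ ^ 2 / 4 * besselC 1 (a ^ 2 * ρ ^ 2 / 4)))) ^ 2 := by
    have hl : Real.log (lam * ρ / 2) = Real.log (lam / 2) + Real.log ρ := by
      rw [← Real.log_mul (by positivity) hρ.ne']
      congr 1
      ring
    have hq : 1 / (a * ρ) * (besselC 0 (a ^ 2 * ρ ^ 2 / 4) /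
        (a * ρ / 2 * besselC 1 (a ^ 2 * ρ ^ 2 / 4))) = 1 / 2 * (besselC 0 (a ^ 2 * ρ ^ 2 / 4) /
          (a ^ 2 * ρ ^ 2 / 4 * besselC 1 (a ^ 2 * ρ ^ 2 / 4))) := by
      field_simp
      norm_num
    rw [wellConst, besselJ_zero_eq, besselJ_one_eq, hl, hq]
    ring
  rw [hlog, besselJ_zero_eq, besselJ_two_eq]
  ring

end Asymptotics

lemma isBigO_deriv_of_not_hasZeroResonance {a ρ : ℝ} {σ : ℝ → ℝ} (ha : 0 < a) (hρ : 0 < ρ)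
    (hσ : IsScatteringPhase (circularWell a ρ) σ)
    (hres : ¬ HasZeroResonance (circularWell a ρ)) :
    (fun lam : ℝ => deriv σ lam - (-1 / lam) * (2 / (4 * (Real.log lam +
        (wellConst ρ a - Real.log 2 + Real.eulerMascheroniConstant)) ^ 2 + π ^ 2)))
      =O[𝓝[>] 0] fun lam : ℝ => lam := by
  have hJ0 : besselJ 0 (a * ρ) ≠ 0 := fun h =>
    hres ((hasPResonance_iff hρ).2 (by rwa [← besselJ_zero_eq])).hasZeroResonance
  have hJ1 : besselJ 1 (a * ρ) ≠ 0 := fun h =>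
    hres ((hasSResonance_iff ha hρ).2 ((besselJ_one_eq_zero_iff ha hρ).1 h)).hasZeroResonance
  have e := (isBigO_deriv_of_besselJ_ne_zero ha hρ hσ hJ0 hJ1).trans isBigO_div_log_sq
  have e1 := (isBigO_refl (fun lam : ℝ => lam) (𝓝[>] 0)).const_mul_left
    (besselJ 2 (a * ρ) / besselJ 0 (a * ρ) * ρ ^ 2)
  refine (e.add e1).congr' ?_ EventuallyEq.rfl
  filter_upwards [eventually_pos] with lam hlam
  rw [Real.log_div hlam.ne' two_ne_zero, show Real.log lam +
      (wellConst ρ a - Real.log 2 + Real.eulerMascheroniConstant) =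
      Real.log lam - Real.log 2 + wellConst ρ a + Real.eulerMascheroniConstant by ring]
  ring

lemma isBigO_deriv_of_hasPResonance {a ρ : ℝ} {σ : ℝ → ℝ} (ha : 0 < a) (hρ : 0 < ρ)
    (hσ : IsScatteringPhase (circularWell a ρ) σ) (hres : HasPResonance (circularWell a ρ)) :
    (fun lam : ℝ => deriv σ lam - (-1 / lam) *
        (2 / (4 * (Real.log lam + Real.log (ρ / 2) + Real.eulerMascheroniConstant) ^ 2 + π ^ 2)
          + 1 / ((Real.log lam + Real.log (ρ / 2) + Real.eulerMascheroniConstant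
              - 1 / 2) ^ 2 + π ^ 2 / 4)))
      =O[𝓝[>] 0] fun lam : ℝ => lam := by
  have hJ : besselJ 0 (a * ρ) = 0 := by rwa [besselJ_zero_eq, ← hasPResonance_iff hρ]
  refine ((isBigO_deriv_of_besselJ_zero_eq_zero ha hρ hσ hJ).trans isBigO_div_log_sq).congr' ?_
    EventuallyEq.rfl
  filter_upwards [eventually_pos] with lam hlam
  set x := Real.log lam + Real.log (ρ / 2) + Real.eulerMascheroniConstant with hx
  have hl : Real.log (lam * ρ / 2) = Real.log lam + Real.log (ρ / 2) := by
    rw [mul_div_assoc, Real.log_mul hlam.ne' (by positivity)]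
  rw [hl, show Real.log lam + Real.log (ρ / 2) - 1 / 2 + Real.eulerMascheroniConstant = x - 1 / 2 by
    rw [hx]; ring, ← hx, show (x - 1 / 2) ^ 2 + π ^ 2 / 4 = (4 * (x - 1 / 2) ^ 2 + π ^ 2) / 4 by ring,
    one_div_div]
  ring

end CircularWell

end

theorem theorem3 (a ρ : ℝ) (ha : 0 < a) (hρ : 0 < ρ) :
    -- the scattering phase exists
    (∃ σ : ℝ → ℝ, IsScatteringPhase (circularWell a ρ) σ) ∧
    -- resonances at zero in terms of Bessel functions
    (HasPResonance (circularWell a ρ) ↔ besselJ 0 (a * ρ) = 0) ∧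
    (HasSResonance (circularWell a ρ) ↔ besselJ 1 (a * ρ) = 0) ∧
    -- asymptotics of the derivative of the scattering phase
    ∀ σ : ℝ → ℝ, IsScatteringPhase (circularWell a ρ) σ →
      DifferentiableOn ℝ σ (Ioi 0) ∧
      -- no resonance at zero
      (¬ HasZeroResonance (circularWell a ρ) →
        ∃ b : ℝ, b = wellConst ρ a - Real.log 2 + Real.eulerMascheroniConstant ∧
          (fun lam : ℝ => deriv σ lam -
              (-1 / lam) * (2 / (4 * (Real.log lam + b) ^ 2 + π ^ 2)))
            =O[𝓝[>] 0] fun lam : ℝ => lam) ∧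
      -- a `p`-resonance at zero
      (HasPResonance (circularWell a ρ) →
        (fun lam : ℝ => deriv σ lam -
            (-1 / lam) *
              (2 / (4 * (Real.log lam + Real.log (ρ / 2) + Real.eulerMascheroniConstant) ^ 2
                  + π ^ 2)
                + 1 / ((Real.log lam + Real.log (ρ / 2) + Real.eulerMascheroniConstant
                    - 1 / 2) ^ 2 + π ^ 2 / 4)))
          =O[𝓝[>] 0] fun lam : ℝ => lam) ∧
      -- an `s`-resonance at zero
      (HasSResonance (circularWell a ρ) →
        (fun lam : ℝ => deriv σ lam - (-(3 / 2) * ρ ^ 2 * lam))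
          =O[𝓝[>] 0] fun lam : ℝ => lam ^ 3 * Real.log lam) ∧
      -- the detailed expansions
      (besselJ 0 (a * ρ) = 0 →
        (fun lam : ℝ => deriv σ lam -
            ((-2 / lam) /
                (4 * (Real.log (lam * ρ / 2) + Real.eulerMascheroniConstant) ^ 2 + π ^ 2)
              + (-4 / lam) /
                (4 * (Real.log (lam * ρ / 2) - 1 / 2 + Real.eulerMascheroniConstant) ^ 2
                  + π ^ 2)))
          =O[𝓝[>] 0] fun lam : ℝ => lam / Real.log lam ^ 2) ∧
      (besselJ 1 (a * ρ) = 0 →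
        (fun lam : ℝ => deriv σ lam - (-(3 / 2) * ρ ^ 2 * lam))
          =O[𝓝[>] 0] fun lam : ℝ => lam ^ 3 * Real.log lam) ∧
      (besselJ 0 (a * ρ) ≠ 0 → besselJ 1 (a * ρ) ≠ 0 →
        (fun lam : ℝ => deriv σ lam -
            ((-2 / lam) /
                (4 * (Real.log (lam / 2) + wellConst ρ a + Real.eulerMascheroniConstant) ^ 2
                  + π ^ 2)
              + besselJ 2 (a * ρ) / besselJ 0 (a * ρ) * ρ ^ 2 * lam))
          =O[𝓝[>] 0] fun lam : ℝ => lam / Real.log lam ^ 2) := by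
  refine ⟨exists_isScatteringPhase ha hρ, ?_, ?_, fun σ hσ => ⟨?_, ?_, ?_, ?_, ?_, ?_, ?_⟩⟩
  · rw [hasPResonance_iff hρ, besselJ_zero_eq]
  · rw [hasSResonance_iff ha hρ, ← besselJ_one_eq_zero_iff ha hρ]
  · exact differentiableOn_scatteringPhase ha hρ hσ
  · intro hres
    refine ⟨_, rfl, isBigO_deriv_of_not_hasZeroResonance ha hρ hσ hres⟩
  · exact isBigO_deriv_of_hasPResonance ha hρ hσ
  · intro hres
    rw [hasSResonance_iff ha hρ, ← besselJ_one_eq_zero_iff ha hρ] at hres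
    exact isBigO_deriv_of_besselJ_one_eq_zero ha hρ hσ hres
  · exact isBigO_deriv_of_besselJ_zero_eq_zero ha hρ hσ
  · exact isBigO_deriv_of_besselJ_one_eq_zero ha hρ hσ
  · exact isBigO_deriv_of_besselJ_ne_zero ha hρ hσ
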